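/- Let $(X,\mathcal B,\mu)$ be a probability space and let $T:X\to X$ be an invertible, bimeasurable, $\mu$-preserving, ergodic and aperiodic transformation. Aperiodic means that there are no $n\ge 1$ and no $A\in\mathcal B$ with $\mu(A)>0$ such that $\mu(B\setminus T^{-n}B)=0$ for all measurable $B\subseteq A$; if countably many measurable sets separate the points of $X$ (for instance on a standard Borel or a Lebesgue space) this says that $\mu\{x: T^n x=x\}=0$ for every $n\ge1$. For $k\ge 2$ put $p_k=2^k$ if $k$ is even, $p_k=2^{k-1}+1$ if $k$ is odd, $d_k=2^{k^2}$ and $\alpha_k=\frac{1}{p_k\sqrt{k\log_2 k}}$. Call a sequence of measurable functions $\bar f_k:X\to\{-1,0,1\}$, $k\ge2$, a *coding sequence* if (a) for every $k\ge 2$ the functions $\bar f_k\circ T^j$, $0\le j\le 2d_k+p_k$, are independent and identically distributed with $\mu(\bar f_k=1)=\mu(\bar f_k=-1)=\alpha_k^2/2$; (b) for every $k\ge 3$ the finite sequence $(\bar f_k\circ T^j)_{0\le j\le 2d_k+p_k}$ is independent of the family $\{\bar f_l\circ T^j: 2\le l<k,\ 0\le j\le 2d_k+p_k\}$. For such a sequence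 let $$f_k=\sum_{i=0}^{p_k-1}\bar f_k\circ T^i-\Big(\sum_{i=0}^{p_k-1}\bar f_k\circ T^{i}\Big)\circ T^{d_k},\qquad g_k=\sum_{j=0}^{d_k-1}\sum_{i=0}^{p_k-1}\bar f_k\circ T^{i+j}.$$ **Theorem.** Coding sequences exist. For every coding sequence, each $f_k$ is a coboundary, $f_k=g_k-g_k\circ T$, and the series $\sum_{k\ge2}f_k$ converges almost everywhere (with only finitely many nonzero terms) and in $L^2(\mu)$ to a measurable function $f:X\to\mathbb Z$. This $f$ is square integrable with $\int f\,d\mu=0$ and satisfies the lattice local central limit theorem with $\sigma^2=2(\ln 2)^2$: writing $S_n(f)=\sum_{i=0}^{n-1}f\circ T^i$, $$\lim_{n\to\infty}\frac{\|S_n(f)\|_2^2}{n}=\sigma^2>0\qquad\text{and}\qquad \sup_{x\in\mathbb Z}\left|\sqrt n\,\mu\big(S_n(f)=x\big)-\frac{e^{-x^2/(2n\sigma^2)}}{\sqrt{2\pi\sigma^2}}\right|\xrightarrow[n\to\infty]{}0.$$ In particular, every ergodic, aperiodic, invertible probability-preserving system carries a square-integrable, mean-zero, $\mathbb Z$-valued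 function satisfying the lattice local central limit theorem. -/

import Mathlib

open MeasureTheory ProbabilityTheory Filter Topology

namespace LatticeLCLT

/-- `T` is aperiodic: no positive-measure set `A` and no `n ≥ 1` are such that `T^n` acts trivially
(modulo null sets) on the measurable subsets of `A`. This form makes sense on every probability
space; `isAperiodic_iff` below shows that it is the usual notion (the periodic points form a null
set) as soon as countably many measurable sets separate points, e.g. on a standard Borel space or
a Lebesgue space. -/
def IsAperiodic {X : Type*} [MeasurableSpace X] (T : X → X) (μ : Measure X) : Prop :=
  ∀ n : ℕ, 1 ≤ n → ∀ A : Set X, MeasurableSet A → μ A ≠ 0 →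
    ∃ B : Set X, B ⊆ A ∧ MeasurableSet B ∧ μ (B \ T^[n] ⁻¹' B) ≠ 0

theorem isAperiodic_iff {X : Type*} [MeasurableSpace X] [MeasurableSpace.CountablySeparated X]
    {T : X → X} (hT : Measurable T) (μ : Measure X) :
    IsAperiodic T μ ↔ ∀ n : ℕ, 1 ≤ n → μ {x | T^[n] x = x} = 0 := by
  obtain ⟨S, hSc, hSm, hS⟩ :=
    MeasurableSpace.CountablySeparated.countably_separated (α := X)
  have key : ∀ n : ℕ, {x | T^[n] x ≠ x} =
      (⋃ E ∈ S, (E \ T^[n] ⁻¹' E)) ∪ (⋃ E ∈ S, (Eᶜ \ T^[n] ⁻¹' Eᶜ)) := by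
    intro n
    ext x
    simp only [Set.mem_ofPred_eq, Set.mem_union, Set.mem_iUnion, Set.mem_sdiff, Set.mem_preimage,
      Set.mem_compl_iff, exists_prop, not_not]
    constructor
    · intro h
      by_contra hc
      push Not at hc
      exact h (hS _ trivial _ trivial fun E hE => ⟨hc.2 E hE |> fun h => by
        intro hx; by_contra hn; exact h hn hx, hc.1 E hE⟩)
    · rintro (⟨E, _, h1, h2⟩ | ⟨E, _, h1, h2⟩) h
      · rw [h] at h2; exact h2 h1
      · rw [h] at h2; exact h1 h2
  have hmeas : ∀ n : ℕ, MeasurableSet {x | T^[n] x = x} := by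
    intro n
    have h : MeasurableSet {x | T^[n] x ≠ x} := by
      rw [key n]
      refine (MeasurableSet.biUnion hSc fun E hE => ?_).union
        (MeasurableSet.biUnion hSc fun E hE => ?_)
      · exact (hSm E hE).diff ((hT.iterate n) (hSm E hE))
      · exact (hSm E hE).compl.diff ((hT.iterate n) (hSm E hE).compl)
    have h' := h.compl
    simpa [Set.compl_ofPred] using h'
  constructor
  · intro h n hn
    by_contra hpos
    obtain ⟨B, hBA, -, hB⟩ := h n hn _ (hmeas n) hpos
    apply hB
    have : B \ T^[n] ⁻¹' B = ∅ := by
      ext x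
      simp only [Set.mem_sdiff, Set.mem_preimage, Set.mem_empty_iff_false, iff_false, not_and,
        not_not]
      intro hx
      have h2 : T^[n] x = x := hBA hx
      rwa [h2]
    rw [this, measure_empty]
  · intro h n hn A hA hApos
    by_contra hc
    push Not at hc
    have hE : ∀ E, MeasurableSet E → μ (A ∩ (E \ T^[n] ⁻¹' E)) = 0 := by
      intro E hE
      refine measure_mono_null ?_ (hc (A ∩ E) Set.inter_subset_left (hA.inter hE))
      rintro x ⟨h1, h2, h3⟩
      exact ⟨⟨h1, h2⟩, fun h4 => h3 h4.2⟩
    apply hApos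
    have hsub : A ⊆ {x | T^[n] x = x} ∪
        ((⋃ E ∈ S, A ∩ (E \ T^[n] ⁻¹' E)) ∪ (⋃ E ∈ S, A ∩ (Eᶜ \ T^[n] ⁻¹' Eᶜ))) := by
      intro x hx
      by_cases hfix : T^[n] x = x
      · exact Or.inl hfix
      · right
        have hx' : x ∈ {x | T^[n] x ≠ x} := hfix
        rw [key n] at hx'
        simp only [Set.mem_union, Set.mem_iUnion, exists_prop] at hx' ⊢
        rcases hx' with ⟨E, h1, h2⟩ | ⟨E, h1, h2⟩
        · exact Or.inl ⟨E, h1, hx, h2⟩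
        · exact Or.inr ⟨E, h1, hx, h2⟩
    refine measure_mono_null hsub ?_
    refine measure_union_null (h n hn) (measure_union_null ?_ ?_)
    · exact (measure_biUnion_null_iff hSc).2 fun E hES => hE E (hSm E hES)
    · exact (measure_biUnion_null_iff hSc).2 fun E hES => hE Eᶜ (hSm E hES).compl

/-- A measurable function `f : X → ℤ` satisfies the lattice local central limit theorem with
asymptotic variance `σsq`. -/
structure SatisfiesLatticeLCLT {X : Type*} [MeasurableSpace X] (T : X → X) (μ : Measure X)
    (f : X → ℤ) (σsq : ℝ) : Prop where
  measurable : Measurable f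
  memLp : MemLp (fun x => (f x : ℝ)) 2 μ
  integral_eq_zero : ∫ x, (f x : ℝ) ∂μ = 0
  variance_pos : 0 < σsq
  tendsto_variance :
    Tendsto (fun n : ℕ => (∫ x, ((birkhoffSum T f n x : ℤ) : ℝ) ^ 2 ∂μ) / (n : ℝ)) atTop (𝓝 σsq)
  tendsto_iSup :
    Tendsto (fun n : ℕ => ⨆ x : ℤ,
      |√(n : ℝ) * μ.real {ω : X | birkhoffSum T f n ω = x}
        - Real.exp (-(x : ℝ) ^ 2 / (2 * (n : ℝ) * σsq)) / √(2 * Real.pi * σsq)|) atTop (𝓝 0)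

/-- `p_k = 2^k` for even `k` and `p_k = 2^(k-1) + 1` for odd `k`. -/
def p (k : ℕ) : ℕ := if Even k then 2 ^ k else 2 ^ (k - 1) + 1

/-- `d_k = 2^(k^2)`. -/
def d (k : ℕ) : ℕ := 2 ^ (k ^ 2)

/-- `α_k = 1 / (p_k √(k log₂ k))`, used for `k ≥ 2` only. -/
noncomputable def α (k : ℕ) : ℝ := 1 / ((p k : ℝ) * √((k : ℝ) * Real.logb 2 (k : ℝ)))

/-- The sequence of `{-1, 0, 1}`-valued functions `f̄_k`, `k ≥ 2` (values at `k = 0, 1` are unused).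
The windows are `0 ≤ j ≤ 2 d_k + p_k`. -/
structure IsCodingSequence {X : Type*} [MeasurableSpace X] (T : X → X) (μ : Measure X)
    (fbar : ℕ → X → ℤ) : Prop where
  measurable : ∀ k, 2 ≤ k → Measurable (fbar k)
  mem : ∀ k, 2 ≤ k → ∀ x, fbar k x = -1 ∨ fbar k x = 0 ∨ fbar k x = 1
  measure_one : ∀ k, 2 ≤ k → μ {x | fbar k x = 1} = ENNReal.ofReal (α k ^ 2 / 2)
  measure_neg_one : ∀ k, 2 ≤ k → μ {x | fbar k x = -1} = ENNReal.ofReal (α k ^ 2 / 2)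
  /-- `f̄_k ∘ T^j`, `0 ≤ j ≤ 2 d_k + p_k`, are identically distributed ... -/
  identDistrib : ∀ k, 2 ≤ k → ∀ j : Fin (2 * d k + p k + 1),
    IdentDistrib (fun x => fbar k (T^[j] x)) (fbar k) μ μ
  /-- ... and independent. -/
  indep : ∀ k, 2 ≤ k →
    iIndepFun (fun (j : Fin (2 * d k + p k + 1)) (x : X) => fbar k (T^[j] x)) μ
  /-- The vector `(f̄_k ∘ T^j)_j` is independent of the family `f̄_l ∘ T^j`, `2 ≤ l < k`,
  `0 ≤ j ≤ 2 d_k + p_k`. -/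
  indepFun_past : ∀ k, 2 ≤ k →
    IndepFun (fun (x : X) (j : Fin (2 * d k + p k + 1)) => fbar k (T^[j] x))
      (fun (x : X) (i : Finset.Ico 2 k × Fin (2 * d k + p k + 1)) =>
        fbar (i.1 : ℕ) (T^[i.2] x)) μ

/-- `f_k = ∑_{i < p_k} U^i f̄_k - U^{d_k} (∑_{i < p_k} U^i f̄_k)`, where `U g = g ∘ T`. -/
def block {X : Type*} (T : X → X) (fbar : ℕ → X → ℤ) (k : ℕ) (x : X) : ℤ :=
  birkhoffSum T (fbar k) (p k) x - birkhoffSum T (fbar k) (p k) (T^[d k] x)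

/-- `g_k = ∑_{j < d_k} ∑_{i < p_k} U^{i + j} f̄_k`. -/
def transfer {X : Type*} (T : X → X) (fbar : ℕ → X → ℤ) (k : ℕ) (x : X) : ℤ :=
  ∑ j ∈ Finset.range (d k), ∑ i ∈ Finset.range (p k), fbar k (T^[i + j] x)

end LatticeLCLT

namespace LatticeLCLT

/-! Existence of coding sequences. An aperiodic system has no atoms (`IsAperiodic.isAtomless`), so
Rokhlin towers exist and labels with any prescribed finite conditional law can be drawn on their
bases. Putting independent labels on a tower gives a function that is only nearly independent of its
next N values, because its value is forced to be a₀ off the tower and on the lowest levels. For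
given data this defect is a multiple of δ_{a₀} - ν, and a small opposite tilt of the label law at
sparse random positions cancels it exactly (`exists_function_indep_future`). Peeling off times from
the last one backwards then gives exactly i.i.d. windows independent of prescribed finitely valued
data, and recursion on k gives the coding sequence.

Variance. For n ≤ d_k the Birkhoff sum S_n(f_k) is a linear combination of i.i.d. variables and is
independent of the lower levels. As long as p_k is small compared with n, its coefficients form two
trapezoids of heights p_k and -p_k, and since p_k²α_k² = h_k = 1/(k log₂ k), its variance is about
2n h_k. Let s = `lev n` be the largest index with d_s ≤ n and K = `top n` = ⌊s/2⌋². The levels up to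
s are coboundaries whose transfer functions contribute o(n) in total. The levels from K on
contribute o(n) too: about log₂ n, hence O(s²), of them are effective, each with variance at most 2n
h_K. Only s < k < K matters, and there ∑ h_k tends to (ln 2)², because ∑ 1/(k ln k) behaves like ln
ln and ln K / ln s tends to 2 (`tendsto_sum_h`). Hence σ² = 2(ln 2)².

Local limit theorem. In the main range p_k ≤ n^{1/4}, so at θ = t/√n the characteristic function is
close to the explicit product `mainCf`, which tends to exp(-(ln 2)² t²) (`tendsto_mainCf`). By
Fourier inversion on [-π, π] it remains to dominate it for |t| ≤ π√n by one integrable function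
(`eventually_mainCf_le`). For t⁴ ≤ n a Gaussian does it. For larger t two adjacent levels with
p_{κ+1} = p_κ + 1 are used: their factors cannot both be close to 1 unless θ is close to 0. The loss
is a factor 16^{-s-3}, negligible because n ≥ 2^{s²}. Dominated convergence concludes
(`tendsto_iSup_of_cf`). -/

/-- Every set of positive measure has a measurable subset of strictly intermediate measure. -/
def IsAtomless {X : Type*} [MeasurableSpace X] (μ : Measure X) : Prop :=
  ∀ A : Set X, MeasurableSet A → 0 < μ.real A →
    ∃ B ⊆ A, MeasurableSet B ∧ 0 < μ.real B ∧ μ.real B < μ.real A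

/-! ### Atomless measures: intermediate values and drawing of labels. -/

section Atomless

variable {X : Type*} [MeasurableSpace X] {μ : Measure X} [IsFiniteMeasure μ]

theorem IsAtomless.exists_le_half (h : IsAtomless μ) {A : Set X} (hA : MeasurableSet A)
    (hpos : 0 < μ.real A) :
    ∃ B ⊆ A, MeasurableSet B ∧ 0 < μ.real B ∧ μ.real B ≤ μ.real A / 2 := by
  obtain ⟨B, hBA, hB, hB0, hB1⟩ := h A hA hpos
  have hd : μ.real (A \ B) = μ.real A - μ.real B := measureReal_sdiff hBA hB
  rcases le_total (μ.real B) (μ.real A / 2) with hle | hle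
  · exact ⟨B, hBA, hB, hB0, hle⟩
  · exact ⟨A \ B, Set.sdiff_subset, hA.diff hB, by linarith, by linarith⟩

theorem IsAtomless.exists_small (h : IsAtomless μ) {A : Set X} (hA : MeasurableSet A)
    (hpos : 0 < μ.real A) {ε : ℝ} (hε : 0 < ε) :
    ∃ B ⊆ A, MeasurableSet B ∧ 0 < μ.real B ∧ μ.real B ≤ ε := by
  have key : ∀ n : ℕ, ∃ B ⊆ A, MeasurableSet B ∧ 0 < μ.real B ∧
      μ.real B ≤ μ.real A * (1 / 2) ^ n := by
    intro n
    induction n with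
    | zero => exact ⟨A, subset_rfl, hA, hpos, by simp⟩
    | succ n ih =>
      obtain ⟨B, hBA, hB, hB0, hB1⟩ := ih
      obtain ⟨C, hCB, hC, hC0, hC1⟩ := h.exists_le_half hB hB0
      exact ⟨C, hCB.trans hBA, hC, hC0, hC1.trans (by rw [pow_succ]; linarith)⟩
  have hlim : Tendsto (fun n : ℕ => μ.real A * (1 / 2 : ℝ) ^ n) atTop (𝓝 (μ.real A * 0)) :=
    (tendsto_pow_atTop_nhds_zero_of_lt_one (by norm_num) (by norm_num)).const_mul _
  rw [mul_zero] at hlim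
  obtain ⟨n, hn⟩ := (hlim.eventually (gt_mem_nhds hε)).exists
  obtain ⟨B, hBA, hB, hB0, hB1⟩ := key n
  exact ⟨B, hBA, hB, hB0, hB1.trans hn.le⟩

/-- Sierpiński: an atomless finite measure takes all intermediate values. -/
theorem IsAtomless.exists_measure_eq (h : IsAtomless μ) {A : Set X} (hA : MeasurableSet A)
    {t : ℝ} (ht0 : 0 ≤ t) (ht : t ≤ μ.real A) :
    ∃ B ⊆ A, MeasurableSet B ∧ μ.real B = t := by
  let S := {B : Set X // B ⊆ A ∧ MeasurableSet B ∧ μ.real B ≤ t}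
  -- Greedy exhaustion: B is enlarged by an admissible set whose measure is at least half the
  -- supremum over all sets that still fit below t.
  have step : ∀ B : S, ∃ B' : S, B.1 ⊆ B'.1 ∧ ∀ C : Set X, C ⊆ A \ B.1 → MeasurableSet C →
      μ.real C ≤ t - μ.real B.1 → μ.real C ≤ 2 * (μ.real B'.1 - μ.real B.1) := by
    rintro ⟨B, hBA, hB, hBt⟩
    let V : Set ℝ := {r | ∃ C : Set X, C ⊆ A \ B ∧ MeasurableSet C ∧ μ.real C ≤ t - μ.real B ∧
      μ.real C = r}
    have hV0 : (0 : ℝ) ∈ V :=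
      ⟨∅, Set.empty_subset _, MeasurableSet.empty, by simpa using hBt, by simp⟩
    have hVb : BddAbove V := ⟨t - μ.real B, by rintro r ⟨C, -, -, h1, rfl⟩; exact h1⟩
    have hs0 : 0 ≤ sSup V := le_csSup hVb hV0
    obtain ⟨C, hC, hCm, hCt, hCs⟩ : ∃ C : Set X, C ⊆ A \ B ∧ MeasurableSet C ∧
        μ.real C ≤ t - μ.real B ∧ sSup V ≤ 2 * μ.real C := by
      rcases hs0.eq_or_lt with h0 | h0
      · exact ⟨∅, Set.empty_subset _, MeasurableSet.empty, by simpa using hBt, by simp [← h0]⟩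
      · obtain ⟨r, ⟨C, h1, h2, h3, rfl⟩, hr⟩ := exists_lt_of_lt_csSup ⟨0, hV0⟩ (half_lt_self h0)
        exact ⟨C, h1, h2, h3, by linarith⟩
    have hdisj : Disjoint B C :=
      Set.disjoint_left.2 fun x hx hxC => (hC hxC).2 hx
    have hun : μ.real (B ∪ C) = μ.real B + μ.real C := measureReal_union hdisj hCm
    refine ⟨⟨B ∪ C, Set.union_subset hBA (hC.trans Set.sdiff_subset), hB.union hCm, by linarith⟩,
      Set.subset_union_left, ?_⟩
    intro C' h1 h2 h3
    have : μ.real C' ≤ sSup V := le_csSup hVb ⟨C', h1, h2, h3, rfl⟩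
    simp only [hun]
    linarith
  choose g hg1 hg2 using step
  let b : ℕ → S := fun n => g^[n] ⟨∅, Set.empty_subset _, MeasurableSet.empty, by simpa using ht0⟩
  have hb : ∀ n, b (n + 1) = g (b n) := fun n => Function.iterate_succ_apply' _ _ _
  have hmono : Monotone fun n => (b n).1 := monotone_nat_of_le_succ fun n => by
    rw [hb]; exact hg1 _
  have hU : MeasurableSet (⋃ n, (b n).1) := MeasurableSet.iUnion fun n => (b n).2.2.1
  have hlim : Tendsto (fun n => μ.real (b n).1) atTop (𝓝 (μ.real (⋃ n, (b n).1))) :=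
    (ENNReal.tendsto_toReal (measure_ne_top _ _)).comp (tendsto_measure_iUnion_atTop hmono)
  have hUt : μ.real (⋃ n, (b n).1) ≤ t := le_of_tendsto' hlim fun n => (b n).2.2.2
  refine ⟨⋃ n, (b n).1, Set.iUnion_subset fun n => (b n).2.1, hU, le_antisymm hUt ?_⟩
  by_contra hlt
  push Not at hlt
  have hUA : (⋃ n, (b n).1) ⊆ A := Set.iUnion_subset fun n => (b n).2.1
  have hd : μ.real (A \ ⋃ n, (b n).1) = μ.real A - μ.real (⋃ n, (b n).1) :=
    measureReal_sdiff hUA hU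
  -- A set C of small positive measure outside the limit set was admissible at every stage, so each
  -- increment is at least half of μ C; this contradicts the convergence of the measures.
  obtain ⟨C, hCA, hC, hC0, hC1⟩ := h.exists_small (hA.diff hU) (by linarith)
    (sub_pos.2 hlt)
  have hbU : ∀ n, μ.real (b n).1 ≤ μ.real (⋃ n, (b n).1) := fun n =>
    measureReal_mono (Set.subset_iUnion (fun n => (b n).1) n)
  have hinc : ∀ n, μ.real C ≤ 2 * (μ.real (b (n + 1)).1 - μ.real (b n).1) := by
    intro n
    rw [hb]
    refine hg2 _ C (fun x hx => ⟨(hCA hx).1, fun hx' => (hCA hx).2 (Set.mem_iUnion.2 ⟨n, hx'⟩)⟩)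
      hC ?_
    linarith [hbU n]
  have hlim2 : Tendsto (fun n => 2 * (μ.real (b (n + 1)).1 - μ.real (b n).1)) atTop
      (𝓝 (2 * (μ.real (⋃ n, (b n).1) - μ.real (⋃ n, (b n).1)))) :=
    ((hlim.comp (tendsto_add_atTop_nat 1)).sub hlim).const_mul 2
  have := ge_of_tendsto' hlim2 hinc
  linarith

/-- Given a weight vector, an atomless measure restricted to a set can be split accordingly. -/
theorem IsAtomless.exists_split (h : IsAtomless μ) {A : Type*} [Fintype A] [DecidableEq A]
    [MeasurableSpace A] [MeasurableSingletonClass A] {B : Set X} (hB : MeasurableSet B)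
    {w : A → ℝ} (hw : ∀ a, 0 ≤ w a) (hw1 : ∑ a, w a = 1) :
    ∃ ℓ : X → A, Measurable ℓ ∧ ∀ a, μ.real (B ∩ ℓ ⁻¹' {a}) = μ.real B * w a := by
  have key : ∀ s : Finset A, ∃ E : A → Set X, (∀ a, MeasurableSet (E a)) ∧ (∀ a, E a ⊆ B) ∧
      (∀ a ∉ s, E a = ∅) ∧ (∀ a ∈ s, μ.real (E a) = μ.real B * w a) ∧
      Pairwise (Function.onFun Disjoint E) := by
    intro s
    induction s using Finset.induction_on with
    | empty =>
      exact ⟨fun _ => ∅, fun _ => MeasurableSet.empty, fun _ => Set.empty_subset _,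
        fun _ _ => rfl, by simp, fun _ _ _ => by simp [Function.onFun]⟩
    | insert c s hc ih =>
      obtain ⟨E, hE1, hE2, hE3, hE4, hE5⟩ := ih
      have hUm : MeasurableSet (⋃ a ∈ s, E a) := s.measurableSet_biUnion fun a _ => hE1 a
      have hUB : (⋃ a ∈ s, E a) ⊆ B := Set.iUnion₂_subset fun a _ => hE2 a
      have hUμ : μ.real (⋃ a ∈ s, E a) = μ.real B * ∑ a ∈ s, w a := by
        rw [measureReal_biUnion_finset (fun a _ b _ hab => hE5 hab) (fun a _ => hE1 a),
          Finset.mul_sum]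
        exact Finset.sum_congr rfl fun a ha => hE4 a ha
      have hle : w c + ∑ a ∈ s, w a ≤ 1 := by
        rw [← Finset.sum_insert hc, ← hw1]
        exact Finset.sum_le_univ_sum_of_nonneg hw
      have hd : μ.real (B \ ⋃ a ∈ s, E a) = μ.real B - μ.real B * ∑ a ∈ s, w a := by
        rw [measureReal_sdiff hUB hUm, hUμ]
      obtain ⟨F, hF1, hF2, hF3⟩ := h.exists_measure_eq (hB.diff hUm)
        (t := μ.real B * w c) (mul_nonneg measureReal_nonneg (hw c)) (by
          rw [hd]; nlinarith [measureReal_nonneg (μ := μ) (s := B)])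
      refine ⟨Function.update E c F, fun a => ?_, fun a => ?_, fun a ha => ?_, fun a ha => ?_, ?_⟩
      · by_cases hac : a = c
        · subst hac; simpa using hF2
        · simpa [hac] using hE1 a
      · by_cases hac : a = c
        · subst hac; simpa using hF1.trans Set.sdiff_subset
        · simpa [hac] using hE2 a
      · rw [Finset.mem_insert, not_or] at ha
        simpa [ha.1] using hE3 a ha.2
      · by_cases hac : a = c
        · subst hac; simpa using hF3
        · rw [Function.update_of_ne hac]
          exact hE4 a ((Finset.mem_insert.1 ha).resolve_left hac)
      · have hdis : ∀ a, a ≠ c → Disjoint (E a) F := by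
          intro a _
          by_cases has : a ∈ s
          · refine Set.disjoint_left.2 fun x hx hxF => (hF1 hxF).2 ?_
            exact Set.mem_biUnion has hx
          · rw [hE3 a has]; exact Set.empty_disjoint _
        intro a b hab
        by_cases hac : a = c
        · subst hac
          simpa [Function.onFun, hab.symm] using (hdis b hab.symm).symm
        · by_cases hbc : b = c
          · subst hbc
            simpa [Function.onFun, hac] using hdis a hac
          · simpa [Function.onFun, hac, hbc] using hE5 hab
  obtain ⟨E, hE1, hE2, -, hE4, hE5⟩ := key Finset.univ
  have hne : Nonempty A := by
    by_contra hc
    rw [not_nonempty_iff] at hc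
    simp at hw1
  have hBU : μ.real (⋃ a, E a) = μ.real B := by
    rw [measureReal_iUnion_fintype hE5 hE1, Finset.sum_congr rfl hE4, ← Finset.mul_sum, hw1,
      mul_one]
  have hnull : μ.real (B \ ⋃ a, E a) = 0 := by
    rw [measureReal_sdiff (Set.iUnion_subset hE2) (MeasurableSet.iUnion hE1), hBU, sub_self]
  classical
  let a₀ : A := Classical.arbitrary A
  -- The pieces exhaust B up to a null set, so the default label a₀ at the remaining points of B
  -- does not affect the measures.
  let ℓ : X → A := fun x => if hx : ∃ a, x ∈ E a then hx.choose else a₀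
  have hℓ : ∀ a x, x ∈ E a → ℓ x = a := by
    intro a x hx
    have hex : ∃ a, x ∈ E a := ⟨a, hx⟩
    have : ℓ x = hex.choose := dif_pos hex
    rw [this]
    by_contra hne
    exact Set.disjoint_left.1 (hE5 hne) hex.choose_spec hx
  have hℓ' : ∀ x, (∀ a, x ∉ E a) → ℓ x = a₀ := fun x hx => dif_neg (by simpa using hx)
  have hpre : ∀ a, ℓ ⁻¹' {a} = E a ∪ (if a = a₀ then (⋃ a, E a)ᶜ else ∅) := by
    intro a
    ext x
    simp only [Set.mem_preimage, Set.mem_singleton_iff, Set.mem_union]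
    by_cases hx : ∃ b, x ∈ E b
    · obtain ⟨b, hb⟩ := hx
      rw [hℓ b x hb]
      constructor
      · rintro rfl; exact Or.inl hb
      · rintro (h1 | h1)
        · rw [← hℓ b x hb, hℓ a x h1]
        · exfalso
          split_ifs at h1
          · exact h1 (Set.mem_iUnion.2 ⟨b, hb⟩)
          · exact h1
    · push Not at hx
      rw [hℓ' x hx]
      constructor
      · rintro rfl; right; simpa using hx
      · rintro (h1 | h1)
        · exact absurd h1 (hx a)
        · split_ifs at h1 with h2
          · exact h2.symm
          · exact absurd h1 (Set.notMem_empty x)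
  refine ⟨ℓ, measurable_to_countable' fun a => ?_, fun a => ?_⟩
  · rw [hpre]
    refine (hE1 a).union ?_
    split_ifs
    · exact (MeasurableSet.iUnion hE1).compl
    · exact MeasurableSet.empty
  · rw [hpre, ← hE4 a (Finset.mem_univ a)]
    refine le_antisymm ?_ (measureReal_mono fun x hx => ⟨hE2 a hx, Or.inl hx⟩)
    calc μ.real (B ∩ (E a ∪ if a = a₀ then (⋃ a, E a)ᶜ else ∅))
        ≤ μ.real (E a ∪ (B \ ⋃ a, E a)) := measureReal_mono (by
          rintro x ⟨h1, h2 | h2⟩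
          · exact Or.inl h2
          · split_ifs at h2
            · exact Or.inr ⟨h1, h2⟩
            · exact absurd h2 (Set.notMem_empty x))
      _ ≤ μ.real (E a) + μ.real (B \ ⋃ a, E a) := measureReal_union_le _ _
      _ = μ.real (E a) := by rw [hnull, add_zero]

/-- Draw a new label with prescribed conditional law given countably valued data. -/
theorem IsAtomless.exists_draw (h : IsAtomless μ) {A δ : Type*} [Fintype A] [DecidableEq A]
    [MeasurableSpace A] [MeasurableSingletonClass A] [MeasurableSpace δ]
    [MeasurableSingletonClass δ] [Countable δ] {B : Set X} (hB : MeasurableSet B)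
    {D : X → δ} (hD : Measurable D)
    {K : δ → A → ℝ} (hw : ∀ d a, 0 ≤ K d a) (hw1 : ∀ d, ∑ a, K d a = 1) :
    ∃ ℓ : X → A, Measurable ℓ ∧ ∀ d a,
      μ.real (B ∩ D ⁻¹' {d} ∩ ℓ ⁻¹' {a}) = μ.real (B ∩ D ⁻¹' {d}) * K d a := by
  have hd : ∀ d, ∃ ℓ : X → A, Measurable ℓ ∧ ∀ a,
      μ.real (B ∩ D ⁻¹' {d} ∩ ℓ ⁻¹' {a}) = μ.real (B ∩ D ⁻¹' {d}) * K d a := fun d =>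
    h.exists_split (hB.inter (hD (measurableSet_singleton d))) (hw d) (hw1 d)
  choose ℓ hℓm hℓ using hd
  refine ⟨fun x => ℓ (D x) x, measurable_to_countable' fun a => ?_, fun d a => ?_⟩
  · have : (fun x => ℓ (D x) x) ⁻¹' {a} = ⋃ d, D ⁻¹' {d} ∩ ℓ d ⁻¹' {a} := by
      ext x; simp
    rw [this]
    exact MeasurableSet.iUnion fun d =>
      (hD (measurableSet_singleton d)).inter (hℓm d (measurableSet_singleton a))
  · rw [← hℓ d a]
    congr 1
    ext x
    simp only [Set.mem_inter_iff, Set.mem_preimage, Set.mem_singleton_iff, and_congr_right_iff]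
    rintro ⟨-, rfl⟩
    rfl

end Atomless

end LatticeLCLT

/-! ### Aperiodicity implies atomlessness; Rokhlin towers. -/

namespace LatticeLCLT

section Tower

variable {X : Type*} [MeasurableSpace X] {μ : Measure X} [IsProbabilityMeasure μ] {T : X ≃ᵐ X}

/-- If A were an atom, Poincaré recurrence would give n ≥ 1 with A ∩ T⁻ⁿA of positive measure, hence
A ⊆ T⁻ⁿA modulo null sets. Every measurable subset of A is null or conull in A, so Tⁿ would act
trivially on these subsets, which aperiodicity forbids. -/
theorem IsAperiodic.isAtomless (haper : IsAperiodic T μ) (hT : MeasurePreserving T μ μ) :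
    IsAtomless μ := by
  intro A hA hpos
  by_contra hc
  push Not at hc
  have h01 : ∀ B ⊆ A, MeasurableSet B → μ B ≠ 0 → μ (A \ B) = 0 := by
    intro B hBA hB hB0
    have hBpos : 0 < μ.real B := ENNReal.toReal_pos hB0 (measure_ne_top _ _)
    have hd : μ.real (A \ B) = μ.real A - μ.real B := measureReal_sdiff hBA hB
    have := hc B hBA hB hBpos
    rw [← measureReal_eq_zero_iff (measure_ne_top _ _)]
    exact le_antisymm (by linarith) measureReal_nonneg
  have hA0 : μ A ≠ 0 := fun h => by simp [Measure.real, h] at hpos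
  obtain ⟨n, hn, hnA⟩ := hT.conservative.exists_gt_measure_inter_ne_zero
    hA.nullMeasurableSet hA0 0
  have h1 : μ (A \ (A ∩ T^[n] ⁻¹' A)) = 0 :=
    h01 _ Set.inter_subset_left (hA.inter (hT.measurable.iterate n hA)) hnA
  obtain ⟨B, hBA, hB, hB0⟩ := haper n hn A hA hA0
  have hBne : μ B ≠ 0 := fun h => hB0 (measure_mono_null Set.sdiff_subset h)
  have h2 : μ (T^[n] ⁻¹' (A \ B)) = 0 := by
    rw [(hT.iterate n).measure_preimage (hA.diff hB).nullMeasurableSet]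
    exact h01 B hBA hB hBne
  refine hB0 (measure_mono_null ?_ (measure_union_null h1 h2))
  rintro x ⟨hx1, hx2⟩
  by_cases hx : T^[n] x ∈ A
  · exact Or.inr ⟨hx, hx2⟩
  · exact Or.inl ⟨hBA hx1, fun h => hx h.2⟩

theorem symm_iterate_iterate (T : X ≃ᵐ X) (n : ℕ) (x : X) : T.symm^[n] (T^[n] x) = x :=
  Function.LeftInverse.iterate T.symm_apply_apply n x

theorem iterate_symm_iterate (T : X ≃ᵐ X) (n : ℕ) (x : X) : T^[n] (T.symm^[n] x) = x :=
  Function.LeftInverse.iterate T.apply_symm_apply n x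

theorem symm_iterate_iterate_of_le (T : X ≃ᵐ X) {a b : ℕ} (h : a ≤ b) (x : X) :
    T.symm^[a] (T^[b] x) = T^[b - a] x := by
  obtain ⟨c, rfl⟩ := Nat.exists_eq_add_of_le h
  rw [Function.iterate_add_apply, symm_iterate_iterate, Nat.add_sub_cancel_left]

theorem symm_iterate_iterate_of_ge (T : X ≃ᵐ X) {a b : ℕ} (h : b ≤ a) (x : X) :
    T.symm^[a] (T^[b] x) = T.symm^[a - b] x := by
  obtain ⟨c, rfl⟩ := Nat.exists_eq_add_of_le h
  rw [add_comm b c, Function.iterate_add_apply, symm_iterate_iterate, Nat.add_sub_cancel]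

theorem iterate_symm_iterate_of_ge (T : X ≃ᵐ X) {a b : ℕ} (h : b ≤ a) (x : X) :
    T^[a] (T.symm^[b] x) = T^[a - b] x := by
  obtain ⟨c, rfl⟩ := Nat.exists_eq_add_of_le h
  rw [add_comm b c, Function.iterate_add_apply, iterate_symm_iterate, Nat.add_sub_cancel]

/-- Rokhlin's lemma for an ergodic automorphism of an atomless probability space. -/
theorem exists_rokhlin_tower (hT : Ergodic T μ) (hμ : IsAtomless μ) {H : ℕ} (hH : 0 < H)
    {ε : ℝ} (hε : 0 < ε) :
    ∃ B : Set X, MeasurableSet B ∧ (∀ b ∈ B, ∀ i, 0 < i → i < H → T^[i] b ∉ B) ∧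
      μ.real {x | ∀ i < H, T.symm^[i] x ∉ B} ≤ ε := by
  obtain ⟨E, -, hE, hE0, hE1⟩ := hμ.exists_small (A := Set.univ) MeasurableSet.univ (by simp)
    (ε := ε / H) (by positivity)
  have hmS : ∀ i, Measurable (T.symm^[i]) := fun i => T.symm.measurable.iterate i
  have hmT : ∀ i, Measurable (T^[i]) := fun i => T.measurable.iterate i
  -- E serves as a marker: `V k` consists of the points whose latest visit to E, the present
  -- included, was k steps ago. The base takes the points whose latest visit was a multiple of H
  -- steps ago and whose next H - 1 iterates avoid E.
  let V : ℕ → Set X := fun k => {x | T.symm^[k] x ∈ E ∧ ∀ i < k, T.symm^[i] x ∉ E}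
  have hVm : ∀ k, MeasurableSet (V k) := by
    intro k
    have : V k = T.symm^[k] ⁻¹' E ∩ ⋂ i ∈ Finset.range k, (T.symm^[i] ⁻¹' E)ᶜ := by
      ext x; simp [V]
    rw [this]
    exact (hmS k hE).inter (Finset.measurableSet_biInter _ fun i _ => (hmS i hE).compl)
  have hVd : ∀ k l x, x ∈ V k → x ∈ V l → k = l := by
    intro k l x hk hl
    rcases lt_trichotomy k l with h | h | h
    · exact absurd hk.1 (hl.2 k h)
    · exact h
    · exact absurd hl.1 (hk.2 l h)
  let B : Set X := T^[H - 1] ⁻¹' ⋃ m : ℕ, V (m * H + (H - 1))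
  have hBV : ∀ b ∈ B, ∃ m : ℕ, ∀ i < H, T^[i] b ∈ V (m * H + i) := by
    intro b hb
    obtain ⟨m, hm1, hm2⟩ := Set.mem_iUnion.1 hb
    refine ⟨m, fun i hi => ⟨?_, fun j hj => ?_⟩⟩
    · rw [symm_iterate_iterate_of_ge T (by omega)] at hm1 ⊢
      rwa [Nat.add_sub_cancel] at hm1 ⊢
    · have := hm2 (j + (H - 1 - i)) (by omega)
      rw [Function.iterate_add_apply, symm_iterate_iterate_of_le T (by omega)] at this
      rwa [show H - 1 - (H - 1 - i) = i by omega] at this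
  refine ⟨B, hmT _ (MeasurableSet.iUnion fun m => hVm _), ?_, ?_⟩
  · intro b hb i hi0 hiH hbi
    obtain ⟨m, hm⟩ := hBV b hb
    obtain ⟨m', hm'⟩ := hBV _ hbi
    have h1 := hm i hiH
    have h2 := hm' 0 hH
    have h3 := hVd _ _ _ h1 h2
    have : (m * H + i) % H = (m' * H + 0) % H := by rw [h3]
    rw [Nat.add_zero, Nat.mul_mod_left, Nat.add_comm, Nat.add_mul_mod_self_right,
      Nat.mod_eq_of_lt hiH] at this
    omega
  · let Z : Set X := {x | ∀ k, T.symm^[k] x ∉ E}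
    have hZm : MeasurableSet Z := by
      have : Z = ⋂ k, (T.symm^[k] ⁻¹' E)ᶜ := by ext x; simp [Z]
      rw [this]
      exact MeasurableSet.iInter fun k => (hmS k hE).compl
    -- Ergodicity of the inverse makes this backward invariant set null or conull, and it misses E,
    -- which has positive measure.
    have hZ0 : μ Z = 0 := by
      rcases hT.symm.ae_empty_or_univ_of_ae_le_preimage hZm.nullMeasurableSet
        (Filter.Eventually.of_forall fun x (hx : x ∈ Z) k => by
          have := hx (k + 1)
          rwa [Function.iterate_succ_apply] at this) with h | h
      · rw [measure_congr h, measure_empty]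
      · exfalso
        have h1 : μ Zᶜ = 0 := by
          rw [measure_congr h.compl, Set.compl_univ, measure_empty]
        have h2 : μ E = 0 := measure_mono_null (show E ⊆ Zᶜ from fun x hx hxZ => hxZ 0 hx) h1
        simp [Measure.real, h2] at hE0
    -- A point missed by the tower either never visited E in the past or meets E within fewer than H
    -- forward steps, which cut its column short.
    have hsub : {x | ∀ i < H, T.symm^[i] x ∉ B} ⊆
        Z ∪ ⋃ j ∈ Finset.range H, T^[j] ⁻¹' E := by
      intro x hx
      by_contra hcon
      rw [Set.mem_union, not_or] at hcon
      obtain ⟨hc1, hc2⟩ := hcon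
      have hc2 : ∀ j < H, T^[j] x ∉ E := by simpa using hc2
      have hex : ∃ k, T.symm^[k] x ∈ E := by simpa [Z] using hc1
      classical
      obtain ⟨k, hk, hkmin⟩ : ∃ k, T.symm^[k] x ∈ E ∧ ∀ i < k, T.symm^[i] x ∉ E :=
        ⟨Nat.find hex, Nat.find_spec hex, fun i hi => Nat.find_min hex hi⟩
      have hlt := Nat.mod_lt k hH
      have hdm := Nat.div_add_mod k H
      refine hx (k % H) hlt (Set.mem_iUnion.2 ⟨k / H, ?_⟩)
      rw [mul_comm] at hdm
      rw [iterate_symm_iterate_of_ge T (by omega)]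
      constructor
      · rw [symm_iterate_iterate_of_ge T (by omega)]
        rwa [show k / H * H + (H - 1) - (H - 1 - k % H) = k by omega]
      · intro i hi
        rcases le_total i (H - 1 - k % H) with h | h
        · rw [symm_iterate_iterate_of_le T h]
          exact hc2 _ (by omega)
        · rw [symm_iterate_iterate_of_ge T h]
          exact hkmin _ (by omega)
    calc μ.real {x | ∀ i < H, T.symm^[i] x ∉ B}
        ≤ μ.real (Z ∪ ⋃ j ∈ Finset.range H, T^[j] ⁻¹' E) := measureReal_mono hsub
      _ ≤ μ.real Z + μ.real (⋃ j ∈ Finset.range H, T^[j] ⁻¹' E) := measureReal_union_le _ _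
      _ ≤ 0 + ∑ j ∈ Finset.range H, μ.real (T^[j] ⁻¹' E) := by
          gcongr
          · simp [Measure.real, hZ0]
          · exact measureReal_biUnion_finset_le _ _
      _ = H * μ.real E := by
          rw [zero_add, Finset.sum_congr rfl fun j _ =>
            (hT.toMeasurePreserving.iterate j).measureReal_preimage hE.nullMeasurableSet]
          simp
      _ ≤ H * (ε / H) := by gcongr
      _ = ε := by field_simp

end Tower

end LatticeLCLT

/-! ### Labels drawn along a column. -/

namespace LatticeLCLT

section Labels

variable {X : Type*} [MeasurableSpace X] {μ : Measure X} [IsFiniteMeasure μ]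

theorem measureReal_eq_sum_inter_fiber {ζ : Type*} [Fintype ζ] [MeasurableSpace ζ]
    [MeasurableSingletonClass ζ] {Z : X → ζ} (hZ : Measurable Z) (E : Set X) :
    μ.real E = ∑ z, μ.real (E ∩ Z ⁻¹' {z}) := by
  have h := sum_measureReal_preimage_singleton (μ := μ.restrict E) (f := Z) Finset.univ
    (fun y _ => hZ (measurableSet_singleton y))
  simp only [Finset.coe_univ, Set.preimage_univ] at h
  rw [measureReal_restrict_apply_univ] at h
  rw [← h]
  refine Finset.sum_congr rfl fun z _ => ?_
  rw [measureReal_restrict_apply (hZ (measurableSet_singleton z)), Set.inter_comm]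

/-- The `N` labels following position `t`. -/
def tail {A : Type*} (N : ℕ) (ℓ : ℕ → X → A) (t : ℕ) (x : X) : Fin N → A := fun i => ℓ (t + 1 + i) x

theorem measurable_tail {A : Type*} [MeasurableSpace A] {N : ℕ} {ℓ : ℕ → X → A} (h : ∀ t, Measurable (ℓ t)) (t : ℕ) :
    Measurable (tail N ℓ t) :=
  measurable_pi_lambda _ fun _ => h _

variable {A : Type*} [Fintype A] [DecidableEq A] [MeasurableSpace A] [MeasurableSingletonClass A]

/-- Labels at the positions `H - 1, …, n` drawn one after the other with prescribed conditional
laws, given finitely valued data and the next `N` labels. -/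
theorem IsAtomless.exists_labels (h : IsAtomless μ) {δ : Type*} [Fintype δ] [MeasurableSpace δ]
    [MeasurableSingletonClass δ] {B : Set X} (hB : MeasurableSet B) {D : X → δ} (hD : Measurable D)
    (N n H : ℕ) (a₀ : A) {K : ℕ → δ × (Fin N → A) → A → ℝ} (hK : ∀ t z a, 0 ≤ K t z a)
    (hK1 : ∀ t z, ∑ a, K t z a = 1) :
    ∃ ℓ : ℕ → X → A, (∀ t, Measurable (ℓ t)) ∧ (∀ t x, (t < n ∨ H ≤ t) → ℓ t x = a₀) ∧
      ∀ t, n ≤ t → t < H → ∀ (S : Set (δ × (Fin N → A))) (a : A) (c : ℝ),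
        (∀ z ∈ S, K t z a = c) →
        μ.real {x | x ∈ B ∧ (D x, tail N ℓ t x) ∈ S ∧ ℓ t x = a} =
          c * μ.real {x | x ∈ B ∧ (D x, tail N ℓ t x) ∈ S} := by
  -- Positions are filled downwards from H - 1, m of them after stage m. Thus the tail of a position
  -- is already in place when its own label is drawn, and later draws do not change it.
  have key : ∀ m : ℕ, ∃ ℓ : ℕ → X → A, (∀ t, Measurable (ℓ t)) ∧
      (∀ t x, (t + m < H ∨ H ≤ t) → ℓ t x = a₀) ∧
      ∀ t, H ≤ t + m → t < H → ∀ (S : Set (δ × (Fin N → A))) (a : A) (c : ℝ),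
        (∀ z ∈ S, K t z a = c) →
        μ.real {x | x ∈ B ∧ (D x, tail N ℓ t x) ∈ S ∧ ℓ t x = a} =
          c * μ.real {x | x ∈ B ∧ (D x, tail N ℓ t x) ∈ S} := by
    intro m
    induction m with
    | zero => exact ⟨fun _ _ => a₀, fun _ => measurable_const, fun _ _ _ => rfl,
        fun t h1 h2 => by omega⟩
    | succ m ih =>
      obtain ⟨ℓ, h1, h2, h3⟩ := ih
      by_cases hm : m + 1 ≤ H
      swap
      · exact ⟨ℓ, h1, fun t x ht => h2 t x (by omega), fun t ht => h3 t (by omega)⟩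
      set u := H - (m + 1) with hu
      have hZ : Measurable fun x => (D x, tail N ℓ u x) := hD.prodMk (measurable_tail h1 u)
      obtain ⟨g, hg1, hg2⟩ := h.exists_draw hB hZ (hK u) (hK1 u)
      have htail : ∀ t, u ≤ t → tail N (Function.update ℓ u g) t = tail N ℓ t := by
        intro t ht
        ext x i
        simp only [tail]
        rw [Function.update_of_ne (by omega)]
      refine ⟨Function.update ℓ u g, fun t => ?_, fun t x ht => ?_, fun t ht1 ht2 S a c hc => ?_⟩
      · by_cases htu : t = u
        · subst htu; simpa using hg1
        · rw [Function.update_of_ne htu]; exact h1 t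
      · rw [Function.update_of_ne (by omega)]
        exact h2 t x (by omega)
      · rw [htail t (by omega)]
        by_cases htu : t = u
        · subst htu
          rw [Function.update_self, measureReal_eq_sum_inter_fiber hZ,
            measureReal_eq_sum_inter_fiber hZ {x | x ∈ B ∧ (D x, tail N ℓ u x) ∈ S},
            Finset.mul_sum]
          refine Finset.sum_congr rfl fun z _ => ?_
          by_cases hz : z ∈ S
          · have e1 : {x | x ∈ B ∧ (D x, tail N ℓ u x) ∈ S ∧ g x = a} ∩
                (fun x => (D x, tail N ℓ u x)) ⁻¹' {z} =
                B ∩ (fun x => (D x, tail N ℓ u x)) ⁻¹' {z} ∩ g ⁻¹' {a} := by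
              ext x
              simp only [Set.mem_inter_iff, Set.mem_ofPred_eq, Set.mem_preimage,
                Set.mem_singleton_iff]
              constructor
              · rintro ⟨⟨a1, a2, a3⟩, a4⟩; exact ⟨⟨a1, a4⟩, a3⟩
              · rintro ⟨⟨a1, a4⟩, a3⟩; exact ⟨⟨a1, a4 ▸ hz, a3⟩, a4⟩
            have e2 : {x | x ∈ B ∧ (D x, tail N ℓ u x) ∈ S} ∩
                (fun x => (D x, tail N ℓ u x)) ⁻¹' {z} =
                B ∩ (fun x => (D x, tail N ℓ u x)) ⁻¹' {z} := by
              ext x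
              simp only [Set.mem_inter_iff, Set.mem_ofPred_eq, Set.mem_preimage,
                Set.mem_singleton_iff]
              constructor
              · rintro ⟨⟨a1, a2⟩, a4⟩; exact ⟨a1, a4⟩
              · rintro ⟨a1, a4⟩; exact ⟨⟨a1, a4 ▸ hz⟩, a4⟩
            rw [e1, e2, hg2, hc z hz, mul_comm]
          · have e1 : {x | x ∈ B ∧ (D x, tail N ℓ u x) ∈ S ∧ g x = a} ∩
                (fun x => (D x, tail N ℓ u x)) ⁻¹' {z} = ∅ := by
              ext x
              simp only [Set.mem_inter_iff, Set.mem_ofPred_eq, Set.mem_preimage,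
                Set.mem_singleton_iff, Set.mem_empty_iff_false, iff_false]
              rintro ⟨⟨a1, a2, a3⟩, a4⟩; exact hz (a4 ▸ a2)
            have e2 : {x | x ∈ B ∧ (D x, tail N ℓ u x) ∈ S} ∩
                (fun x => (D x, tail N ℓ u x)) ⁻¹' {z} = ∅ := by
              ext x
              simp only [Set.mem_inter_iff, Set.mem_ofPred_eq, Set.mem_preimage,
                Set.mem_singleton_iff, Set.mem_empty_iff_false, iff_false]
              rintro ⟨⟨a1, a2⟩, a4⟩; exact hz (a4 ▸ a2)
            rw [e1, e2, measureReal_empty, mul_zero]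
        · rw [Function.update_of_ne htu]
          exact h3 t (by omega) ht2 S a c hc
  obtain ⟨ℓ, h1, h2, h3⟩ := key (H - n)
  by_cases hn : n ≤ H
  · exact ⟨ℓ, h1, fun t x ht => h2 t x (by omega), fun t ht1 ht2 => h3 t (by omega) ht2⟩
  · refine ⟨fun _ _ => a₀, fun _ => measurable_const, fun _ _ _ => rfl, fun t ht1 ht2 => by omega⟩

end Labels

/-- The law of a label at position `u` outside of the corrected positions: `ν` for `n ≤ u < H`,
the point mass at `a₀` otherwise. -/
noncomputable def labelLaw {A : Type*} [DecidableEq A] (ν : A → ℝ) (a₀ : A) (n H u : ℕ) (a : A) : ℝ :=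
  if n ≤ u ∧ u < H then ν a else if a = a₀ then 1 else 0

/-- Along uncorrected positions the labels are independent. -/
theorem measureReal_tail_eq {X : Type*} [MeasurableSpace X] {μ : Measure X} {A : Type*}
    [DecidableEq A] {δ : Type*} {B : Set X} {D : X → δ} {N n H : ℕ} {a₀ : A} {ν : A → ℝ}
    {K : ℕ → δ × (Fin N → A) → A → ℝ} {ℓ : ℕ → X → A}
    (h2 : ∀ t x, (t < n ∨ H ≤ t) → ℓ t x = a₀)
    (h3 : ∀ t, n ≤ t → t < H → ∀ (S : Set (δ × (Fin N → A))) (a : A) (c : ℝ),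
        (∀ z ∈ S, K t z a = c) →
        μ.real {x | x ∈ B ∧ (D x, tail N ℓ t x) ∈ S ∧ ℓ t x = a} =
          c * μ.real {x | x ∈ B ∧ (D x, tail N ℓ t x) ∈ S})
    (S : Set δ) (t : ℕ)
    (hS : ∀ u, t < u → u ≤ t + N → n ≤ u → u < H → ∀ d ∈ S, ∀ v a, K u (d, v) a = ν a)
    (v : Fin N → A) :
    μ.real {x | x ∈ B ∧ D x ∈ S ∧ tail N ℓ t x = v} =
      μ.real {x | x ∈ B ∧ D x ∈ S} * ∏ i : Fin N, labelLaw ν a₀ n H (t + 1 + i) (v i) := by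
  -- Induction from the far end of the window: at stage m its last m labels have been accounted for.
  have key : ∀ m : ℕ, m ≤ N →
      μ.real {x | x ∈ B ∧ D x ∈ S ∧ ∀ i : Fin N, N ≤ i + m → ℓ (t + 1 + i) x = v i} =
      μ.real {x | x ∈ B ∧ D x ∈ S} *
        ∏ i ∈ Finset.univ.filter (fun i : Fin N => N ≤ i + m), labelLaw ν a₀ n H (t + 1 + i) (v i) := by
    intro m
    induction m with
    | zero =>
      intro _
      have e : ∀ i : Fin N, ¬ N ≤ i + 0 := fun i => by omega
      simp [Finset.filter_false_of_mem]
    | succ m ih =>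
      intro hm
      have ih := ih (by omega)
      let j : Fin N := ⟨N - (m + 1), by omega⟩
      have hj : ∀ i : Fin N, N ≤ i + (m + 1) ↔ (i = j ∨ N ≤ i + m) := fun i => by
        rw [Fin.ext_iff]; simp only [j]; omega
      have hfil : (Finset.univ.filter fun i : Fin N => N ≤ i + (m + 1)) =
          insert j (Finset.univ.filter fun i : Fin N => N ≤ i + m) := by
        ext i; simp [hj]
      rw [hfil, Finset.prod_insert (by simp [j]; omega), mul_left_comm, ← ih]
      set u := t + 1 + (j : ℕ) with hu
      have hset : {x | x ∈ B ∧ D x ∈ S ∧ ∀ i : Fin N, N ≤ i + (m + 1) → ℓ (t + 1 + i) x = v i} =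
          {x | (x ∈ B ∧ D x ∈ S ∧ ∀ i : Fin N, N ≤ i + m → ℓ (t + 1 + i) x = v i) ∧
            ℓ u x = v j} := by
        ext x
        simp only [Set.mem_ofPred_eq, hj]
        constructor
        · rintro ⟨a1, a2, a3⟩
          exact ⟨⟨a1, a2, fun i hi => a3 i (Or.inr hi)⟩, a3 j (Or.inl rfl)⟩
        · rintro ⟨⟨a1, a2, a3⟩, a4⟩
          refine ⟨a1, a2, ?_⟩
          rintro i (rfl | hi)
          · exact a4
          · exact a3 i hi
      rw [hset]
      by_cases hun : n ≤ u ∧ u < H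
      -- The labels already fixed all lie in the tail of the new position u: label i of the window
      -- at t is label i - j - 1 of the window at u.
      · have := h3 u hun.1 hun.2 {z | z.1 ∈ S ∧ ∀ i : Fin N, ∀ hi : N ≤ i + m,
          z.2 ⟨i - j - 1, by omega⟩ = v i} (v j) (ν (v j)) (fun z hz =>
            hS u (by omega) (by omega) hun.1 hun.2 z.1 hz.1 z.2 (v j))
        rw [labelLaw, if_pos hun]
        have e : ∀ x, (∀ i : Fin N, ∀ hi : N ≤ i + m,
          tail N ℓ u x ⟨i - j - 1, by omega⟩ = v i) ↔
          ∀ i : Fin N, N ≤ i + m → ℓ (t + 1 + i) x = v i := by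
          intro x
          refine forall_congr' fun i => forall_congr' fun hi => ?_
          have : u + 1 + (i - j - 1) = t + 1 + (i : ℕ) := by
            simp only [hu, j]; omega
          simp only [tail, this]
        simp only [Set.mem_ofPred_eq, e] at this
        rw [← this]
        congr 1
        ext x
        simp only [Set.mem_ofPred_eq]
        tauto
      · have hz : ∀ x, ℓ u x = a₀ := fun x => h2 u x (by omega)
        rw [labelLaw, if_neg hun]
        simp only [hz]
        by_cases hv : v j = a₀
        · simp [hv]
        · rw [if_neg hv]
          simp [Ne.symm hv]
  have := key N le_rfl
  have e : ∀ i : Fin N, N ≤ i + N := fun i => by omega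
  simp only [e, Finset.filter_true, true_implies] at this
  rw [← this]
  congr 1
  ext x
  simp only [Set.mem_ofPred_eq, funext_iff, tail]

end LatticeLCLT

/-! ### Functions defined on a tower. -/

namespace LatticeLCLT

section TowerFunction

variable {X : Type*} [MeasurableSpace X] {T : X ≃ᵐ X} {B : Set X} {H : ℕ}

theorem tower_level_unique (hdis : ∀ b ∈ B, ∀ i, 0 < i → i < H → T^[i] b ∉ B) {x : X} {s t : ℕ}
    (hs : s < H) (ht : t < H) (hsx : T.symm^[s] x ∈ B) (htx : T.symm^[t] x ∈ B) : s = t := by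
  have key : ∀ s t : ℕ, t < H → T.symm^[s] x ∈ B → T.symm^[t] x ∈ B → ¬ s < t := by
    intro s t ht hsx htx hlt
    refine hdis _ htx (t - s) (by omega) (by omega) ?_
    have : T.symm^[t] x = T.symm^[t - s] (T.symm^[s] x) := by
      rw [← Function.iterate_add_apply]; congr 1; omega
    rwa [this, iterate_symm_iterate]
  rcases lt_trichotomy s t with h | h | h
  · exact absurd h (key s t ht hsx htx)
  · exact h
  · exact absurd h (key t s hs htx hsx)

/-- Measure preservation carries every level down to the base, where the labels live; all laws are
computed there. -/
theorem measureReal_tower_decomp {μ : Measure X} [IsFiniteMeasure μ]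
    (hT : MeasurePreserving T μ μ) (hB : MeasurableSet B)
    (hdis : ∀ b ∈ B, ∀ i, 0 < i → i < H → T^[i] b ∉ B) {E : Set X} (hE : MeasurableSet E) :
    μ.real E = μ.real {x | (∀ i < H, T.symm^[i] x ∉ B) ∧ x ∈ E} +
      ∑ t ∈ Finset.range H, μ.real {b | b ∈ B ∧ T^[t] b ∈ E} := by
  have hL : ∀ t, MeasurableSet (T.symm^[t] ⁻¹' B) := fun t => T.symm.measurable.iterate t hB
  have hU : MeasurableSet (⋃ t ∈ Finset.range H, T.symm^[t] ⁻¹' B) :=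
    Finset.measurableSet_biUnion _ fun t _ => hL t
  rw [← measureReal_inter_add_sdiff (s := E) hU, add_comm]
  congr 1
  · congr 1
    ext x
    simp only [Set.mem_sdiff, Set.mem_iUnion, Finset.mem_range, Set.mem_preimage, Set.mem_ofPred_eq,
      exists_prop, not_exists, not_and]
    tauto
  · rw [Set.inter_iUnion₂, measureReal_biUnion_finset]
    · refine Finset.sum_congr rfl fun t _ => ?_
      rw [← (hT.iterate t).measureReal_preimage (hE.inter (hL t)).nullMeasurableSet]
      congr 1
      ext b
      simp only [Set.mem_inter_iff, Set.mem_preimage, Set.mem_ofPred_eq, symm_iterate_iterate]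
      tauto
    · intro s hs t ht hst
      refine Set.disjoint_left.2 fun x hx1 hx2 => hst ?_
      exact tower_level_unique hdis (by simpa using hs) (by simpa using ht) hx1.2 hx2.2
    · exact fun t _ => hE.inter (hL t)

/-- The function which is `ℓ t` on the `t`-th level of a tower and constant outside of it. -/
theorem exists_tower_function {A : Type*} [Countable A] [MeasurableSpace A]
    [MeasurableSingletonClass A] (hB : MeasurableSet B)
    (hdis : ∀ b ∈ B, ∀ i, 0 < i → i < H → T^[i] b ∉ B) {N : ℕ} {a₀ : A} {ℓ : ℕ → X → A}
    (hℓ : ∀ t, Measurable (ℓ t)) (h0 : ∀ t x, (t < N + 1 ∨ H ≤ t) → ℓ t x = a₀) :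
    ∃ f : X → A, Measurable f ∧ (∀ b ∈ B, ∀ t < H + N, f (T^[t] b) = ℓ t b) ∧
      ∀ x, (∀ i < H, T.symm^[i] x ∉ B) → ∀ i ≤ N, f (T^[i] x) = a₀ := by
  classical
  let f : X → A := fun x =>
    if h : ∃ t, t < H ∧ T.symm^[t] x ∈ B then ℓ h.choose (T.symm^[h.choose] x) else a₀
  have f1 : ∀ x t, t < H → T.symm^[t] x ∈ B → f x = ℓ t (T.symm^[t] x) := by
    intro x t ht hx
    have hex : ∃ t, t < H ∧ T.symm^[t] x ∈ B := ⟨t, ht, hx⟩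
    have : f x = ℓ hex.choose (T.symm^[hex.choose] x) := dif_pos hex
    rw [this, tower_level_unique hdis hex.choose_spec.1 ht hex.choose_spec.2 hx]
  have f2 : ∀ x, (∀ t < H, T.symm^[t] x ∉ B) → f x = a₀ := fun x hx =>
    dif_neg (by rintro ⟨t, h1, h2⟩; exact hx t h1 h2)
  have f3 : ∀ x t, t < N + 1 → T.symm^[t] x ∈ B → t < H → f x = a₀ := fun x t h1 h2 h3 => by
    rw [f1 x t h3 h2]; exact h0 t _ (Or.inl h1)
  refine ⟨f, measurable_to_countable' fun a => ?_, fun b hb t ht => ?_, fun x hx i hi => ?_⟩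
  · have hL : ∀ t, MeasurableSet (T.symm^[t] ⁻¹' B) := fun t => T.symm.measurable.iterate t hB
    have : f ⁻¹' {a} = (⋃ t ∈ Finset.range H, T.symm^[t] ⁻¹' (B ∩ ℓ t ⁻¹' {a})) ∪
        ((⋃ t ∈ Finset.range H, T.symm^[t] ⁻¹' B)ᶜ ∩ {_x | a₀ = a}) := by
      ext x
      simp only [Set.mem_preimage, Set.mem_singleton_iff, Set.mem_union, Set.mem_iUnion,
        Finset.mem_range, Set.mem_inter_iff, Set.mem_compl_iff, Set.mem_ofPred_eq, exists_prop,
        not_exists, not_and]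
      by_cases hx : ∃ t, t < H ∧ T.symm^[t] x ∈ B
      · obtain ⟨t, ht, hxt⟩ := hx
        rw [f1 x t ht hxt]
        constructor
        · exact fun h => Or.inl ⟨t, ht, hxt, h⟩
        · rintro (⟨s, hs, hsx, h⟩ | ⟨h, -⟩)
          · rwa [tower_level_unique hdis ht hs hxt hsx]
          · exact absurd hxt (h t ht)
      · push Not at hx
        rw [f2 x hx]
        constructor
        · exact fun h => Or.inr ⟨hx, h⟩
        · rintro (⟨s, hs, hsx, h⟩ | ⟨-, h⟩)
          · exact absurd hsx (hx s hs)
          · exact h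
    rw [this]
    refine MeasurableSet.union (Finset.measurableSet_biUnion _ fun t _ => ?_)
      ((Finset.measurableSet_biUnion _ fun t _ => hL t).compl.inter (MeasurableSet.const _))
    exact T.symm.measurable.iterate t (hB.inter (hℓ t (measurableSet_singleton a)))
  · by_cases htH : t < H
    · rw [f1 _ t htH (by rwa [symm_iterate_iterate]), symm_iterate_iterate]
    -- Above the top, the point is either off the tower or on one of the levels 0, …, N of a column,
    -- and both carry a₀. A higher level would mean a return of b to the base in fewer than H steps.
    · rw [h0 t b (Or.inr (by omega))]
      by_cases hx : ∀ s < H, T.symm^[s] (T^[t] b) ∉ B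
      · exact f2 _ hx
      · push Not at hx
        obtain ⟨s, hs, hsx⟩ := hx
        refine f3 _ s ?_ hsx hs
        by_contra hsN
        rw [symm_iterate_iterate_of_le T (by omega)] at hsx
        exact hdis b hb (t - s) (by omega) (by omega) hsx
  · by_cases hx' : ∀ s < H, T.symm^[s] (T^[i] x) ∉ B
    · exact f2 _ hx'
    · push Not at hx'
      obtain ⟨s, hs, hsx⟩ := hx'
      refine f3 _ s ?_ hsx hs
      by_contra hsN
      rw [symm_iterate_iterate_of_ge T (by omega)] at hsx
      exact hx (s - i) (by omega) hsx

end TowerFunction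

end LatticeLCLT

/-! ### Tilted labels and exact independence of the future. -/

namespace LatticeLCLT

section CodedFunction

variable {X : Type*} [MeasurableSpace X] {μ : Measure X} [IsProbabilityMeasure μ] {T : X ≃ᵐ X}
  {A : Type*} [Fintype A] [DecidableEq A] [MeasurableSpace A] [MeasurableSingletonClass A]
  {Q : Type*} [Fintype Q] [MeasurableSpace Q] [MeasurableSingletonClass Q]

/-- Labels on a tower: independent with law `ν` except for a correction of size `lam` at the
positions `t ≡ s mod N + 1`, where the residue `s` is random. -/
theorem exists_tower_labels (hμ : IsAtomless μ) {B : Set X} (hB : MeasurableSet B)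
    {ν : A → ℝ} (hν : ∀ a, 0 < ν a) (hν1 : ∑ a, ν a = 1) (a₀ : A) {q : X → Q} (hq : Measurable q)
    (N H : ℕ) {lam : Q → (Fin N → A) → ℝ} (hlam0 : ∀ c v, 0 ≤ lam c v)
    (hlam1 : ∀ c v, lam c v ≤ ν a₀) :
    ∃ ℓ : ℕ → X → A, (∀ t, Measurable (ℓ t)) ∧ (∀ t x, (t < N + 1 ∨ H ≤ t) → ℓ t x = a₀) ∧
      (∀ t < N + 1, t < H → ∀ c v, μ.real {b | b ∈ B ∧ q (T^[t] b) = c ∧ tail N ℓ t b = v} =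
        μ.real {b | b ∈ B ∧ q (T^[t] b) = c} * ∏ i : Fin N, labelLaw ν a₀ (N + 1) H (t + 1 + i) (v i)) ∧
      (∀ t, N + 1 ≤ t → t < H → ¬ (2 * (N + 1) ≤ t ∧ t + N < H) → ∀ c v a,
        μ.real {b | b ∈ B ∧ q (T^[t] b) = c ∧ tail N ℓ t b = v ∧ ℓ t b = a} =
        ν a * μ.real {b | b ∈ B ∧ q (T^[t] b) = c ∧ tail N ℓ t b = v}) ∧
      (∀ t, 2 * (N + 1) ≤ t → t + N < H → ∀ c v a,
        μ.real {b | b ∈ B ∧ q (T^[t] b) = c ∧ tail N ℓ t b = v ∧ ℓ t b = a} =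
        ν a * μ.real {b | b ∈ B ∧ q (T^[t] b) = c ∧ tail N ℓ t b = v} -
        lam c v * ((if a = a₀ then 1 else 0) - ν a) *
          (μ.real {b | b ∈ B ∧ q (T^[t] b) = c} / (N + 1) * ∏ i, ν (v i))) := by
  classical
  have hmT : ∀ i, Measurable (T^[i]) := fun i => T.measurable.iterate i
  -- `R` records q along the whole column, so that the uniform residue s drawn next is independent
  -- of q at every level.
  let R : X → Fin H → Q := fun x t => q (T^[t] x)
  have hR : Measurable R := measurable_pi_lambda _ fun t => hq.comp (hmT _)
  obtain ⟨s, hs, hs'⟩ := hμ.exists_draw (A := Fin (N + 1)) hB hR (K := fun _ _ => 1 / (N + 1 : ℝ))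
    (fun _ _ => by positivity) (fun _ => by simp; field_simp)
  let D : X → (Fin H → Q) × Fin (N + 1) := fun x => (R x, s x)
  have hD : Measurable D := hR.prodMk hs
  -- The tilt takes mass lam away from a₀ and redistributes it according to ν; nonnegativity at a₀
  -- is where lam ≤ ν a₀ enters. Tilted positions are N + 1 apart, so none lies in the tail of
  -- another. The range 2(N + 1) ≤ t < H - N also keeps the tails of the lowest N + 1 positions
  -- untilted and the tails of tilted positions inside the tower.
  let K : ℕ → ((Fin H → Q) × Fin (N + 1)) × (Fin N → A) → A → ℝ := fun t z a =>
    if h : 2 * (N + 1) ≤ t ∧ t + N < H ∧ t % (N + 1) = z.1.2 then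
      (1 + lam (z.1.1 ⟨t, by omega⟩) z.2) * ν a -
        lam (z.1.1 ⟨t, by omega⟩) z.2 * (if a = a₀ then 1 else 0)
    else ν a
  have hK : ∀ t z a, 0 ≤ K t z a := by
    intro t z a
    simp only [K]
    split_ifs with h1 h2
    · subst h2
      have l0 := hlam0 (z.1.1 ⟨t, by omega⟩) z.2
      have l1 := hlam1 (z.1.1 ⟨t, by omega⟩) z.2
      nlinarith [hν a]
    · have l0 := hlam0 (z.1.1 ⟨t, by omega⟩) z.2
      have := hν a
      simp only [mul_zero, sub_zero]
      positivity
    · exact (hν a).le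
  have hK1 : ∀ t z, ∑ a, K t z a = 1 := by
    intro t z
    simp only [K]
    split_ifs with h1
    · rw [Finset.sum_sub_distrib, ← Finset.mul_sum, ← Finset.mul_sum, hν1]
      simp
    · exact hν1
  obtain ⟨ℓ, h1, h2, h3⟩ := hμ.exists_labels hB hD N (N + 1) H a₀ hK hK1
  refine ⟨ℓ, h1, h2, ?_, ?_, ?_⟩
  · intro t ht htH c v
    have := measureReal_tail_eq (μ := μ) (ν := ν) h2 h3 {d | d.1 ⟨t, htH⟩ = c} t (by
      intro u hu1 hu2 hu3 hu4 d _ v a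
      simp only [K]
      rw [dif_neg (by omega)]) v
    exact this
  · intro t ht1 ht2 ht3 c v a
    have := h3 t ht1 ht2 {z | z.1.1 ⟨t, ht2⟩ = c ∧ z.2 = v} a (ν a) (by
      intro z _
      simp only [K]
      rw [dif_neg (by tauto)])
    simp only [Set.mem_ofPred_eq, D, R, and_assoc] at this
    exact this
  · intro t ht1 ht2 c v a
    have htH : t < H := by omega
    let j : Fin (N + 1) := ⟨t % (N + 1), Nat.mod_lt _ (by omega)⟩
    have hsm : MeasurableSet (s ⁻¹' {j}) := hs (measurableSet_singleton j)
    have e1 := h3 t (by omega) htH {z | (z.1.1 ⟨t, htH⟩ = c ∧ z.2 = v) ∧ z.1.2 = j} a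
      ((1 + lam c v) * ν a - lam c v * (if a = a₀ then 1 else 0)) (by
      rintro z ⟨⟨hz1, hz2⟩, hz3⟩
      simp only [K]
      rw [dif_pos ⟨ht1, ht2, by rw [hz3]⟩, hz1, hz2])
    have e2 := h3 t (by omega) htH {z | (z.1.1 ⟨t, htH⟩ = c ∧ z.2 = v) ∧ z.1.2 ≠ j} a (ν a) (by
      rintro z ⟨⟨hz1, hz2⟩, hz3⟩
      simp only [K]
      rw [dif_neg]
      rintro ⟨-, -, h⟩
      exact hz3 (Fin.ext h.symm))
    -- Once the residue is that of t, the positions t + 1, …, t + N are untilted, so the tail of t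
    -- has an exact product law.
    have e3 := measureReal_tail_eq (μ := μ) (ν := ν) h2 h3
      {d | d.1 ⟨t, htH⟩ = c ∧ d.2 = j} t (by
      rintro u hu1 hu2 hu3 hu4 d ⟨-, hd⟩ v a
      simp only [K]
      rw [dif_neg]
      rintro ⟨-, -, h⟩
      rw [hd] at h
      have h : u ≡ t [MOD (N + 1)] := h
      have := (Nat.modEq_iff_dvd' hu1.le).1 h.symm
      have := Nat.le_of_dvd (by omega) this
      omega) v
    have e4 : ∏ i : Fin N, labelLaw ν a₀ (N + 1) H (t + 1 + i) (v i) = ∏ i, ν (v i) := by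
      refine Finset.prod_congr rfl fun i _ => ?_
      rw [labelLaw, if_pos (by omega)]
    have e5 : μ.real {b | b ∈ B ∧ q (T^[t] b) = c ∧ s b = j} =
        μ.real {b | b ∈ B ∧ q (T^[t] b) = c} / (N + 1) := by
      rw [measureReal_eq_sum_inter_fiber hR, measureReal_eq_sum_inter_fiber hR
        {b | b ∈ B ∧ q (T^[t] b) = c}, Finset.sum_div]
      refine Finset.sum_congr rfl fun r _ => ?_
      by_cases hr : r ⟨t, htH⟩ = c
      · have a1 : {b | b ∈ B ∧ q (T^[t] b) = c ∧ s b = j} ∩ R ⁻¹' {r} =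
            B ∩ R ⁻¹' {r} ∩ s ⁻¹' {j} := by
          ext b
          simp only [Set.mem_inter_iff, Set.mem_ofPred_eq, Set.mem_preimage,
            Set.mem_singleton_iff]
          constructor
          · rintro ⟨⟨a1, a2, a3⟩, a4⟩; exact ⟨⟨a1, a4⟩, a3⟩
          · rintro ⟨⟨a1, a4⟩, a3⟩; exact ⟨⟨a1, by rw [← hr, ← a4], a3⟩, a4⟩
        have a2 : {b | b ∈ B ∧ q (T^[t] b) = c} ∩ R ⁻¹' {r} = B ∩ R ⁻¹' {r} := by
          ext b
          simp only [Set.mem_inter_iff, Set.mem_ofPred_eq, Set.mem_preimage,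
            Set.mem_singleton_iff]
          constructor
          · rintro ⟨⟨a1, a2⟩, a4⟩; exact ⟨a1, a4⟩
          · rintro ⟨a1, a4⟩; exact ⟨⟨a1, by rw [← hr, ← a4]⟩, a4⟩
        rw [a1, a2, hs']
        ring
      · have a0 : ∀ b, R b = r → q (T^[t] b) ≠ c := fun b hb h => hr (by rw [← hb, ← h])
        have a1 : {b | b ∈ B ∧ q (T^[t] b) = c ∧ s b = j} ∩ R ⁻¹' {r} = ∅ := by
          ext b
          simp only [Set.mem_inter_iff, Set.mem_ofPred_eq, Set.mem_preimage,
            Set.mem_singleton_iff, Set.mem_empty_iff_false, iff_false]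
          rintro ⟨⟨-, h, -⟩, h'⟩; exact a0 b h' h
        have a2 : {b | b ∈ B ∧ q (T^[t] b) = c} ∩ R ⁻¹' {r} = ∅ := by
          ext b
          simp only [Set.mem_inter_iff, Set.mem_ofPred_eq, Set.mem_preimage,
            Set.mem_singleton_iff, Set.mem_empty_iff_false, iff_false]
          rintro ⟨⟨-, h⟩, h'⟩; exact a0 b h' h
        rw [a1, a2]; simp
    simp only [Set.mem_ofPred_eq, D, R] at e1 e2 e3
    rw [e4, e5] at e3
    have f1 := measureReal_inter_add_sdiff (μ := μ)
      (s := {b | b ∈ B ∧ q (T^[t] b) = c ∧ tail N ℓ t b = v ∧ ℓ t b = a}) hsm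
    have f2 := measureReal_inter_add_sdiff (μ := μ)
      (s := {b | b ∈ B ∧ q (T^[t] b) = c ∧ tail N ℓ t b = v}) hsm
    have g1 : {b | b ∈ B ∧ q (T^[t] b) = c ∧ tail N ℓ t b = v ∧ ℓ t b = a} ∩ s ⁻¹' {j} =
        {x | x ∈ B ∧ ((q (T^[t] x) = c ∧ tail N ℓ t x = v) ∧ s x = j) ∧ ℓ t x = a} := by
      ext b
      simp only [Set.mem_inter_iff, Set.mem_ofPred_eq, Set.mem_preimage, Set.mem_singleton_iff]
      tauto
    have g2 : {b | b ∈ B ∧ q (T^[t] b) = c ∧ tail N ℓ t b = v ∧ ℓ t b = a} \ s ⁻¹' {j} =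
        {x | x ∈ B ∧ ((q (T^[t] x) = c ∧ tail N ℓ t x = v) ∧ s x ≠ j) ∧ ℓ t x = a} := by
      ext b
      simp only [Set.mem_sdiff, Set.mem_ofPred_eq, Set.mem_preimage, Set.mem_singleton_iff]
      tauto
    have g3 : {b | b ∈ B ∧ q (T^[t] b) = c ∧ tail N ℓ t b = v} ∩ s ⁻¹' {j} =
        {x | x ∈ B ∧ (q (T^[t] x) = c ∧ tail N ℓ t x = v) ∧ s x = j} := by
      ext b
      simp only [Set.mem_inter_iff, Set.mem_ofPred_eq, Set.mem_preimage, Set.mem_singleton_iff]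
      tauto
    have g4 : {b | b ∈ B ∧ q (T^[t] b) = c ∧ tail N ℓ t b = v} \ s ⁻¹' {j} =
        {x | x ∈ B ∧ (q (T^[t] x) = c ∧ tail N ℓ t x = v) ∧ s x ≠ j} := by
      ext b
      simp only [Set.mem_sdiff, Set.mem_ofPred_eq, Set.mem_preimage, Set.mem_singleton_iff]
      tauto
    have g5 : {x | x ∈ B ∧ (q (T^[t] x) = c ∧ s x = j) ∧ tail N ℓ t x = v} =
        {x | x ∈ B ∧ (q (T^[t] x) = c ∧ tail N ℓ t x = v) ∧ s x = j} := by
      ext b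
      simp only [Set.mem_ofPred_eq]
      tauto
    rw [g1, g2, e1, e2] at f1
    rw [g3, g4] at f2
    rw [g5] at e3
    rw [← f1, ← f2, e3]
    ring

end CodedFunction

end LatticeLCLT

namespace LatticeLCLT

section CodedFunction

variable {X : Type*} [MeasurableSpace X] {μ : Measure X} [IsProbabilityMeasure μ] {T : X ≃ᵐ X}
  {A : Type*} [Fintype A] [DecidableEq A] [MeasurableSpace A] [MeasurableSingletonClass A]
  {Q : Type*} [Fintype Q] [MeasurableSpace Q] [MeasurableSingletonClass Q]

/-- There is a function whose value has law `ν` and is independent of its next `N` values together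
with a given finitely valued function. -/
theorem exists_function_indep_future (hT : Ergodic T μ) (hμ : IsAtomless μ) {ν : A → ℝ}
    (hν : ∀ a, 0 < ν a) (hν1 : ∑ a, ν a = 1) {q : X → Q} (hq : Measurable q) (N : ℕ) :
    ∃ f : X → A, Measurable f ∧ ∀ a (v : Fin N → A) c,
      μ.real {x | q x = c ∧ (fun i : Fin N => f (T^[(i : ℕ) + 1] x)) = v ∧ f x = a} =
        ν a * μ.real {x | q x = c ∧ (fun i : Fin N => f (T^[(i : ℕ) + 1] x)) = v} := by
  have hmp := hT.toMeasurePreserving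
  have hmT : ∀ i, Measurable (T^[i]) := fun i => T.measurable.iterate i
  have hA : Nonempty A := by
    by_contra hc
    rw [not_nonempty_iff] at hc
    simp at hν1
  obtain ⟨a₀⟩ := hA
  have hν_le : ∀ a, ν a ≤ 1 := fun a => hν1 ▸ Finset.single_le_sum (fun b _ => (hν b).le)
    (Finset.mem_univ a)
  obtain ⟨c₀, hc₀, hc₀'⟩ : ∃ c₀ > 0, ∀ v : Fin N → A, c₀ ≤ ∏ i, ν (v i) := by
    have : Nonempty (Fin N → A) := ⟨fun _ => a₀⟩
    obtain ⟨v, hv⟩ := Finite.exists_min fun v : Fin N → A => ∏ i, ν (v i)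
    exact ⟨_, Finset.prod_pos fun i _ => hν _, hv⟩
  obtain ⟨ρ, hρ, hρ'⟩ : ∃ ρ > 0, ∀ c : Q, μ.real (q ⁻¹' {c}) ≠ 0 → ρ ≤ μ.real (q ⁻¹' {c}) := by
    classical
    have hQ : Nonempty Q := by
      have : (Set.univ : Set X).Nonempty := by
        by_contra h
        rw [Set.not_nonempty_iff_eq_empty] at h
        have : μ Set.univ = 0 := by rw [h, measure_empty]
        simp at this
      exact ⟨q this.some⟩
    obtain ⟨c, hc⟩ := Finite.exists_min fun c : Q =>
      if μ.real (q ⁻¹' {c}) = 0 then 1 else μ.real (q ⁻¹' {c})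
    refine ⟨_, ?_, fun c' hc' => (hc c').trans (by rw [if_neg hc'])⟩
    split_ifs with h
    · exact one_pos
    · exact lt_of_le_of_ne measureReal_nonneg (Ne.symm h)
  -- η will bound the mass `u` of the points with forced label. The first entry leaves mass at least
  -- ρ/2 of each nonnull fibre of q on the levels that can be tilted; the second then gives u ≤ ν a₀
  -- · ∏ ν(vᵢ) · m, that is, lam ≤ ν a₀.
  set η : ℝ := min (ρ / 2) (ν a₀ * c₀ * ρ / (2 * (N + 1))) with hη
  have hη0 : 0 < η := by
    have := hν a₀
    positivity
  obtain ⟨H, hH⟩ := exists_nat_gt ((3 * (N + 1)) / (η / 2))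
  have hH0 : 0 < H := by
    have : (0 : ℝ) < H := lt_of_le_of_lt (by positivity) hH
    exact_mod_cast this
  have hH1 : (3 * (N + 1) : ℝ) ≤ η / 2 * H := by
    rw [div_lt_iff₀ (by positivity)] at hH
    linarith
  obtain ⟨B, hB, hdis, hout⟩ := exists_rokhlin_tower hT hμ hH0 (half_pos hη0)
  have hBH : H * μ.real B ≤ 1 := by
    have := measureReal_tower_decomp hmp hB hdis (MeasurableSet.univ (α := X))
    simp only [Set.mem_univ, and_true, Set.ofPred_mem_eq, Finset.sum_const, Finset.card_range,
      nsmul_eq_mul, probReal_univ] at this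
    linarith [measureReal_nonneg (μ := μ) (s := {x | ∀ i < H, T.symm^[i] x ∉ B})]
  have hB3 : 3 * (N + 1) * μ.real B ≤ η / 2 := by
    have h1 : 3 * (N + 1) * μ.real B ≤ η / 2 * H * μ.real B := by
      gcongr
    have h2 : η / 2 * (H * μ.real B) ≤ η / 2 * 1 := by gcongr
    linarith
  let β : ℕ → Q → ℝ := fun t c => μ.real {b | b ∈ B ∧ q (T^[t] b) = c}
  have hβ0 : ∀ t c, 0 ≤ β t c := fun t c => measureReal_nonneg
  have hβB : ∀ t c, β t c ≤ μ.real B := fun t c => measureReal_mono fun x hx => hx.1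
  let out : Q → ℝ := fun c => μ.real {x | (∀ i < H, T.symm^[i] x ∉ B) ∧ q x = c}
  have hout0 : ∀ c, 0 ≤ out c := fun c => measureReal_nonneg
  have hout1 : ∀ c, out c ≤ η / 2 := fun c =>
    (measureReal_mono fun x hx => hx.1).trans hout
  have hqc : ∀ c, MeasurableSet {x | q x = c} := fun c => hq (measurableSet_singleton c)
  have hdec : ∀ c, μ.real (q ⁻¹' {c}) = out c + ∑ t ∈ Finset.range H, β t c := fun c =>
    measureReal_tower_decomp hmp hB hdis (hqc c)
  have hlaw0 : ∀ u a, 0 ≤ labelLaw ν a₀ (N + 1) H u a := by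
    intro u a
    unfold labelLaw
    split_ifs
    · exact (hν a).le
    · exact zero_le_one
    · exact le_rfl
  have hlaw1 : ∀ u a, labelLaw ν a₀ (N + 1) H u a ≤ 1 := by
    intro u a
    unfold labelLaw
    split_ifs
    · exact hν_le a
    · exact le_rfl
    · exact zero_le_one
  let τ : ℕ → Q → (Fin N → A) → ℝ := fun t c v =>
    β t c * ∏ i : Fin N, labelLaw ν a₀ (N + 1) H (t + 1 + i) (v i)
  have hτ0 : ∀ t c v, 0 ≤ τ t c v := fun t c v =>
    mul_nonneg (hβ0 t c) (Finset.prod_nonneg fun i _ => hlaw0 _ _)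
  have hτ1 : ∀ t c v, τ t c v ≤ β t c := fun t c v =>
    mul_le_of_le_one_right (hβ0 t c) (Finset.prod_le_one (fun i _ => hlaw0 _ _)
      fun i _ => hlaw1 _ _)
  -- The mass of the points with data (c, v) whose label is forced to be a₀, off the tower or on its
  -- lowest N + 1 levels. Their contribution to the defect is (δ_{a₀} - ν) · u.
  let u : Q → (Fin N → A) → ℝ := fun c v =>
    (if v = fun _ => a₀ then out c else 0) + ∑ t ∈ Finset.range H with t < N + 1, τ t c v
  have hu0 : ∀ c v, 0 ≤ u c v := fun c v => add_nonneg (by split_ifs; exacts [hout0 c, le_rfl])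
    (Finset.sum_nonneg fun t _ => hτ0 t c v)
  have hu1 : ∀ c v, u c v ≤ out c + ∑ t ∈ Finset.range H with t < N + 1, β t c := fun c v =>
    add_le_add (by split_ifs; exacts [le_rfl, hout0 c]) (Finset.sum_le_sum fun t _ => hτ1 t c v)
  -- The mass available for tilting; the denominator N + 1 is the probability that the random
  -- residue selects a given position.
  let m : Q → ℝ := fun c =>
    ∑ t ∈ Finset.range H with 2 * (N + 1) ≤ t ∧ t + N < H, β t c / (N + 1)
  have hm0 : ∀ c, 0 ≤ m c := fun c => Finset.sum_nonneg fun t _ =>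
    div_nonneg (hβ0 t c) (by positivity)
  have hcard1 : ((Finset.range H).filter fun t => t < N + 1).card ≤ N + 1 := by
    refine (Finset.card_le_card (t := Finset.range (N + 1)) fun t ht => ?_).trans (by simp)
    simp only [Finset.mem_filter, Finset.mem_range] at ht ⊢
    omega
  have hcard2 : ((Finset.range H).filter fun t => ¬ (2 * (N + 1) ≤ t ∧ t + N < H)).card ≤
      3 * (N + 1) := by
    refine (Finset.card_le_card (t := Finset.range (2 * (N + 1)) ∪ Finset.Ico (H - N) H)
      fun t ht => ?_).trans ((Finset.card_union_le _ _).trans ?_)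
    · simp only [Finset.mem_filter, Finset.mem_range, Finset.mem_union, Finset.mem_Ico] at ht ⊢
      omega
    · simp only [Finset.card_range, Nat.card_Ico]
      omega
  have hsumle : ∀ (p : ℕ → Prop) [DecidablePred p] (k : ℕ) (c : Q),
      ((Finset.range H).filter p).card ≤ k →
      ∑ t ∈ Finset.range H with p t, β t c ≤ k * μ.real B := by
    intro p _ k c hk
    refine (Finset.sum_le_card_nsmul _ _ (μ.real B) fun t _ => hβB t c).trans ?_
    rw [nsmul_eq_mul]
    gcongr
  have hu2 : ∀ c v, u c v ≤ η := by
    intro c v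
    have h1 := hsumle (fun t => t < N + 1) (N + 1) c hcard1
    have h2 := hu1 c v
    have h3 := hout1 c
    push_cast at h1
    nlinarith [measureReal_nonneg (μ := μ) (s := B)]
  have hm1 : ∀ c, μ.real (q ⁻¹' {c}) ≠ 0 → ρ / (2 * (N + 1)) ≤ m c := by
    intro c hc
    have h1 := hsumle _ _ c hcard2
    have h2 := hdec c
    rw [← Finset.sum_filter_add_sum_filter_not (Finset.range H)
      (fun t => 2 * (N + 1) ≤ t ∧ t + N < H)] at h2
    have h3 := hout1 c
    have h4 := hρ' c hc
    have h5 : η ≤ ρ / 2 := min_le_left _ _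
    push_cast at h1
    simp only [m]
    rw [← Finset.sum_div, div_le_div_iff₀ (by positivity) (by positivity)]
    have h6 : ρ / 2 ≤ ∑ t ∈ Finset.range H with 2 * (N + 1) ≤ t ∧ t + N < H, β t c := by linarith
    have h7 : (0 : ℝ) < N + 1 := by positivity
    nlinarith
  let lam : Q → (Fin N → A) → ℝ := fun c v => u c v / ((∏ i, ν (v i)) * m c)
  have hlam0 : ∀ c v, 0 ≤ lam c v := fun c v => div_nonneg (hu0 c v)
    (mul_nonneg (Finset.prod_nonneg fun i _ => (hν _).le) (hm0 c))
  have hu3 : ∀ c v, μ.real (q ⁻¹' {c}) = 0 → u c v = 0 := by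
    intro c v hc
    refine le_antisymm ((hu1 c v).trans ?_) (hu0 c v)
    rw [← hc, hdec]
    refine add_le_add le_rfl ?_
    exact Finset.sum_le_sum_of_subset_of_nonneg (Finset.filter_subset _ _) fun t _ _ => hβ0 t c
  have hlam1 : ∀ c v, lam c v ≤ ν a₀ := by
    intro c v
    by_cases hc : μ.real (q ⁻¹' {c}) = 0
    · simp only [lam, hu3 c v hc, zero_div]
      exact (hν a₀).le
    · have hmc := hm1 c hc
      have hmpos : 0 < m c := lt_of_lt_of_le (by positivity) hmc
      have hp : 0 < ∏ i, ν (v i) := hc₀.trans_le (hc₀' v)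
      simp only [lam]
      rw [div_le_iff₀ (by positivity)]
      calc u c v ≤ η := hu2 c v
        _ ≤ ν a₀ * c₀ * ρ / (2 * (N + 1)) := min_le_right _ _
        _ = ν a₀ * (c₀ * (ρ / (2 * (N + 1)))) := by ring
        _ ≤ ν a₀ * ((∏ i, ν (v i)) * m c) := by
          have := (hν a₀).le
          gcongr
          exact hc₀' v
  have hlam2 : ∀ c v, lam c v * ((∏ i, ν (v i)) * m c) = u c v := by
    intro c v
    by_cases hc : μ.real (q ⁻¹' {c}) = 0
    · simp [lam, hu3 c v hc]
    · have hmpos : 0 < m c := lt_of_lt_of_le (by positivity) (hm1 c hc)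
      have hp : 0 < ∏ i, ν (v i) := hc₀.trans_le (hc₀' v)
      exact div_mul_cancel₀ _ (by positivity)
  obtain ⟨ℓ, h1, h2, h3, h4, h5⟩ := exists_tower_labels (T := T) hμ hB hν hν1 a₀ hq N H hlam0 hlam1
  obtain ⟨f, f1, f2, f3⟩ := exists_tower_function hB hdis (N := N) h1 h2
  refine ⟨f, f1, fun a v c => ?_⟩
  have hfT : Measurable fun x => fun i : Fin N => f (T^[(i : ℕ) + 1] x) :=
    measurable_pi_lambda _ fun i => f1.comp (hmT _)
  have hE2 : MeasurableSet {x | q x = c ∧ (fun i : Fin N => f (T^[(i : ℕ) + 1] x)) = v} :=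
    (hqc c).inter (hfT (measurableSet_singleton v))
  have hE1 : MeasurableSet
      {x | q x = c ∧ (fun i : Fin N => f (T^[(i : ℕ) + 1] x)) = v ∧ f x = a} :=
    (hqc c).inter ((hfT (measurableSet_singleton v)).inter (f1 (measurableSet_singleton a)))
  have hft : ∀ b ∈ B, ∀ t < H, (fun i : Fin N => f (T^[(i : ℕ) + 1] (T^[t] b))) =
      tail N ℓ t b := by
    intro b hb t ht
    ext i
    rw [← Function.iterate_add_apply, f2 b hb _ (by omega), tail]
    congr 1
    omega
  have hlev1 : ∀ t < H, {b | b ∈ B ∧ T^[t] b ∈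
      {x | q x = c ∧ (fun i : Fin N => f (T^[(i : ℕ) + 1] x)) = v ∧ f x = a}} =
      {b | b ∈ B ∧ q (T^[t] b) = c ∧ tail N ℓ t b = v ∧ ℓ t b = a} := by
    intro t ht
    ext b
    simp only [Set.mem_ofPred_eq, and_congr_right_iff]
    intro hb
    rw [hft b hb t ht, f2 b hb t (by omega)]
    exact fun _ => Iff.rfl
  have hlev2 : ∀ t < H, {b | b ∈ B ∧ T^[t] b ∈
      {x | q x = c ∧ (fun i : Fin N => f (T^[(i : ℕ) + 1] x)) = v}} =
      {b | b ∈ B ∧ q (T^[t] b) = c ∧ tail N ℓ t b = v} := by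
    intro t ht
    ext b
    simp only [Set.mem_ofPred_eq, and_congr_right_iff]
    intro hb
    rw [hft b hb t ht]
    exact fun _ => Iff.rfl
  have ho1 : ∀ x, (∀ i < H, T.symm^[i] x ∉ B) →
      (fun i : Fin N => f (T^[(i : ℕ) + 1] x)) = fun _ => a₀ := fun x hx =>
    funext fun i => f3 x hx _ (by omega)
  have ho2 : ∀ x, (∀ i < H, T.symm^[i] x ∉ B) → f x = a₀ := fun x hx => f3 x hx 0 (by omega)
  have hout_eq1 : μ.real {x | (∀ i < H, T.symm^[i] x ∉ B) ∧ x ∈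
      {x | q x = c ∧ (fun i : Fin N => f (T^[(i : ℕ) + 1] x)) = v ∧ f x = a}} =
      (if a = a₀ then 1 else 0) * (if v = fun _ => a₀ then out c else 0) := by
    by_cases ha : a = a₀
    · by_cases hv : v = fun _ => a₀
      · rw [if_pos ha, if_pos hv, one_mul]
        simp only [out]
        congr 1
        ext x
        simp only [Set.mem_ofPred_eq, and_congr_right_iff]
        intro hx
        rw [ho1 x hx, ho2 x hx, ha, hv]
        simp
      · rw [if_neg hv, mul_zero]
        convert measureReal_empty
        ext x
        simp only [Set.mem_ofPred_eq, Set.mem_empty_iff_false, iff_false]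
        rintro ⟨hx, -, h, -⟩
        exact hv (by rw [← h, ho1 x hx])
    · rw [if_neg ha, zero_mul]
      convert measureReal_empty
      ext x
      simp only [Set.mem_ofPred_eq, Set.mem_empty_iff_false, iff_false]
      rintro ⟨hx, -, -, h⟩
      exact ha (by rw [← h, ho2 x hx])
  have hout_eq2 : μ.real {x | (∀ i < H, T.symm^[i] x ∉ B) ∧ x ∈
      {x | q x = c ∧ (fun i : Fin N => f (T^[(i : ℕ) + 1] x)) = v}} =
      (if v = fun _ => a₀ then out c else 0) := by
    by_cases hv : v = fun _ => a₀
    · rw [if_pos hv]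
      simp only [out]
      congr 1
      ext x
      simp only [Set.mem_ofPred_eq, and_congr_right_iff]
      intro hx
      rw [ho1 x hx, hv]
      simp
    · rw [if_neg hv]
      convert measureReal_empty
      ext x
      simp only [Set.mem_ofPred_eq, Set.mem_empty_iff_false, iff_false]
      rintro ⟨hx, -, h⟩
      exact hv (by rw [← h, ho1 x hx])
  set δa : ℝ := if a = a₀ then 1 else 0 with hδa
  have hlevel : ∀ t ∈ Finset.range H,
      μ.real {b | b ∈ B ∧ q (T^[t] b) = c ∧ tail N ℓ t b = v ∧ ℓ t b = a} =
      ν a * μ.real {b | b ∈ B ∧ q (T^[t] b) = c ∧ tail N ℓ t b = v} +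
        ((δa - ν a) * (if t < N + 1 then τ t c v else 0) -
        (δa - ν a) * (lam c v * (∏ i, ν (v i)) *
          (if 2 * (N + 1) ≤ t ∧ t + N < H then β t c / (N + 1) else 0))) := by
    intro t ht
    rw [Finset.mem_range] at ht
    by_cases htN : t < N + 1
    · rw [if_pos htN, if_neg (by omega), h3 t htN ht c v]
      have : ∀ b, ℓ t b = a₀ := fun b => h2 t b (Or.inl htN)
      simp only [this]
      by_cases ha : a = a₀
      · subst ha
        simp only [and_true, δa, if_true]
        rw [h3 t htN ht c v]
        simp only [τ, β]
        ring
      · simp only [Ne.symm ha, and_false, δa, if_neg ha, τ, β, Set.ofPred_false, measureReal_empty]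
        ring
    · rw [if_neg htN]
      by_cases htm : 2 * (N + 1) ≤ t ∧ t + N < H
      · rw [if_pos htm, h5 t htm.1 htm.2 c v a]
        simp only [β, δa]
        ring
      · rw [if_neg htm, h4 t (by omega) ht htm c v a]
        ring
  have hs1 := Finset.sum_congr rfl fun t ht =>
    (congrArg μ.real (hlev1 t (Finset.mem_range.1 ht))).trans (hlevel t ht)
  have hs2 : ∑ t ∈ Finset.range H, _ = _ := Finset.sum_congr rfl fun t ht =>
    congrArg μ.real (hlev2 t (Finset.mem_range.1 ht))
  rw [measureReal_tower_decomp hmp hB hdis hE1, measureReal_tower_decomp hmp hB hdis hE2,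
    hout_eq1, hout_eq2, hs1, hs2, Finset.sum_add_distrib, ← Finset.mul_sum,
    Finset.sum_sub_distrib, ← Finset.mul_sum, ← Finset.mul_sum, ← Finset.mul_sum,
    ← Finset.sum_filter, ← Finset.sum_filter]
  -- After summation over the levels only (δₐ - ν a)(u - lam · ∏ ν(vᵢ) · m) is left, and it vanishes
  -- by the choice of lam.
  have hl := hlam2 c v
  simp only [u, m] at hl
  linear_combination (δa - ν a) * (-hl)

end CodedFunction

end LatticeLCLT

/-! ### Exactly i.i.d. windows independent of given data. -/

namespace LatticeLCLT

section CodedFunction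

variable {X : Type*} [MeasurableSpace X] {μ : Measure X} [IsProbabilityMeasure μ] {T : X ≃ᵐ X}
  {A : Type*} [Fintype A] [DecidableEq A] [MeasurableSpace A] [MeasurableSingletonClass A]
  {P : Type*} [Fintype P] [MeasurableSpace P] [MeasurableSingletonClass P]

/-- There is a function with `N + 1` consecutive values i.i.d. of law `ν` and independent of a given
finitely valued function. -/
theorem exists_function_iid_window (hT : Ergodic T μ) (hμ : IsAtomless μ) {ν : A → ℝ}
    (hν : ∀ a, 0 < ν a) (hν1 : ∑ a, ν a = 1) {π : X → P} (hπ : Measurable π) (N : ℕ) :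
    ∃ f : X → A, Measurable f ∧ (∀ a, μ.real (f ⁻¹' {a}) = ν a) ∧
      ∀ (w : Fin (N + 1) → A) c,
        μ.real {x | π x = c ∧ ∀ j : Fin (N + 1), f (T^[j] x) = w j} =
          (∏ j, ν (w j)) * μ.real {x | π x = c} := by
  have hmp := hT.toMeasurePreserving
  have hmT : ∀ i, Measurable (T^[i]) := fun i => T.measurable.iterate i
  have hmS : ∀ i, Measurable (T.symm^[i]) := fun i => T.symm.measurable.iterate i
  -- π is recorded at the present and N past times, so that q at T^[s] x still knows π x for every s
  -- ≤ N.
  let q : X → Fin (N + 1) → P := fun x s => π (T.symm^[s] x)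
  have hq : Measurable q := measurable_pi_lambda _ fun s => hπ.comp (hmS _)
  obtain ⟨f, hf, hf1⟩ := exists_function_indep_future hT hμ hν hν1 hq N
  have hZ : Measurable fun x => (q x, fun i : Fin N => f (T^[(i : ℕ) + 1] x)) :=
    hq.prodMk (measurable_pi_lambda _ fun i => hf.comp (hmT _))
  have hset : ∀ (S : Set ((Fin (N + 1) → P) × (Fin N → A))) (a : A),
      μ.real {x | (q x, fun i : Fin N => f (T^[(i : ℕ) + 1] x)) ∈ S ∧ f x = a} =
      ν a * μ.real {x | (q x, fun i : Fin N => f (T^[(i : ℕ) + 1] x)) ∈ S} := by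
    intro S a
    rw [measureReal_eq_sum_inter_fiber hZ, measureReal_eq_sum_inter_fiber hZ
      {x | (q x, fun i : Fin N => f (T^[(i : ℕ) + 1] x)) ∈ S}, Finset.mul_sum]
    refine Finset.sum_congr rfl fun z _ => ?_
    by_cases hz : z ∈ S
    · have := hf1 a z.2 z.1
      refine (congrArg μ.real ?_).trans (this.trans (congrArg (fun E => ν a * μ.real E) ?_))
      · ext x
        simp only [Set.mem_inter_iff, Set.mem_ofPred_eq, Set.mem_preimage, Set.mem_singleton_iff,
          Prod.ext_iff]
        constructor
        · rintro ⟨⟨-, h1⟩, h2, h3⟩; exact ⟨h2, h3, h1⟩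
        · rintro ⟨h2, h3, h1⟩
          refine ⟨⟨?_, h1⟩, h2, h3⟩
          rwa [h2, h3]
      · ext x
        simp only [Set.mem_inter_iff, Set.mem_ofPred_eq, Set.mem_preimage, Set.mem_singleton_iff,
          Prod.ext_iff]
        constructor
        · rintro ⟨h2, h3⟩
          refine ⟨?_, h2, h3⟩
          rwa [h2, h3]
        · rintro ⟨-, h2, h3⟩; exact ⟨h2, h3⟩
    · have e : ∀ x, (q x, fun i : Fin N => f (T^[(i : ℕ) + 1] x)) ∈ S →
          (q x, fun i : Fin N => f (T^[(i : ℕ) + 1] x)) ≠ z := fun x hx h => hz (h ▸ hx)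
      have e1 : {x | (q x, fun i : Fin N => f (T^[(i : ℕ) + 1] x)) ∈ S ∧ f x = a} ∩
          (fun x => (q x, fun i : Fin N => f (T^[(i : ℕ) + 1] x))) ⁻¹' {z} = ∅ :=
        Set.eq_empty_of_forall_notMem fun x hx => e x hx.1.1 hx.2
      have e2 : {x | (q x, fun i : Fin N => f (T^[(i : ℕ) + 1] x)) ∈ S} ∩
          (fun x => (q x, fun i : Fin N => f (T^[(i : ℕ) + 1] x))) ⁻¹' {z} = ∅ :=
        Set.eq_empty_of_forall_notMem fun x hx => e x hx.1 hx.2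
      rw [e1, e2, measureReal_empty, mul_zero]
  refine ⟨f, hf, fun a => ?_, fun w c => ?_⟩
  · have := hset Set.univ a
    simp only [Set.mem_univ, true_and, Set.ofPred_true, probReal_univ, mul_one] at this
    exact this
  -- Times are peeled off from N downwards: seen from T^[s] x, the value at time s is independent of
  -- the later values together with π x.
  · have key : ∀ m : ℕ, m ≤ N + 1 →
        μ.real {x | π x = c ∧ ∀ j : Fin (N + 1), N + 1 ≤ j + m → f (T^[j] x) = w j} =
        (∏ j ∈ Finset.univ.filter (fun j : Fin (N + 1) => N + 1 ≤ j + m), ν (w j)) *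
          μ.real {x | π x = c} := by
      intro m
      induction m with
      | zero =>
        intro _
        have e : ∀ i : Fin (N + 1), ¬ N + 1 ≤ i + 0 := fun i => by omega
        rw [Finset.filter_false_of_mem (fun i _ => e i), Finset.prod_empty, one_mul]
        simp only [e, false_implies, implies_true, and_true]
      | succ m ih =>
        intro hm
        have ih := ih (by omega)
        let s : Fin (N + 1) := ⟨N - m, by omega⟩
        have hj : ∀ i : Fin (N + 1), N + 1 ≤ i + (m + 1) ↔ (i = s ∨ N + 1 ≤ i + m) := fun i => by
          rw [Fin.ext_iff]; simp only [s]; omega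
        have hfil : (Finset.univ.filter fun i : Fin (N + 1) => N + 1 ≤ i + (m + 1)) =
            insert s (Finset.univ.filter fun i : Fin (N + 1) => N + 1 ≤ i + m) := by
          ext i; simp [hj]
        rw [hfil, Finset.prod_insert (by simp [s]; omega), mul_assoc, ← ih]
        have := hset {z | z.1 s = c ∧ ∀ i : Fin (N + 1), ∀ hi : N + 1 ≤ i + m,
          z.2 ⟨i - s - 1, by omega⟩ = w i} (w s)
        have e : ∀ x, ((q (T^[s] x), fun i : Fin N => f (T^[(i : ℕ) + 1] (T^[s] x))) ∈
            {z : (Fin (N + 1) → P) × (Fin N → A) | z.1 s = c ∧ ∀ i : Fin (N + 1),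
              ∀ hi : N + 1 ≤ i + m, z.2 ⟨i - s - 1, by omega⟩ = w i}) ↔
            (π x = c ∧ ∀ i : Fin (N + 1), N + 1 ≤ i + m → f (T^[i] x) = w i) := by
          intro x
          simp only [Set.mem_ofPred_eq, q, symm_iterate_iterate]
          refine and_congr_right fun _ => forall_congr' fun i => forall_congr' fun hi => ?_
          rw [← Function.iterate_add_apply]
          have : (i : ℕ) - s - 1 + 1 + s = i := by simp only [s]; omega
          rw [this]
        have hS : ∀ E : Set X, MeasurableSet E → μ.real E = μ.real (T^[s] ⁻¹' E) := fun E hE =>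
          ((hmp.iterate s).measureReal_preimage hE.nullMeasurableSet).symm
        have hSm : MeasurableSet {x | (q x, fun i : Fin N => f (T^[(i : ℕ) + 1] x)) ∈
            {z : (Fin (N + 1) → P) × (Fin N → A) | z.1 s = c ∧ ∀ i : Fin (N + 1),
              ∀ hi : N + 1 ≤ i + m, z.2 ⟨i - s - 1, by omega⟩ = w i}} :=
          hZ (Set.toFinite _).measurableSet
        have this := (hS _ (hSm.inter (hf (measurableSet_singleton (w s))))).symm.trans
          (this.trans (congrArg (fun r => ν (w s) * r) (hS _ hSm)))
        refine (congrArg μ.real ?_).trans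
          (this.trans (congrArg (fun E => ν (w s) * μ.real E) ?_))
        · ext x
          simp only [Set.mem_ofPred_eq, Set.mem_preimage, Set.mem_inter_iff, hj,
            Set.mem_singleton_iff]
          have := e x
          simp only [Set.mem_ofPred_eq] at this
          rw [this]
          constructor
          · rintro ⟨a1, a2⟩
            exact ⟨⟨a1, fun i hi => a2 i (Or.inr hi)⟩, a2 s (Or.inl rfl)⟩
          · rintro ⟨⟨a1, a2⟩, a3⟩
            refine ⟨a1, ?_⟩
            rintro i (rfl | hi)
            · exact a3
            · exact a2 i hi
        · ext x
          exact e x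
    have := key (N + 1) le_rfl
    have e : ∀ i : Fin (N + 1), N + 1 ≤ i + (N + 1) := fun i => by omega
    simp only [e, true_implies, Finset.filter_true] at this
    exact this

/-- The previous result in terms of independence. -/
theorem exists_function_iIndepFun_window (hT : Ergodic T μ) (hμ : IsAtomless μ) {ν : A → ℝ}
    (hν : ∀ a, 0 < ν a) (hν1 : ∑ a, ν a = 1) {π : X → P} (hπ : Measurable π) (N : ℕ) :
    ∃ f : X → A, Measurable f ∧ (∀ a, μ (f ⁻¹' {a}) = ENNReal.ofReal (ν a)) ∧
      iIndepFun (fun (j : Fin (N + 1)) (x : X) => f (T^[j] x)) μ ∧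
      IndepFun (fun (x : X) (j : Fin (N + 1)) => f (T^[j] x)) π μ := by
  obtain ⟨f, hf, hf1, hf2⟩ := exists_function_iid_window hT hμ hν hν1 hπ N
  have hmp := hT.toMeasurePreserving
  have hfT : ∀ j : ℕ, Measurable fun x => f (T^[j] x) := fun j =>
    hf.comp (T.measurable.iterate j)
  have hV : Measurable fun (x : X) (j : Fin (N + 1)) => f (T^[j] x) :=
    measurable_pi_lambda _ fun j => hfT j
  have hmarg : ∀ a, μ (f ⁻¹' {a}) = ENNReal.ofReal (ν a) := fun a => by
    rw [← hf1, ofReal_measureReal]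
  have hmargj : ∀ (j : ℕ) a, μ.map (fun x => f (T^[j] x)) {a} = ENNReal.ofReal (ν a) := by
    intro j a
    rw [Measure.map_apply (hfT j) (measurableSet_singleton a), ← hmarg,
      ← (hmp.iterate j).measure_preimage (hf (measurableSet_singleton a)).nullMeasurableSet]
    rfl
  have hVw : ∀ w : Fin (N + 1) → A, μ.real {x | ∀ j : Fin (N + 1), f (T^[j] x) = w j} = ∏ j, ν (w j) := by
    intro w
    rw [measureReal_eq_sum_inter_fiber hπ]
    have h1 := measureReal_eq_sum_inter_fiber (μ := μ) hπ Set.univ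
    rw [probReal_univ] at h1
    rw [← mul_one (∏ j, ν (w j)), h1, Finset.mul_sum]
    refine Finset.sum_congr rfl fun c _ => ?_
    rw [Set.univ_inter]
    refine Eq.trans ?_ (hf2 w c)
    congr 1
    ext x
    simp only [Set.mem_inter_iff, Set.mem_ofPred_eq, Set.mem_preimage, Set.mem_singleton_iff]
    tauto
  have hVmap : ∀ w : Fin (N + 1) → A, μ.map (fun (x : X) (j : Fin (N + 1)) => f (T^[j] x)) {w} =
      ENNReal.ofReal (∏ j, ν (w j)) := by
    intro w
    rw [Measure.map_apply hV (measurableSet_singleton w), ← hVw, ofReal_measureReal]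
    congr 1
    ext x
    simp [funext_iff]
  refine ⟨f, hf, hmarg, ?_, ?_⟩
  · rw [iIndepFun_iff_map_fun_eq_pi_map fun j : Fin (N + 1) => (hfT j).aemeasurable]
    refine Measure.ext_of_singleton fun w => ?_
    rw [hVmap, Measure.pi_singleton, ENNReal.ofReal_prod_of_nonneg fun j _ => (hν _).le]
    exact Finset.prod_congr rfl fun j _ => (hmargj j (w j)).symm
  · rw [indepFun_iff_map_prod_eq_prod_map_map hV.aemeasurable hπ.aemeasurable]
    refine Measure.ext_of_singleton fun z => ?_
    obtain ⟨w, c⟩ := z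
    rw [Measure.map_apply (hV.prodMk hπ) (measurableSet_singleton _), ← Set.singleton_prod_singleton,
      Measure.prod_prod, hVmap, Measure.map_apply hπ (measurableSet_singleton c),
      ← ofReal_measureReal (μ := μ) (s := π ⁻¹' {c}),
      ← ENNReal.ofReal_mul (Finset.prod_nonneg fun j _ => (hν _).le),
      ← ofReal_measureReal (μ := μ)]
    congr 1
    refine Eq.trans ?_ (hf2 w c)
    congr 1
    ext x
    simp only [Set.mem_preimage, Set.mem_prod, Set.mem_singleton_iff, Set.mem_ofPred_eq,
      funext_iff]
    tauto

end CodedFunction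

end LatticeLCLT

/-! ### Parameters and existence of coding sequences. -/

namespace LatticeLCLT

theorem p_pos (k : ℕ) : 0 < p k := by
  unfold p
  split_ifs <;> positivity

theorem one_le_logb {k : ℕ} (hk : 2 ≤ k) : 1 ≤ Real.logb 2 k := by
  rw [Real.le_logb_iff_rpow_le (by norm_num) (by positivity), Real.rpow_one]
  exact_mod_cast hk

/-- `h k = 1 / (k log₂ k)`. -/
noncomputable def h (k : ℕ) : ℝ := 1 / (k * Real.logb 2 k)

theorem h_pos {k : ℕ} (hk : 2 ≤ k) : 0 < h k := by
  have h1 := one_le_logb hk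
  have h2 : (2 : ℝ) ≤ k := by exact_mod_cast hk
  unfold h
  positivity

theorem h_le_half {k : ℕ} (hk : 2 ≤ k) : h k ≤ 1 / 2 := by
  have h1 := one_le_logb hk
  have h2 : (2 : ℝ) ≤ k := by exact_mod_cast hk
  unfold h
  gcongr
  nlinarith

/-- The normalisation behind α: a coefficient ±p k in front of a translate of f̄_k contributes
variance exactly `h k`, whatever the size of p k. -/
theorem p_sq_mul_α_sq {k : ℕ} (hk : 2 ≤ k) : (p k : ℝ) ^ 2 * α k ^ 2 = h k := by
  have h1 := one_le_logb hk
  have h2 : (2 : ℝ) ≤ k := by exact_mod_cast hk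
  have h3 : (0 : ℝ) < p k := by exact_mod_cast p_pos k
  have h4 : √((k : ℝ) * Real.logb 2 k) ^ 2 = k * Real.logb 2 k := Real.sq_sqrt (by positivity)
  unfold α h
  rw [div_pow, mul_pow, h4]
  field_simp

theorem α_sq_pos {k : ℕ} (hk : 2 ≤ k) : 0 < α k ^ 2 := by
  have h3 : (0 : ℝ) < p k := by exact_mod_cast p_pos k
  have := p_sq_mul_α_sq hk ▸ h_pos hk
  exact pos_of_mul_pos_right this (by positivity)

theorem α_sq_le_h {k : ℕ} (hk : 2 ≤ k) : α k ^ 2 ≤ h k := by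
  rw [← p_sq_mul_α_sq hk]
  have h3 : (1 : ℝ) ≤ p k := by exact_mod_cast p_pos k
  exact le_mul_of_one_le_left (α_sq_pos hk).le (one_le_pow₀ h3)

theorem α_sq_le_half {k : ℕ} (hk : 2 ≤ k) : α k ^ 2 ≤ 1 / 2 := (α_sq_le_h hk).trans (h_le_half hk)

section Existence

variable {X : Type*} [MeasurableSpace X] {μ : Measure X} [IsProbabilityMeasure μ] {T : X ≃ᵐ X}

/-- The law of `f̄_k`, the three symbols standing for `-1, 0, 1`. -/
noncomputable def codeLaw (k : ℕ) : Fin 3 → ℝ := ![α k ^ 2 / 2, 1 - α k ^ 2, α k ^ 2 / 2]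

theorem codeLaw_pos {k : ℕ} (hk : 2 ≤ k) (a : Fin 3) : 0 < codeLaw k a := by
  have h1 := α_sq_pos hk
  have h2 := α_sq_le_half hk
  fin_cases a
  · change 0 < α k ^ 2 / 2
    linarith
  · change 0 < 1 - α k ^ 2
    linarith
  · change 0 < α k ^ 2 / 2
    linarith

theorem codeLaw_sum (k : ℕ) : ∑ a, codeLaw k a = 1 := by
  simp [codeLaw, Fin.sum_univ_three]
  ring

/-- Strong recursion on k: the earlier functions, along the window of level k, form one finitely
valued map, which plays the part of π in `exists_function_iIndepFun_window`. -/
theorem exists_isCodingSequence (hT : Ergodic T μ) (hμ : IsAtomless μ) :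
    ∃ fbar : ℕ → X → ℤ, IsCodingSequence T μ fbar := by
  have hmp := hT.toMeasurePreserving
  let S := {g : X → Fin 3 // Measurable g}
  have step : ∀ (k : ℕ) (prev : ∀ l < k, S), ∃ g : S, 2 ≤ k →
      (∀ a, μ (g.1 ⁻¹' {a}) = ENNReal.ofReal (codeLaw k a)) ∧
      iIndepFun (fun (j : Fin (2 * d k + p k + 1)) (x : X) => g.1 (T^[j] x)) μ ∧
      IndepFun (fun (x : X) (j : Fin (2 * d k + p k + 1)) => g.1 (T^[j] x))
        (fun (x : X) (i : Finset.Ico 2 k × Fin (2 * d k + p k + 1)) =>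
          (prev i.1 (Finset.mem_Ico.1 i.1.2).2).1 (T^[i.2] x)) μ := by
    intro k prev
    by_cases hk : 2 ≤ k
    · have hπ : Measurable (fun (x : X) (i : Finset.Ico 2 k × Fin (2 * d k + p k + 1)) =>
          (prev i.1 (Finset.mem_Ico.1 i.1.2).2).1 (T^[i.2] x)) :=
        measurable_pi_lambda _ fun i =>
          (prev i.1 (Finset.mem_Ico.1 i.1.2).2).2.comp (T.measurable.iterate i.2)
      obtain ⟨g, hg, h1, h2, h3⟩ := exists_function_iIndepFun_window hT hμ (codeLaw_pos hk)
        (codeLaw_sum k) hπ (2 * d k + p k)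
      exact ⟨⟨g, hg⟩, fun _ => ⟨h1, h2, h3⟩⟩
    · exact ⟨⟨fun _ => 0, measurable_const⟩, fun h => absurd h hk⟩
  choose G hG using step
  let F : ℕ → S := Nat.lt_wfRel.wf.fix G
  have hF : ∀ k, F k = G k fun l _ => F l := fun k => WellFounded.fix_eq _ _ _
  let e : Fin 3 → ℤ := fun a => (a : ℤ) - 1
  have he : Measurable e := measurable_of_finite e
  have he1 : ∀ a, e a = 1 ↔ a = 2 := by decide
  have he2 : ∀ a, e a = -1 ↔ a = 0 := by decide
  have hF' : ∀ k, 2 ≤ k →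
      (∀ a, μ ((F k).1 ⁻¹' {a}) = ENNReal.ofReal (codeLaw k a)) ∧
      iIndepFun (fun (j : Fin (2 * d k + p k + 1)) (x : X) => (F k).1 (T^[j] x)) μ ∧
      IndepFun (fun (x : X) (j : Fin (2 * d k + p k + 1)) => (F k).1 (T^[j] x))
        (fun (x : X) (i : Finset.Ico 2 k × Fin (2 * d k + p k + 1)) =>
          (F i.1).1 (T^[i.2] x)) μ := by
    intro k hk
    have := hG k (fun l _ => F l) hk
    rw [← hF k] at this
    exact this
  refine ⟨fun k x => e ((F k).1 x), ⟨fun k _ => he.comp (F k).2, fun k _ x => ?_, fun k hk => ?_,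
    fun k hk => ?_, fun k hk j => ?_, fun k hk => ?_, fun k hk => ?_⟩⟩
  · have : ∀ a, e a = -1 ∨ e a = 0 ∨ e a = 1 := by decide
    exact this _
  · simp only [he1]
    exact (hF' k hk).1 2
  · simp only [he2]
    exact (hF' k hk).1 0
  · have hm : Measurable fun x => e ((F k).1 x) := he.comp (F k).2
    exact ⟨(hm.comp (T.measurable.iterate j)).aemeasurable, hm.aemeasurable, by
      rw [← (hmp.iterate j).map_eq, Measure.map_map hm (T.measurable.iterate j),
        (hmp.iterate j).map_eq]
      rfl⟩
  · exact (hF' k hk).2.1.comp (fun _ => e) fun _ => he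
  · exact (hF' k hk).2.2.comp (φ := fun v j => e (v j)) (ψ := fun v i => e (v i))
      (measurable_pi_lambda _ fun j => he.comp (measurable_pi_apply j))
      (measurable_pi_lambda _ fun j => he.comp (measurable_pi_apply j))

end Existence

end LatticeLCLT

/-! ### Coefficients of the Birkhoff sums of one block. -/

namespace LatticeLCLT

/-- The number of pairs `(i, l)`, `i < n`, `l < m`, with `i + l + d = j`. -/
def cnt (n m d j : ℕ) : ℤ :=
  ∑ i ∈ Finset.range n, ∑ l ∈ Finset.range m, if i + l + d = j then 1 else 0

theorem cnt_nonneg (n m d j : ℕ) : 0 ≤ cnt n m d j :=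
  Finset.sum_nonneg fun i _ => Finset.sum_nonneg fun l _ => by split_ifs <;> norm_num

theorem cnt_le_left (n m d j : ℕ) : cnt n m d j ≤ n := by
  unfold cnt
  refine (Finset.sum_le_card_nsmul _ _ 1 fun i _ => ?_).trans (by simp)
  rw [Finset.sum_ite, Finset.sum_const_zero, add_zero, Finset.sum_const, nsmul_eq_mul, mul_one]
  have : ((Finset.range m).filter fun l => i + l + d = j).card ≤ 1 :=
    Finset.card_le_one.2 fun a ha b hb => by
      simp only [Finset.mem_filter] at ha hb; omega
  exact_mod_cast this

theorem cnt_le_right (n m d j : ℕ) : cnt n m d j ≤ m := by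
  have : cnt n m d j = cnt m n d j := by
    unfold cnt
    rw [Finset.sum_comm]
    simp_rw [add_comm]
  rw [this]
  exact cnt_le_left _ _ _ _

theorem sum_cnt_le (n m d : ℕ) (s : Finset ℕ) : ∑ j ∈ s, cnt n m d j ≤ n * m := by
  unfold cnt
  rw [Finset.sum_comm]
  refine (Finset.sum_le_card_nsmul _ _ (m : ℤ) fun i _ => ?_).trans (by simp)
  rw [Finset.sum_comm]
  refine (Finset.sum_le_card_nsmul _ _ (1 : ℤ) fun l _ => ?_).trans (by simp)
  rw [Finset.sum_ite_eq]
  split_ifs <;> norm_num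

theorem sum_sum_eq_sum_cnt (g : ℕ → ℤ) {n m d R : ℕ} (hR : n + m + d ≤ R) :
    ∑ i ∈ Finset.range n, ∑ l ∈ Finset.range m, g (i + l + d) =
      ∑ j ∈ Finset.range R, cnt n m d j * g j := by
  unfold cnt
  simp_rw [Finset.sum_mul]
  symm
  rw [Finset.sum_comm]
  refine Finset.sum_congr rfl fun i hi => ?_
  rw [Finset.sum_comm]
  refine Finset.sum_congr rfl fun l hl => ?_
  simp only [ite_mul, one_mul, zero_mul]
  rw [Finset.sum_ite_eq, if_pos]
  simp only [Finset.mem_range] at *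
  omega

theorem cnt_eq_of_mem {n m d j : ℕ} (h1 : m ≤ j + 1) (h2 : j < n) : cnt n m d (d + j) = m := by
  unfold cnt
  rw [Finset.sum_comm]
  have : ∀ l ∈ Finset.range m,
      (∑ i ∈ Finset.range n, if i + l + d = d + j then (1 : ℤ) else 0) = 1 := by
    intro l hl
    rw [Finset.mem_range] at hl
    rw [Finset.sum_eq_single (j - l)]
    · rw [if_pos (by omega)]
    · intro i _ hi
      rw [if_neg (by omega)]
    · intro h
      rw [Finset.mem_range] at h
      omega
  rw [Finset.sum_congr rfl this]
  simp

theorem cnt_eq_zero {n m d j : ℕ} (h : j < d ∨ n + m + d ≤ j) : cnt n m d j = 0 := by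
  unfold cnt
  refine Finset.sum_eq_zero fun i hi => Finset.sum_eq_zero fun l hl => if_neg ?_
  simp only [Finset.mem_range] at *
  omega

/-- The coefficient of `f̄_k ∘ T^j` in the `n`-th Birkhoff sum of `f_k`. -/
def coef (n k j : ℕ) : ℤ := cnt n (p k) 0 j - cnt n (p k) (d k) j

theorem abs_coef_le_left (n k j : ℕ) : |coef n k j| ≤ n := by
  have h1 := cnt_nonneg n (p k) 0 j
  have h2 := cnt_nonneg n (p k) (d k) j
  have h3 := cnt_le_left n (p k) 0 j
  have h4 := cnt_le_left n (p k) (d k) j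
  unfold coef
  rw [abs_le]
  constructor <;> linarith

theorem abs_coef_le_right (n k j : ℕ) : |coef n k j| ≤ p k := by
  have h1 := cnt_nonneg n (p k) 0 j
  have h2 := cnt_nonneg n (p k) (d k) j
  have h3 := cnt_le_right n (p k) 0 j
  have h4 := cnt_le_right n (p k) (d k) j
  unfold coef
  rw [abs_le]
  constructor <;> linarith

theorem sum_abs_coef_le (n k : ℕ) (s : Finset ℕ) : ∑ j ∈ s, |coef n k j| ≤ 2 * (n * p k) := by
  have h : ∀ j, |coef n k j| ≤ cnt n (p k) 0 j + cnt n (p k) (d k) j := by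
    intro j
    have h1 := cnt_nonneg n (p k) 0 j
    have h2 := cnt_nonneg n (p k) (d k) j
    unfold coef
    rw [abs_le]
    constructor <;> linarith
  refine (Finset.sum_le_sum fun j _ => h j).trans ?_
  rw [Finset.sum_add_distrib]
  have h1 := sum_cnt_le n (p k) 0 s
  have h2 := sum_cnt_le n (p k) (d k) s
  linarith

/-- The ℓ¹ bound times a uniform bound. The coefficients are bounded both by n and by p k; using n
is better when p k > n, and the companion bound with p k serves the other levels. -/
theorem sum_coef_sq_le_left (n k : ℕ) (s : Finset ℕ) :
    ∑ j ∈ s, coef n k j ^ 2 ≤ 2 * (n ^ 2 * p k) := by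
  calc ∑ j ∈ s, coef n k j ^ 2 ≤ ∑ j ∈ s, |coef n k j| * n := by
        refine Finset.sum_le_sum fun j _ => ?_
        rw [← sq_abs, sq]
        exact mul_le_mul_of_nonneg_left (abs_coef_le_left n k j) (abs_nonneg _)
    _ ≤ 2 * (n * p k) * n := by
        rw [← Finset.sum_mul]
        exact mul_le_mul_of_nonneg_right (sum_abs_coef_le n k s) (by positivity)
    _ = 2 * (n ^ 2 * p k) := by ring

theorem sum_coef_sq_le_right (n k : ℕ) (s : Finset ℕ) :
    ∑ j ∈ s, coef n k j ^ 2 ≤ 2 * (n * p k ^ 2) := by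
  calc ∑ j ∈ s, coef n k j ^ 2 ≤ ∑ j ∈ s, |coef n k j| * p k := by
        refine Finset.sum_le_sum fun j _ => ?_
        rw [← sq_abs, sq]
        exact mul_le_mul_of_nonneg_left (abs_coef_le_right n k j) (abs_nonneg _)
    _ ≤ 2 * (n * p k) * p k := by
        rw [← Finset.sum_mul]
        exact mul_le_mul_of_nonneg_right (sum_abs_coef_le n k s) (by positivity)
    _ = 2 * (n * p k ^ 2) := by ring

theorem sum_cnt_sq_le (n m d : ℕ) (s : Finset ℕ) :
    ∑ j ∈ s, cnt n m d j ^ 2 ≤ n * m ^ 2 := by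
  calc ∑ j ∈ s, cnt n m d j ^ 2 ≤ ∑ j ∈ s, cnt n m d j * m := by
        refine Finset.sum_le_sum fun j _ => ?_
        rw [sq]
        exact mul_le_mul_of_nonneg_left (cnt_le_right n m d j) (cnt_nonneg n m d j)
    _ ≤ (n * m) * m := by
        rw [← Finset.sum_mul]
        exact mul_le_mul_of_nonneg_right (sum_cnt_le n m d s) (by positivity)
    _ = n * m ^ 2 := by ring

/-- The coefficients are the difference of two trapezoids, the second one shifted by d k. The
condition n ≤ d k keeps each trapezoid away from the plateau of the other. -/
theorem coef_eq_p {n k j P : ℕ} (hd : n ≤ d k) (hP : p k ≤ P) (h1 : P ≤ j) (h2 : j < n) :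
    coef n k j = p k := by
  have := cnt_eq_of_mem (n := n) (m := p k) (d := 0) (j := j) (by omega) h2
  rw [zero_add] at this
  unfold coef
  rw [this, cnt_eq_zero (Or.inl (by omega)), sub_zero]

theorem coef_eq_neg_p {n k j P : ℕ} (hd : n ≤ d k) (hP : p k ≤ P) (h1 : P ≤ j) (h2 : j < n) :
    coef n k (d k + j) = -p k := by
  unfold coef
  rw [cnt_eq_of_mem (by omega) h2, cnt_eq_zero (Or.inr (by omega)), zero_sub]

section Birkhoff

variable {X : Type*} (T : X → X) (fbar : ℕ → X → ℤ)

theorem birkhoffSum_block_eq (n k : ℕ) {R : ℕ} (hR : n + p k + d k ≤ R) (x : X) :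
    birkhoffSum T (block T fbar k) n x =
      ∑ j ∈ Finset.range R, coef n k j * fbar k (T^[j] x) := by
  have h1 := sum_sum_eq_sum_cnt (fun j => fbar k (T^[j] x)) (n := n) (m := p k) (d := 0) (R := R)
    (by omega)
  have h2 := sum_sum_eq_sum_cnt (fun j => fbar k (T^[j] x)) hR
  simp only [coef, sub_mul, Finset.sum_sub_distrib]
  rw [← h1, ← h2, ← Finset.sum_sub_distrib]
  unfold birkhoffSum block birkhoffSum
  refine Finset.sum_congr rfl fun i _ => ?_
  congr 1
  · refine Finset.sum_congr rfl fun l _ => ?_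
    rw [← Function.iterate_add_apply, add_zero, add_comm]
  · refine Finset.sum_congr rfl fun l _ => ?_
    rw [← Function.iterate_add_apply, ← Function.iterate_add_apply]
    congr 2
    omega

theorem transfer_eq (k : ℕ) {R : ℕ} (hR : d k + p k ≤ R) (x : X) :
    transfer T fbar k x = ∑ j ∈ Finset.range R, cnt (d k) (p k) 0 j * fbar k (T^[j] x) := by
  rw [← sum_sum_eq_sum_cnt (fun j => fbar k (T^[j] x)) (by omega)]
  unfold transfer
  refine Finset.sum_congr rfl fun i _ => Finset.sum_congr rfl fun l _ => ?_
  rw [add_zero, add_comm]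

theorem block_eq_transfer_sub (k : ℕ) (x : X) :
    block T fbar k x = transfer T fbar k x - transfer T fbar k (T x) := by
  unfold transfer block birkhoffSum
  have : ∀ j, (∑ i ∈ Finset.range (p k), fbar k (T^[i + j] (T x))) =
      ∑ i ∈ Finset.range (p k), fbar k (T^[i + (j + 1)] x) := fun j => rfl
  simp only [this]
  rw [← Finset.sum_sub_distrib, ← Finset.sum_sub_distrib,
    Finset.sum_range_sub' fun j => ∑ i ∈ Finset.range (p k), fbar k (T^[i + j] x),
    ← Finset.sum_sub_distrib]
  simp only [Function.iterate_add_apply, Function.iterate_zero, id]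

theorem birkhoffSum_block_eq_transfer_sub (k n : ℕ) (x : X) :
    birkhoffSum T (block T fbar k) n x = transfer T fbar k x - transfer T fbar k (T^[n] x) := by
  unfold birkhoffSum
  simp only [block_eq_transfer_sub, ← Function.iterate_succ_apply' T]
  exact Finset.sum_range_sub' (fun i => transfer T fbar k (T^[i] x)) n

end Birkhoff

theorem p_le_two_pow {k : ℕ} (hk : 1 ≤ k) : p k ≤ 2 ^ k := by
  unfold p
  split_ifs
  · exact le_rfl
  · obtain ⟨m, rfl⟩ := Nat.exists_eq_add_of_le hk
    rw [Nat.add_sub_cancel_left, pow_add]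
    have := Nat.one_le_two_pow (n := m)
    omega

theorem two_pow_le_two_mul_p (k : ℕ) : 2 ^ k ≤ 2 * p k := by
  unfold p
  split_ifs
  · have := Nat.one_le_two_pow (n := k)
    omega
  · cases k with
    | zero => simp
    | succ m => rw [Nat.add_sub_cancel, pow_succ]; omega

/-- For n ≤ d k this places all positions occurring in the n-th Birkhoff sum of a lower block inside
the window on which level k is independent of the past. -/
theorem d_add_p_le {l k : ℕ} (hl : 1 ≤ l) (hlk : l < k) : d l + p l ≤ d k := by
  have h1 := p_le_two_pow hl
  unfold d
  have h2 : (l + 1) ^ 2 ≤ k ^ 2 := Nat.pow_le_pow_left hlk 2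
  have h3 : 2 ^ ((l + 1) ^ 2) ≤ 2 ^ (k ^ 2) := Nat.pow_le_pow_right (by norm_num) h2
  have h4 : 2 ^ (l ^ 2) ≤ 2 ^ (l ^ 2 + 2 * l) := Nat.pow_le_pow_right (by norm_num) (by omega)
  have h5 : 2 ^ l ≤ 2 ^ (l ^ 2 + 2 * l) := Nat.pow_le_pow_right (by norm_num) (by
    have := Nat.zero_le (l ^ 2); omega)
  have h6 : 2 ^ ((l + 1) ^ 2) = 2 ^ (l ^ 2 + 2 * l) * 2 := by
    rw [← pow_succ]; congr 1; ring
  omega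

end LatticeLCLT

/-! ### Characteristic functions and moments of one level. -/

namespace LatticeLCLT

/-- The characteristic function of an integer valued random variable. -/
noncomputable def cf {X : Type*} [MeasurableSpace X] (μ : Measure X) (V : X → ℤ) (θ : ℝ) : ℂ :=
  ∫ x, Complex.exp (((θ * V x : ℝ) : ℂ) * Complex.I) ∂μ

theorem norm_cf_le_one {X : Type*} [MeasurableSpace X] (μ : Measure X) [IsProbabilityMeasure μ]
    (V : X → ℤ) (θ : ℝ) : ‖cf μ V θ‖ ≤ 1 := by
  refine (norm_integral_le_of_norm_le_const (C := 1) (ae_of_all _ fun x => ?_)).trans (by simp)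
  rw [Complex.norm_exp_ofReal_mul_I]

theorem cf_add_of_indepFun {X : Type*} [MeasurableSpace X] {μ : Measure X}
    {V W : X → ℤ} (hV : Measurable V) (hW : Measurable W) (h : IndepFun V W μ) (θ : ℝ) :
    cf μ (fun x => V x + W x) θ = cf μ V θ * cf μ W θ := by
  unfold cf
  have := h.integral_fun_comp_mul_comp hV.aemeasurable hW.aemeasurable
    (f := fun a : ℤ => Complex.exp (((θ * a : ℝ) : ℂ) * Complex.I))
    (g := fun a : ℤ => Complex.exp (((θ * a : ℝ) : ℂ) * Complex.I))
    (measurable_of_countable _).aestronglyMeasurable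
    (measurable_of_countable _).aestronglyMeasurable
  rw [← this]
  congr 1
  ext x
  rw [← Complex.exp_add]
  congr 1
  push_cast
  ring

theorem integral_comp_eq {X E : Type*} [MeasurableSpace X] {μ : Measure X} [NormedAddCommGroup E]
    [NormedSpace ℝ E] {S : X → X} (hS : MeasurePreserving S μ μ) {g : X → E}
    (hg : AEStronglyMeasurable g μ) : ∫ x, g (S x) ∂μ = ∫ x, g x ∂μ := by
  have := integral_map (f := g) hS.measurable.aemeasurable (by rwa [hS.map_eq])
  rw [← this, hS.map_eq]

section Level

variable {X : Type*} [MeasurableSpace X] {μ : Measure X} [IsProbabilityMeasure μ] {T : X → X}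
  {fbar : ℕ → X → ℤ}

theorem IsCodingSequence.integral_comp {E : Type*} [NormedAddCommGroup E] [NormedSpace ℝ E]
    [CompleteSpace E] (hc : IsCodingSequence T μ fbar) {k : ℕ} (hk : 2 ≤ k) (φ : ℤ → E) :
    ∫ x, φ (fbar k x) ∂μ =
      (α k ^ 2 / 2) • φ 1 + (α k ^ 2 / 2) • φ (-1) + (1 - α k ^ 2) • φ 0 := by
  have hm := hc.measurable k hk
  have h1 : MeasurableSet {x | fbar k x = 1} := hm (measurableSet_singleton 1)
  have h2 : MeasurableSet {x | fbar k x = -1} := hm (measurableSet_singleton (-1))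
  have e : ∀ x, φ (fbar k x) = Set.indicator {x | fbar k x = 1} (fun _ => φ 1 - φ 0) x +
      Set.indicator {x | fbar k x = -1} (fun _ => φ (-1) - φ 0) x + φ 0 := by
    intro x
    rcases hc.mem k hk x with h | h | h <;> simp [Set.indicator, h]
  have hr : (0 : ℝ) ≤ α k ^ 2 / 2 := by positivity
  simp only [e]
  have r1 : μ.real {x | fbar k x = 1} = α k ^ 2 / 2 := by
    rw [Measure.real, hc.measure_one k hk, ENNReal.toReal_ofReal hr]
  have r2 : μ.real {x | fbar k x = -1} = α k ^ 2 / 2 := by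
    rw [Measure.real, hc.measure_neg_one k hk, ENNReal.toReal_ofReal hr]
  rw [integral_add _ (integrable_const _), integral_add, integral_indicator h1,
    integral_indicator h2]
  · simp only [integral_const, measureReal_restrict_apply_univ, probReal_univ, one_smul,
      r1, r2]
    module
  · exact (integrable_const _).indicator h1
  · exact (integrable_const _).indicator h2
  · exact ((integrable_const _).indicator h1).add ((integrable_const _).indicator h2)

theorem IsCodingSequence.cf_fbar (hc : IsCodingSequence T μ fbar) {k : ℕ} (hk : 2 ≤ k) (θ : ℝ) :
    cf μ (fbar k) θ = ((1 - α k ^ 2 * (1 - Real.cos θ) : ℝ) : ℂ) := by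
  unfold cf
  rw [hc.integral_comp hk fun a : ℤ => Complex.exp (((θ * a : ℝ) : ℂ) * Complex.I)]
  simp only [Int.cast_one, Int.cast_neg, Int.cast_zero, mul_one, mul_neg, mul_zero,
    Complex.ofReal_zero, zero_mul, Complex.exp_zero, Complex.real_smul, Complex.ofReal_neg]
  have := Complex.two_cos (θ : ℂ)
  rw [neg_mul] at this ⊢
  push_cast
  linear_combination (-(α k : ℂ) ^ 2 / 2) * this

/-- A linear combination of `f̄_k ∘ T^j`, `j < 2 d_k + p_k + 1`. -/
def lin (T : X → X) (fbar : ℕ → X → ℤ) (k : ℕ) (c : ℕ → ℤ) (x : X) : ℤ :=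
  ∑ j ∈ Finset.range (2 * d k + p k + 1), c j * fbar k (T^[j] x)

omit [IsProbabilityMeasure μ] in
theorem IsCodingSequence.measurable_lin (hc : IsCodingSequence T μ fbar) (hT : Measurable T) {k : ℕ}
    (hk : 2 ≤ k) (c : ℕ → ℤ) : Measurable (lin T fbar k c) :=
  Finset.measurable_fun_sum _ fun j _ =>
    ((hc.measurable k hk).comp (hT.iterate j)).const_mul (c j)

theorem IsCodingSequence.cf_lin (hc : IsCodingSequence T μ fbar) (hT : MeasurePreserving T μ μ)
    {k : ℕ} (hk : 2 ≤ k) (c : ℕ → ℤ) (θ : ℝ) :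
    cf μ (lin T fbar k c) θ = ((∏ j ∈ Finset.range (2 * d k + p k + 1),
      (1 - α k ^ 2 * (1 - Real.cos (θ * c j))) : ℝ) : ℂ) := by
  have hm : ∀ j : ℕ, Measurable fun x => fbar k (T^[j] x) := fun j =>
    (hc.measurable k hk).comp (hT.measurable.iterate j)
  have hone : ∀ j : ℕ, ∫ x, Complex.exp (((θ * c j * fbar k (T^[j] x) : ℝ) : ℂ) * Complex.I) ∂μ =
      ((1 - α k ^ 2 * (1 - Real.cos (θ * c j)) : ℝ) : ℂ) := by
    intro j
    rw [← hc.cf_fbar hk]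
    exact integral_comp_eq (hT.iterate j) ((measurable_of_countable fun a : ℤ =>
      Complex.exp (((θ * c j * a : ℝ) : ℂ) * Complex.I)).comp
        (hc.measurable k hk)).aestronglyMeasurable
  have := (hc.indep k hk).integral_fun_prod_comp (fun j => (hm j).aemeasurable)
    (f := fun (j : Fin (2 * d k + p k + 1)) (a : ℤ) =>
      Complex.exp (((θ * c j * a : ℝ) : ℂ) * Complex.I))
    (fun j => (measurable_of_countable _).aestronglyMeasurable)
  simp only [hone] at this
  rw [Finset.prod_range]
  rw [Complex.ofReal_prod, ← this]
  unfold cf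
  congr 1
  ext x
  rw [← Complex.exp_sum]
  congr 1
  rw [lin, Finset.sum_range, ← Finset.sum_mul]
  congr 1
  push_cast
  rw [Finset.mul_sum]
  exact Finset.sum_congr rfl fun j _ => by ring

omit [IsProbabilityMeasure μ] in
theorem IsCodingSequence.abs_fbar_le (hc : IsCodingSequence T μ fbar) {k : ℕ} (hk : 2 ≤ k) (x : X) :
    |(fbar k x : ℝ)| ≤ 1 := by
  rcases hc.mem k hk x with h | h | h <;> simp [h]

omit [IsProbabilityMeasure μ] in
theorem IsCodingSequence.abs_lin_le (hc : IsCodingSequence T μ fbar) {k : ℕ} (hk : 2 ≤ k)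
    (c : ℕ → ℤ) (x : X) :
    |(lin T fbar k c x : ℝ)| ≤ ∑ j ∈ Finset.range (2 * d k + p k + 1), |(c j : ℝ)| := by
  unfold lin
  push_cast
  refine (Finset.abs_sum_le_sum_abs _ _).trans (Finset.sum_le_sum fun j _ => ?_)
  rw [abs_mul]
  exact mul_le_of_le_one_right (abs_nonneg _) (hc.abs_fbar_le hk _)

theorem IsCodingSequence.memLp_lin (hc : IsCodingSequence T μ fbar) (hT : Measurable T) {k : ℕ}
    (hk : 2 ≤ k) (c : ℕ → ℤ) (q : ENNReal) : MemLp (fun x => (lin T fbar k c x : ℝ)) q μ :=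
  MemLp.of_bound ((measurable_of_countable fun a : ℤ => (a : ℝ)).comp
    (hc.measurable_lin hT hk c)).aestronglyMeasurable _ (ae_of_all _ (hc.abs_lin_le hk c))

theorem IsCodingSequence.integral_fbar (hc : IsCodingSequence T μ fbar)
    (hT : MeasurePreserving T μ μ) {k : ℕ} (hk : 2 ≤ k) (j : ℕ) (φ : ℤ → ℝ) :
    ∫ x, φ (fbar k (T^[j] x)) ∂μ =
      (α k ^ 2 / 2) * φ 1 + (α k ^ 2 / 2) * φ (-1) + (1 - α k ^ 2) * φ 0 := by
  have := hc.integral_comp hk φ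
  simp only [smul_eq_mul] at this
  rw [← this]
  exact integral_comp_eq (hT.iterate j)
    ((measurable_of_countable φ).comp (hc.measurable k hk)).aestronglyMeasurable

theorem IsCodingSequence.memLp_fbar (hc : IsCodingSequence T μ fbar) (hT : Measurable T) {k : ℕ}
    (hk : 2 ≤ k) (j : ℕ) (q : ENNReal) : MemLp (fun x => (fbar k (T^[j] x) : ℝ)) q μ :=
  MemLp.of_bound ((measurable_of_countable fun a : ℤ => (a : ℝ)).comp
    ((hc.measurable k hk).comp (hT.iterate j))).aestronglyMeasurable _
      (ae_of_all _ fun _ => hc.abs_fbar_le hk _)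

theorem IsCodingSequence.integral_lin (hc : IsCodingSequence T μ fbar)
    (hT : MeasurePreserving T μ μ) {k : ℕ} (hk : 2 ≤ k) (c : ℕ → ℤ) :
    ∫ x, (lin T fbar k c x : ℝ) ∂μ = 0 := by
  unfold lin
  push_cast
  rw [integral_finsetSum]
  · refine Finset.sum_eq_zero fun j _ => ?_
    rw [integral_const_mul, hc.integral_fbar hT hk j fun a => (a : ℝ)]
    simp
  · exact fun j _ =>
      ((hc.memLp_fbar hT.measurable hk j 1).integrable le_rfl).const_mul _

theorem IsCodingSequence.integral_lin_sq (hc : IsCodingSequence T μ fbar)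
    (hT : MeasurePreserving T μ μ) {k : ℕ} (hk : 2 ≤ k) (c : ℕ → ℤ) :
    ∫ x, (lin T fbar k c x : ℝ) ^ 2 ∂μ =
      α k ^ 2 * ∑ j ∈ Finset.range (2 * d k + p k + 1), (c j : ℝ) ^ 2 := by
  rw [← variance_of_integral_eq_zero
    (hc.memLp_lin hT.measurable hk c 1).aestronglyMeasurable.aemeasurable
    (hc.integral_lin hT hk c)]
  have e : (fun x => (lin T fbar k c x : ℝ)) =
      ∑ j : Fin (2 * d k + p k + 1), fun x => (c j : ℝ) * (fbar k (T^[j] x) : ℝ) := by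
    ext x
    rw [Finset.sum_apply, lin, Finset.sum_range]
    push_cast
    rfl
  rw [e, IndepFun.variance_sum]
  · rw [Finset.sum_range, Finset.mul_sum]
    refine Finset.sum_congr rfl fun j _ => ?_
    rw [variance_const_mul, variance_of_integral_eq_zero
      (hc.memLp_fbar hT.measurable hk j 1).aestronglyMeasurable.aemeasurable,
      hc.integral_fbar hT hk j fun a => (a : ℝ) ^ 2]
    · simp
      ring
    · rw [hc.integral_fbar hT hk j fun a => (a : ℝ)]
      simp
  · exact fun j _ => (hc.memLp_fbar hT.measurable hk j 2).const_mul _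
  · intro i _ j _ hij
    exact ((hc.indep k hk).indepFun hij).comp (φ := fun a : ℤ => (c i : ℝ) * (a : ℝ))
      (ψ := fun a : ℤ => (c j : ℝ) * (a : ℝ)) (measurable_of_countable _)
      (measurable_of_countable _)

end Level

end LatticeLCLT

/-! ### Superposition of the levels. -/

namespace LatticeLCLT

/-- The `n`-th Birkhoff sum of `∑_{2 ≤ k < M} f_k`. -/
def psum {X : Type*} (T : X → X) (fbar : ℕ → X → ℤ) (n M : ℕ) (x : X) : ℤ :=
  ∑ k ∈ Finset.Ico 2 M, birkhoffSum T (block T fbar k) n x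

theorem psum_succ {X : Type*} (T : X → X) (fbar : ℕ → X → ℤ) (n : ℕ) {M : ℕ} (hM : 2 ≤ M) (x : X) :
    psum T fbar n (M + 1) x = psum T fbar n M x + birkhoffSum T (block T fbar M) n x :=
  Finset.sum_Ico_succ_top hM _

theorem birkhoffSum_block_eq_lin {X : Type*} (T : X → X) (fbar : ℕ → X → ℤ) {n k : ℕ}
    (hn : n ≤ d k) (x : X) :
    birkhoffSum T (block T fbar k) n x = lin T fbar k (coef n k) x :=
  birkhoffSum_block_eq T fbar n k (by omega) x

theorem d_mono {k l : ℕ} (h : k ≤ l) : d k ≤ d l :=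
  Nat.pow_le_pow_right (by norm_num) (Nat.pow_le_pow_left h 2)

section Levels

variable {X : Type*} [MeasurableSpace X] {μ : Measure X} [IsProbabilityMeasure μ] {T : X → X}
  {fbar : ℕ → X → ℤ}

omit [IsProbabilityMeasure μ] in
theorem IsCodingSequence.measurable_block (hc : IsCodingSequence T μ fbar) (hT : Measurable T)
    {k : ℕ} (hk : 2 ≤ k) : Measurable (block T fbar k) := by
  have h1 : Measurable (birkhoffSum T (fbar k) (p k)) :=
    Finset.measurable_fun_sum _ fun j _ => (hc.measurable k hk).comp (hT.iterate j)
  exact h1.sub (h1.comp (hT.iterate _))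

theorem measurable_birkhoffSum (hT : Measurable T) {g : X → ℤ} (hg : Measurable g) (n : ℕ) :
    Measurable (birkhoffSum T g n) :=
  Finset.measurable_fun_sum _ fun j _ => hg.comp (hT.iterate j)

omit [IsProbabilityMeasure μ] in
theorem IsCodingSequence.measurable_psum (hc : IsCodingSequence T μ fbar) (hT : Measurable T)
    (n M : ℕ) : Measurable (psum T fbar n M) :=
  Finset.measurable_fun_sum _ fun _ hk =>
    measurable_birkhoffSum hT (hc.measurable_block hT (Finset.mem_Ico.1 hk).1) n

-- By `d_add_p_le` the partial sum over the lower levels is a function of the past family within the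
-- window of level M.
omit [IsProbabilityMeasure μ] in
theorem IsCodingSequence.indepFun_psum (hc : IsCodingSequence T μ fbar) {n M : ℕ} (hM : 2 ≤ M)
    (hn : n ≤ d M) (c : ℕ → ℤ) : IndepFun (psum T fbar n M) (lin T fbar M c) μ := by
  have := (hc.indepFun_past M hM).symm.comp
    (φ := fun u : Finset.Ico 2 M × Fin (2 * d M + p M + 1) → ℤ =>
      ∑ l : Finset.Ico 2 M, ∑ j : Fin (2 * d M + p M + 1), coef n l j * u (l, j))
    (ψ := fun v : Fin (2 * d M + p M + 1) → ℤ => ∑ j : Fin (2 * d M + p M + 1), c j * v j)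
    (measurable_of_countable _) (measurable_of_countable _)
  convert this using 1
  · ext x
    simp only [psum, Function.comp]
    rw [← Finset.sum_coe_sort]
    refine Finset.sum_congr rfl fun l _ => ?_
    have hl := Finset.mem_Ico.1 l.2
    have := d_add_p_le (by omega) hl.2
    rw [birkhoffSum_block_eq T fbar n l (R := 2 * d M + p M + 1) (by omega), Finset.sum_range]
  · ext x
    simp only [lin, Function.comp]
    rw [Finset.sum_range]

theorem IsCodingSequence.memLp_block (hc : IsCodingSequence T μ fbar) (hT : Measurable T)
    {k : ℕ} (hk : 2 ≤ k) (q : ENNReal) : MemLp (fun x => (block T fbar k x : ℝ)) q μ := by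
  have : ∀ x, block T fbar k x = lin T fbar k (coef 1 k) x := fun x => by
    rw [← birkhoffSum_block_eq_lin T fbar (Nat.one_le_two_pow), birkhoffSum_one]
  simp only [this]
  exact hc.memLp_lin hT hk _ q

omit [IsProbabilityMeasure μ] in
theorem memLp_birkhoffSum (hT : MeasurePreserving T μ μ) {g : X → ℤ} {q : ENNReal}
    (hg : MemLp (fun x => (g x : ℝ)) q μ) (n : ℕ) :
    MemLp (fun x => ((birkhoffSum T g n x : ℤ) : ℝ)) q μ := by
  unfold birkhoffSum
  push_cast
  exact memLp_finsetSum _ fun j _ => hg.comp_measurePreserving (hT.iterate j)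

theorem IsCodingSequence.memLp_psum (hc : IsCodingSequence T μ fbar) (hT : MeasurePreserving T μ μ)
    (n M : ℕ) (q : ENNReal) : MemLp (fun x => (psum T fbar n M x : ℝ)) q μ := by
  unfold psum
  push_cast
  exact memLp_finsetSum _ fun k hk =>
    memLp_birkhoffSum hT (hc.memLp_block hT.measurable (Finset.mem_Ico.1 hk).1 q) n

/-- Levels are added one at a time: above K the condition n ≤ d k makes each Birkhoff sum a
combination of i.i.d. variables independent of what lies below. The levels under K stay together in
a factor that is not evaluated. -/
theorem IsCodingSequence.cf_psum (hc : IsCodingSequence T μ fbar) (hT : MeasurePreserving T μ μ)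
    {n K : ℕ} (hK : 2 ≤ K) (hn : n ≤ d K) (M : ℕ) (hM : K ≤ M) (θ : ℝ) :
    cf μ (psum T fbar n M) θ = cf μ (psum T fbar n K) θ *
      ((∏ k ∈ Finset.Ico K M, ∏ j ∈ Finset.range (2 * d k + p k + 1),
        (1 - α k ^ 2 * (1 - Real.cos (θ * coef n k j))) : ℝ) : ℂ) := by
  induction M, hM using Nat.le_induction with
  | base => simp
  | succ M hM ih =>
    have hnM : n ≤ d M := hn.trans (d_mono hM)
    have e : psum T fbar n (M + 1) = fun x => psum T fbar n M x + lin T fbar M (coef n M) x := by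
      ext x
      rw [psum_succ T fbar n (by omega), birkhoffSum_block_eq_lin T fbar hnM]
    rw [e, cf_add_of_indepFun (hc.measurable_psum hT.measurable n M)
      (hc.measurable_lin hT.measurable (by omega) _) (hc.indepFun_psum (by omega) hnM _), ih,
      hc.cf_lin hT (by omega), Finset.prod_Ico_succ_top hM, Complex.ofReal_mul, mul_assoc]

theorem IsCodingSequence.integral_psum_sq (hc : IsCodingSequence T μ fbar)
    (hT : MeasurePreserving T μ μ) {n K : ℕ} (hK : 2 ≤ K) (hn : n ≤ d K) (M : ℕ) (hM : K ≤ M) :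
    ∫ x, (psum T fbar n M x : ℝ) ^ 2 ∂μ = ∫ x, (psum T fbar n K x : ℝ) ^ 2 ∂μ +
      ∑ k ∈ Finset.Ico K M,
        α k ^ 2 * ∑ j ∈ Finset.range (2 * d k + p k + 1), (coef n k j : ℝ) ^ 2 := by
  induction M, hM using Nat.le_induction with
  | base => simp
  | succ M hM ih =>
    have hnM : n ≤ d M := hn.trans (d_mono hM)
    have e : ∀ x, (psum T fbar n (M + 1) x : ℝ) ^ 2 = (psum T fbar n M x : ℝ) ^ 2 +
        2 * ((psum T fbar n M x : ℝ) * (lin T fbar M (coef n M) x : ℝ)) +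
        (lin T fbar M (coef n M) x : ℝ) ^ 2 := by
      intro x
      rw [psum_succ T fbar n (by omega), birkhoffSum_block_eq_lin T fbar hnM]
      push_cast
      ring
    have h1 := hc.memLp_psum hT n M 2
    have h2 := hc.memLp_lin hT.measurable (k := M) (by omega) (coef n M) 2
    have h3 := (hc.indepFun_psum (by omega) hnM (coef n M)).integral_fun_comp_mul_comp
      (hc.measurable_psum hT.measurable n M).aemeasurable
      (hc.measurable_lin hT.measurable (by omega) _).aemeasurable
      (f := fun a : ℤ => (a : ℝ)) (g := fun a : ℤ => (a : ℝ))
      (measurable_of_countable _).aestronglyMeasurable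
      (measurable_of_countable _).aestronglyMeasurable
    simp only [e]
    have h4 : Integrable (fun x => (psum T fbar n M x : ℝ) * (lin T fbar M (coef n M) x : ℝ)) μ :=
      h1.integrable_mul h2
    have h5 : Integrable (fun x => (psum T fbar n M x : ℝ) ^ 2 +
        2 * ((psum T fbar n M x : ℝ) * (lin T fbar M (coef n M) x : ℝ))) μ :=
      h1.integrable_sq.add (h4.const_mul 2)
    rw [integral_add h5 h2.integrable_sq,
      integral_add h1.integrable_sq (h4.const_mul 2), integral_const_mul, h3,
      hc.integral_lin hT (by omega), hc.integral_lin_sq hT (by omega), ih,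
      Finset.sum_Ico_succ_top hM]
    ring

/-- Meant for low levels, where n may exceed d k and the window is too short. The Birkhoff sum is a
difference of two copies of the transfer function, whose second moment is at most d k · h k,
independently of n. -/
theorem IsCodingSequence.integral_birkhoffSum_block_sq_le (hc : IsCodingSequence T μ fbar)
    (hT : MeasurePreserving T μ μ) {k : ℕ} (hk : 2 ≤ k) (n : ℕ) :
    ∫ x, ((birkhoffSum T (block T fbar k) n x : ℤ) : ℝ) ^ 2 ∂μ ≤ 4 * (d k * h k) := by
  have hg : ∀ x, transfer T fbar k x = lin T fbar k (cnt (d k) (p k) 0) x := fun x =>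
    transfer_eq T fbar k (by omega) x
  have h1 := hc.memLp_lin hT.measurable hk (cnt (d k) (p k) 0) 2
  have h2 : MemLp (fun x => (lin T fbar k (cnt (d k) (p k) 0) (T^[n] x) : ℝ)) 2 μ :=
    h1.comp_measurePreserving (hT.iterate n)
  have h3 : ∫ x, (lin T fbar k (cnt (d k) (p k) 0) (T^[n] x) : ℝ) ^ 2 ∂μ =
      ∫ x, (lin T fbar k (cnt (d k) (p k) 0) x : ℝ) ^ 2 ∂μ :=
    integral_comp_eq (hT.iterate n)
      (g := fun x => (lin T fbar k (cnt (d k) (p k) 0) x : ℝ) ^ 2) h1.integrable_sq.1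
  have h4 : ∫ x, (lin T fbar k (cnt (d k) (p k) 0) x : ℝ) ^ 2 ∂μ ≤ d k * h k := by
    rw [hc.integral_lin_sq hT hk, ← p_sq_mul_α_sq hk]
    have := sum_cnt_sq_le (d k) (p k) 0 (Finset.range (2 * d k + p k + 1))
    have : ∑ j ∈ Finset.range (2 * d k + p k + 1), (cnt (d k) (p k) 0 j : ℝ) ^ 2 ≤
        d k * p k ^ 2 := by exact_mod_cast this
    calc _ ≤ α k ^ 2 * ((d k : ℝ) * p k ^ 2) := by gcongr
      _ = _ := by ring
  calc ∫ x, ((birkhoffSum T (block T fbar k) n x : ℤ) : ℝ) ^ 2 ∂μ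
      ≤ ∫ x, (2 * (lin T fbar k (cnt (d k) (p k) 0) x : ℝ) ^ 2 +
        2 * (lin T fbar k (cnt (d k) (p k) 0) (T^[n] x) : ℝ) ^ 2) ∂μ := by
        refine integral_mono_of_nonneg (ae_of_all _ fun x => sq_nonneg _)
          ((h1.integrable_sq.const_mul 2).add (h2.integrable_sq.const_mul 2))
          (ae_of_all _ fun x => ?_)
        simp only [birkhoffSum_block_eq_transfer_sub, hg]
        push_cast
        nlinarith [sq_nonneg ((lin T fbar k (cnt (d k) (p k) 0) x : ℝ) +
          (lin T fbar k (cnt (d k) (p k) 0) (T^[n] x) : ℝ))]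
    _ ≤ 4 * (d k * h k) := by
        rw [integral_add (h1.integrable_sq.const_mul 2) (h2.integrable_sq.const_mul 2),
          integral_const_mul, integral_const_mul, h3]
        linarith

/-- Level s is split off at the cost of a factor 2 only: d s may be comparable with n, and nothing
but h s → 0 makes its term small. Below s the factor s lost in Cauchy–Schwarz is harmless against
the growth of d. -/
theorem IsCodingSequence.integral_psum_sq_le (hc : IsCodingSequence T μ fbar)
    (hT : MeasurePreserving T μ μ) (n : ℕ) {s : ℕ} (hs : 2 ≤ s) :
    ∫ x, (psum T fbar n (s + 1) x : ℝ) ^ 2 ∂μ ≤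
      8 * (d s * h s) + 8 * s * ∑ k ∈ Finset.Ico 2 s, d k * h k := by
  have hb : ∀ k ∈ Finset.Ico 2 s,
      MemLp (fun x => ((birkhoffSum T (block T fbar k) n x : ℤ) : ℝ)) 2 μ := fun k hk =>
    memLp_birkhoffSum hT (hc.memLp_block hT.measurable (Finset.mem_Ico.1 hk).1 2) n
  have hbs : MemLp (fun x => ((birkhoffSum T (block T fbar s) n x : ℤ) : ℝ)) 2 μ :=
    memLp_birkhoffSum hT (hc.memLp_block hT.measurable hs 2) n
  have hint : Integrable (fun x => 2 * s * ∑ k ∈ Finset.Ico 2 s,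
      ((birkhoffSum T (block T fbar k) n x : ℤ) : ℝ) ^ 2) μ :=
    (integrable_finsetSum _ fun k hk => (hb k hk).integrable_sq).const_mul _
  calc ∫ x, (psum T fbar n (s + 1) x : ℝ) ^ 2 ∂μ
      ≤ ∫ x, (2 * ((birkhoffSum T (block T fbar s) n x : ℤ) : ℝ) ^ 2 + 2 * s * ∑ k ∈ Finset.Ico 2 s,
        ((birkhoffSum T (block T fbar k) n x : ℤ) : ℝ) ^ 2) ∂μ := by
        refine integral_mono_of_nonneg (ae_of_all _ fun x => sq_nonneg _)
          ((hbs.integrable_sq.const_mul 2).add hint) (ae_of_all _ fun x => ?_)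
        simp only [psum_succ T fbar n hs]
        push_cast
        have h1 := sq_sum_le_card_mul_sum_sq (s := Finset.Ico 2 s)
          (f := fun k => ((birkhoffSum T (block T fbar k) n x : ℤ) : ℝ))
        have h2 : (psum T fbar n s x : ℝ) =
            ∑ k ∈ Finset.Ico 2 s, ((birkhoffSum T (block T fbar k) n x : ℤ) : ℝ) := by
          unfold psum; push_cast; rfl
        have h3 : ((Finset.Ico 2 s).card : ℝ) ≤ s := by
          rw [Nat.card_Ico]; exact_mod_cast Nat.sub_le s 2
        have h4 : ((Finset.Ico 2 s).card : ℝ) *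
            ∑ k ∈ Finset.Ico 2 s, ((birkhoffSum T (block T fbar k) n x : ℤ) : ℝ) ^ 2 ≤
            s * ∑ k ∈ Finset.Ico 2 s, ((birkhoffSum T (block T fbar k) n x : ℤ) : ℝ) ^ 2 := by
          gcongr
        rw [← h2] at h1
        nlinarith [sq_nonneg ((psum T fbar n s x : ℝ) -
          ((birkhoffSum T (block T fbar s) n x : ℤ) : ℝ))]
    _ = 2 * ∫ x, ((birkhoffSum T (block T fbar s) n x : ℤ) : ℝ) ^ 2 ∂μ + 2 * s * ∑ k ∈ Finset.Ico 2 s,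
        ∫ x, ((birkhoffSum T (block T fbar k) n x : ℤ) : ℝ) ^ 2 ∂μ := by
        rw [integral_add (hbs.integrable_sq.const_mul 2) hint, integral_const_mul,
          integral_const_mul, integral_finsetSum _ fun k hk => (hb k hk).integrable_sq]
    _ ≤ 2 * (4 * (d s * h s)) + 2 * s * ∑ k ∈ Finset.Ico 2 s, 4 * (d k * h k) := by
        gcongr with k hk
        · exact hc.integral_birkhoffSum_block_sq_le hT hs n
        · exact hc.integral_birkhoffSum_block_sq_le hT (Finset.mem_Ico.1 hk).1 n
    _ = _ := by
        rw [← Finset.mul_sum]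
        ring

end Levels

end LatticeLCLT

/-! ### Main factor and remainder of the characteristic function. -/

namespace LatticeLCLT

theorem one_sub_prod_le_sum {ι : Type*} (s : Finset ι) {x : ι → ℝ} (h0 : ∀ i ∈ s, 0 ≤ x i)
    (h1 : ∀ i ∈ s, x i ≤ 1) : 1 - ∏ i ∈ s, x i ≤ ∑ i ∈ s, (1 - x i) := by
  classical
  induction s using Finset.induction_on with
  | empty => simp
  | insert a s ha ih =>
    rw [Finset.prod_insert ha, Finset.sum_insert ha]
    have i1 := ih (fun i hi => h0 i (Finset.mem_insert_of_mem hi))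
      fun i hi => h1 i (Finset.mem_insert_of_mem hi)
    have i2 := h0 a (Finset.mem_insert_self a s)
    have i3 := h1 a (Finset.mem_insert_self a s)
    have i4 : ∏ i ∈ s, x i ≤ 1 := Finset.prod_le_one
      (fun i hi => h0 i (Finset.mem_insert_of_mem hi)) fun i hi => h1 i (Finset.mem_insert_of_mem hi)
    have i5 : 0 ≤ ∏ i ∈ s, x i := Finset.prod_nonneg fun i hi => h0 i (Finset.mem_insert_of_mem hi)
    nlinarith

/-- The characteristic function of `f̄_k` at `u`. -/
noncomputable def chf (k : ℕ) (u : ℝ) : ℝ := 1 - α k ^ 2 * (1 - Real.cos u)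

theorem chf_nonneg {k : ℕ} (hk : 2 ≤ k) (u : ℝ) : 0 ≤ chf k u := by
  have h1 := α_sq_le_half hk
  have h2 := (α_sq_pos hk).le
  have h3 := Real.neg_one_le_cos u
  unfold chf
  nlinarith

theorem chf_le_one {k : ℕ} (u : ℝ) : chf k u ≤ 1 := by
  have h3 := Real.cos_le_one u
  have : 0 ≤ α k ^ 2 * (1 - Real.cos u) := mul_nonneg (sq_nonneg _) (by linarith)
  unfold chf
  linarith

theorem one_sub_chf_le (k : ℕ) (u : ℝ) : 1 - chf k u ≤ α k ^ 2 * (u ^ 2 / 2) := by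
  have h3 := Real.one_sub_sq_div_two_le_cos (x := u)
  have : α k ^ 2 * (1 - Real.cos u) ≤ α k ^ 2 * (u ^ 2 / 2) :=
    mul_le_mul_of_nonneg_left (by linarith) (sq_nonneg _)
  unfold chf
  linarith

/-- The variance of the `n`-th Birkhoff sum of `f_k`, for `n ≤ d k`. -/
noncomputable def levelVar (n k : ℕ) : ℝ :=
  α k ^ 2 * ∑ j ∈ Finset.range (2 * d k + p k + 1), (coef n k j : ℝ) ^ 2

theorem levelVar_nonneg (n k : ℕ) : 0 ≤ levelVar n k :=
  mul_nonneg (sq_nonneg _) (Finset.sum_nonneg fun _ _ => sq_nonneg _)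

theorem levelVar_le_left (n : ℕ) {k : ℕ} (hk : 2 ≤ k) :
    levelVar n k ≤ 2 * n ^ 2 * (h k / p k) := by
  have h1 : ∑ j ∈ Finset.range (2 * d k + p k + 1), (coef n k j : ℝ) ^ 2 ≤
      2 * ((n : ℝ) ^ 2 * p k) := by
    exact_mod_cast sum_coef_sq_le_left n k (Finset.range (2 * d k + p k + 1))
  have h2 : (0 : ℝ) < p k := by exact_mod_cast p_pos k
  calc levelVar n k ≤ α k ^ 2 * (2 * ((n : ℝ) ^ 2 * p k)) :=
        mul_le_mul_of_nonneg_left h1 (sq_nonneg _)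
    _ = _ := by rw [← p_sq_mul_α_sq hk]; field_simp

theorem levelVar_le_right (n : ℕ) {k : ℕ} (hk : 2 ≤ k) : levelVar n k ≤ 2 * n * h k := by
  have h1 : ∑ j ∈ Finset.range (2 * d k + p k + 1), (coef n k j : ℝ) ^ 2 ≤
      2 * (n * (p k : ℝ) ^ 2) := by
    exact_mod_cast sum_coef_sq_le_right n k (Finset.range (2 * d k + p k + 1))
  calc levelVar n k ≤ α k ^ 2 * (2 * (n * (p k : ℝ) ^ 2)) :=
        mul_le_mul_of_nonneg_left h1 (sq_nonneg _)
    _ = _ := by rw [← p_sq_mul_α_sq hk]; ring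

/-- The positions at which the coefficients of the `n`-th Birkhoff sum of `f_k` are `p k` or
`-p k`. -/
def plateau (n P k : ℕ) : Finset ℕ :=
  Finset.Ico P n ∪ Finset.Ico (d k + P) (d k + n)

theorem plateau_subset {n P k : ℕ} (hn : n ≤ d k) :
    plateau n P k ⊆ Finset.range (2 * d k + p k + 1) := by
  intro j hj
  simp only [plateau, Finset.mem_union, Finset.mem_Ico, Finset.mem_range] at *
  omega

theorem card_plateau {n P k : ℕ} (hn : n ≤ d k) : (plateau n P k).card = 2 * (n - P) := by
  unfold plateau
  rw [Finset.card_union_of_disjoint, Nat.card_Ico, Nat.card_Ico]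
  · omega
  · rw [Finset.disjoint_left]
    intro j hj hj'
    simp only [Finset.mem_Ico] at *
    omega

theorem coef_plateau {n P k j : ℕ} (hn : n ≤ d k) (hP : p k ≤ P) (hj : j ∈ plateau n P k) :
    coef n k j = p k ∨ coef n k j = -p k := by
  simp only [plateau, Finset.mem_union, Finset.mem_Ico] at hj
  rcases hj with ⟨h1, h2⟩ | ⟨h1, h2⟩
  · exact Or.inl (coef_eq_p hn hP h1 h2)
  · obtain ⟨i, rfl⟩ := Nat.exists_eq_add_of_le (show d k ≤ j by omega)
    exact Or.inr (coef_eq_neg_p hn hP (by omega) (by omega))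

theorem levelVar_eq {n P k : ℕ} (hk : 2 ≤ k) (hn : n ≤ d k) (hP : p k ≤ P) :
    levelVar n k = 2 * (n - P : ℕ) * h k + α k ^ 2 *
      ∑ j ∈ Finset.range (2 * d k + p k + 1) \ plateau n P k, (coef n k j : ℝ) ^ 2 := by
  unfold levelVar
  rw [← Finset.sum_sdiff (plateau_subset (P := P) hn), mul_add, add_comm]
  congr 1
  rw [Finset.sum_congr rfl (g := fun _ => (p k : ℝ) ^ 2), Finset.sum_const, card_plateau hn,
    ← p_sq_mul_α_sq hk, nsmul_eq_mul]
  · push_cast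
    ring
  · intro j hj
    rcases coef_plateau hn hP hj with e | e <;> rw [e] <;> push_cast <;> ring

/-- All plateau positions give the same factor, since cos is even. The remaining ones are collected
in r, and each costs at most θ²/2 times the variance it carries. -/
theorem exists_prod_chf_eq {n P k : ℕ} (hk : 2 ≤ k) (hn : n ≤ d k) (hP : p k ≤ P) (θ : ℝ) :
    ∃ r, 0 ≤ r ∧ r ≤ 1 ∧ 1 - r ≤ θ ^ 2 / 2 * (levelVar n k - 2 * (n - P : ℕ) * h k) ∧
      ∏ j ∈ Finset.range (2 * d k + p k + 1), chf k (θ * coef n k j) =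
        chf k (p k * θ) ^ (2 * (n - P)) * r := by
  refine ⟨∏ j ∈ Finset.range (2 * d k + p k + 1) \ plateau n P k, chf k (θ * coef n k j),
    Finset.prod_nonneg fun _ _ => chf_nonneg hk _,
    Finset.prod_le_one (fun _ _ => chf_nonneg hk _) fun _ _ => chf_le_one _, ?_, ?_⟩
  · rw [levelVar_eq hk hn hP, add_sub_cancel_left]
    refine (one_sub_prod_le_sum _ (fun _ _ => chf_nonneg hk _) fun _ _ => chf_le_one _).trans ?_
    rw [Finset.mul_sum, Finset.mul_sum]
    refine Finset.sum_le_sum fun j _ => (one_sub_chf_le _ _).trans (le_of_eq ?_)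
    ring
  · rw [← Finset.prod_sdiff (plateau_subset (P := P) hn), mul_comm]
    congr 1
    rw [← card_plateau hn, ← Finset.prod_const]
    refine Finset.prod_congr rfl fun j hj => ?_
    rcases coef_plateau hn hP hj with e | e <;> rw [e] <;> push_cast
    · rw [mul_comm]
    · unfold chf
      rw [mul_neg, Real.cos_neg, mul_comm θ]

theorem one_sub_prod_chf_le {n k : ℕ} (hk : 2 ≤ k) (θ : ℝ) :
    1 - ∏ j ∈ Finset.range (2 * d k + p k + 1), chf k (θ * coef n k j) ≤
      θ ^ 2 / 2 * levelVar n k := by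
  refine (one_sub_prod_le_sum _ (fun _ _ => chf_nonneg hk _) fun _ _ => chf_le_one _).trans ?_
  unfold levelVar
  rw [Finset.mul_sum, Finset.mul_sum]
  refine Finset.sum_le_sum fun j _ => (one_sub_chf_le _ _).trans (le_of_eq ?_)
  ring

/-- The main factor of the characteristic function of the `n`-th Birkhoff sum; here `I` is the set
of the levels that matter and `m` is their common effective length. -/
noncomputable def mainCf (I : Finset ℕ) (m : ℕ) (θ : ℝ) : ℝ :=
  ∏ k ∈ I, chf k (p k * θ) ^ (2 * m)

/-- An upper bound for the variance carried by the positions left out in `mainCf`. -/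
noncomputable def restVar (n P s K M : ℕ) : ℝ :=
  2 * P * ∑ k ∈ Finset.Ico (s + 1) K, h k + ∑ k ∈ Finset.Ico K M, levelVar n k

theorem sum_levelVar_le {n P s K M : ℕ} (hs : 2 ≤ s) (hK : s + 1 ≤ K) (hM : K ≤ M) (hPn : P ≤ n) :
    ∑ k ∈ Finset.Ico (s + 1) M, levelVar n k ≤
      2 * (n - P : ℕ) * ∑ k ∈ Finset.Ico (s + 1) K, h k + restVar n P s K M := by
  rw [← Finset.sum_Ico_consecutive _ hK hM, restVar, ← add_assoc, ← add_mul, Nat.cast_sub hPn]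
  gcongr
  rw [show 2 * ((n : ℝ) - P) + 2 * P = 2 * n by ring, Finset.mul_sum]
  exact Finset.sum_le_sum fun k hk => levelVar_le_right n (by have := Finset.mem_Ico.1 hk; omega)

theorem le_sum_levelVar {n P s K M : ℕ} (hs : 2 ≤ s) (hn : n ≤ d (s + 1)) (hK : s + 1 ≤ K)
    (hM : K ≤ M) (hP : ∀ k < K, p k ≤ P) :
    2 * (n - P : ℕ) * ∑ k ∈ Finset.Ico (s + 1) K, h k ≤
      ∑ k ∈ Finset.Ico (s + 1) M, levelVar n k := by
  rw [← Finset.sum_Ico_consecutive _ hK hM, Finset.mul_sum]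
  refine (Finset.sum_le_sum fun k hk => ?_).trans
    (le_add_of_nonneg_right (Finset.sum_nonneg fun _ _ => levelVar_nonneg _ _))
  have hk := Finset.mem_Ico.1 hk
  rw [levelVar_eq (by omega) (hn.trans (d_mono hk.1)) (hP k hk.2)]
  exact le_add_of_nonneg_right (mul_nonneg (sq_nonneg _) (Finset.sum_nonneg fun _ _ => sq_nonneg _))

/-- P bounds p k for all k < K, so those levels share the plateau length n - P; the levels from K on
go into r entirely. -/
theorem exists_prod_prod_chf_eq {n P s K M : ℕ} (hs : 2 ≤ s) (hn : n ≤ d (s + 1)) (hK : s + 1 ≤ K)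
    (hM : K ≤ M) (hP : ∀ k < K, p k ≤ P) (hPn : P ≤ n) (θ : ℝ) :
    ∃ r, 0 ≤ r ∧ r ≤ 1 ∧ 1 - r ≤ θ ^ 2 / 2 * restVar n P s K M ∧
      ∏ k ∈ Finset.Ico (s + 1) M,
        ∏ j ∈ Finset.range (2 * d k + p k + 1), chf k (θ * coef n k j) =
          mainCf (Finset.Ico (s + 1) K) (n - P) θ * r := by
  have H : ∀ k : ℕ, ∃ r, k ∈ Finset.Ico (s + 1) K →
      0 ≤ r ∧ r ≤ 1 ∧ 1 - r ≤ θ ^ 2 / 2 * (2 * P * h k) ∧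
      ∏ j ∈ Finset.range (2 * d k + p k + 1), chf k (θ * coef n k j) =
        chf k (p k * θ) ^ (2 * (n - P)) * r := by
    intro k
    by_cases hk : k ∈ Finset.Ico (s + 1) K
    · have hk' := Finset.mem_Ico.1 hk
      obtain ⟨r, h1, h2, h3, h4⟩ :=
        exists_prod_chf_eq (by omega) (hn.trans (d_mono hk'.1)) (hP k hk'.2) θ
      refine ⟨r, fun _ => ⟨h1, h2, h3.trans ?_, h4⟩⟩
      have := levelVar_le_right n (k := k) (by omega)
      rw [Nat.cast_sub hPn]
      gcongr
      linarith
    · exact ⟨0, fun h => absurd h hk⟩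
  choose r hr using H
  have hA0 : 0 ≤ ∏ k ∈ Finset.Ico (s + 1) K, r k := Finset.prod_nonneg fun k hk => (hr k hk).1
  have hA1 : ∏ k ∈ Finset.Ico (s + 1) K, r k ≤ 1 :=
    Finset.prod_le_one (fun k hk => (hr k hk).1) fun k hk => (hr k hk).2.1
  have hA : 1 - ∏ k ∈ Finset.Ico (s + 1) K, r k ≤
      θ ^ 2 / 2 * (2 * P * ∑ k ∈ Finset.Ico (s + 1) K, h k) := by
    refine (one_sub_prod_le_sum _ (fun k hk => (hr k hk).1) fun k hk => (hr k hk).2.1).trans ?_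
    rw [Finset.mul_sum, Finset.mul_sum]
    exact Finset.sum_le_sum fun k hk => (hr k hk).2.2.1
  have hB' : ∀ k ∈ Finset.Ico K M, 0 ≤
      ∏ j ∈ Finset.range (2 * d k + p k + 1), chf k (θ * coef n k j) := fun k hk =>
    Finset.prod_nonneg fun j _ => chf_nonneg (by have := Finset.mem_Ico.1 hk; omega) _
  have hB'' : ∀ k ∈ Finset.Ico K M,
      ∏ j ∈ Finset.range (2 * d k + p k + 1), chf k (θ * coef n k j) ≤ 1 := fun k hk =>
    Finset.prod_le_one (fun j _ => chf_nonneg (by have := Finset.mem_Ico.1 hk; omega) _)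
      fun j _ => chf_le_one _
  have hB : 1 - ∏ k ∈ Finset.Ico K M,
      ∏ j ∈ Finset.range (2 * d k + p k + 1), chf k (θ * coef n k j) ≤
      θ ^ 2 / 2 * ∑ k ∈ Finset.Ico K M, levelVar n k := by
    refine (one_sub_prod_le_sum _ hB' hB'').trans ?_
    rw [Finset.mul_sum]
    exact Finset.sum_le_sum fun k hk =>
      one_sub_prod_chf_le (by have := Finset.mem_Ico.1 hk; omega) θ
  have hB0 := Finset.prod_nonneg hB'
  have hB1 := Finset.prod_le_one hB' hB''
  refine ⟨(∏ k ∈ Finset.Ico (s + 1) K, r k) * ∏ k ∈ Finset.Ico K M,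
    ∏ j ∈ Finset.range (2 * d k + p k + 1), chf k (θ * coef n k j), mul_nonneg hA0 hB0,
    mul_le_one₀ hA1 hB0 hB1, ?_, ?_⟩
  · rw [restVar, mul_add]
    nlinarith
  · rw [← Finset.prod_Ico_consecutive _ hK hM, mainCf, ← mul_assoc, ← Finset.prod_mul_distrib]
    congr 1
    exact Finset.prod_congr rfl fun k hk => (hr k hk).2.2.2

theorem mainCf_nonneg {I : Finset ℕ} (m : ℕ) (θ : ℝ) : 0 ≤ mainCf I m θ :=
  Finset.prod_nonneg fun _ _ => by rw [pow_mul]; positivity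

theorem mainCf_le_one {I : Finset ℕ} (hI : ∀ k ∈ I, 2 ≤ k) (m : ℕ) (θ : ℝ) : mainCf I m θ ≤ 1 :=
  Finset.prod_le_one (fun k hk => pow_nonneg (chf_nonneg (hI k hk) _) _)
    fun k hk => pow_le_one₀ (chf_nonneg (hI k hk) _) (chf_le_one _)

theorem norm_cf_sub_one_le {X : Type*} [MeasurableSpace X] {μ : Measure X} [IsProbabilityMeasure μ]
    {V : X → ℤ} (hV : MemLp (fun x => (V x : ℝ)) 2 μ) (θ : ℝ) :
    ‖cf μ V θ - 1‖ ≤ |θ| * √(∫ x, (V x : ℝ) ^ 2 ∂μ) := by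
  have hm := hV.aestronglyMeasurable
  have hint : Integrable (fun x => Complex.exp (((θ * V x : ℝ) : ℂ) * Complex.I)) μ := by
    refine Integrable.of_bound ?_ 1 (ae_of_all _ fun x => by rw [Complex.norm_exp_ofReal_mul_I])
    exact Continuous.comp_aestronglyMeasurable
      (g := fun y : ℝ => Complex.exp (((θ * y : ℝ) : ℂ) * Complex.I)) (by fun_prop) hm
  have e : cf μ V θ - 1 = ∫ x, (Complex.exp (((θ * V x : ℝ) : ℂ) * Complex.I) - 1) ∂μ := by
    rw [integral_sub hint (integrable_const _)]
    simp [cf]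
  have h1 : Integrable (fun x => |(V x : ℝ)|) μ := (hV.integrable (by norm_num)).abs
  have h2 : (∫ x, |(V x : ℝ)| ∂μ) ^ 2 ≤ ∫ x, (V x : ℝ) ^ 2 ∂μ := by
    have h3 := variance_nonneg (fun x => |(V x : ℝ)|) μ
    have h4 : MemLp (fun x => |(V x : ℝ)|) 2 μ := hV.abs
    rw [variance_eq_sub h4] at h3
    simp only [Pi.pow_apply, sq_abs] at h3
    linarith
  calc ‖cf μ V θ - 1‖ ≤ ∫ x, |θ| * |(V x : ℝ)| ∂μ := by
        rw [e]
        refine norm_integral_le_of_norm_le (h1.const_mul _) (ae_of_all _ fun x => ?_)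
        rw [mul_comm _ Complex.I, ← abs_mul]
        exact Real.norm_exp_I_mul_ofReal_sub_one_le
    _ = |θ| * ∫ x, |(V x : ℝ)| ∂μ := integral_const_mul _ _
    _ ≤ _ := by gcongr; exact Real.le_sqrt_of_sq_le h2

section Levels

variable {X : Type*} [MeasurableSpace X] {μ : Measure X} [IsProbabilityMeasure μ] {T : X → X}
  {fbar : ℕ → X → ℤ}

/-- The characteristic function is z · A · r, with z from the low levels and A the main factor.
Dropping z and r gives a bound without error term, which is what domination on all of |θ| ≤ π needs.
The second estimate measures z - 1 and 1 - r and is meant for θ of order 1/√n. -/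
theorem IsCodingSequence.cf_psum_estimates (hc : IsCodingSequence T μ fbar)
    (hT : MeasurePreserving T μ μ) {n P s K M : ℕ} (hs : 2 ≤ s) (hn : n ≤ d (s + 1))
    (hK : s + 1 ≤ K) (hM : K ≤ M) (hP : ∀ k < K, p k ≤ P) (hPn : P ≤ n) (θ : ℝ) :
    ‖cf μ (psum T fbar n M) θ‖ ≤ mainCf (Finset.Ico (s + 1) K) (n - P) θ ∧
    ‖cf μ (psum T fbar n M) θ - mainCf (Finset.Ico (s + 1) K) (n - P) θ‖ ≤
      |θ| * √(∫ x, (psum T fbar n (s + 1) x : ℝ) ^ 2 ∂μ) + θ ^ 2 / 2 * restVar n P s K M := by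
  obtain ⟨r, h0, h1, h2, h3⟩ := exists_prod_prod_chf_eq hs hn hK hM hP hPn θ
  have e := hc.cf_psum hT (by omega) hn M (by omega) θ
  have e2 := norm_cf_sub_one_le (hc.memLp_psum hT n (s + 1) 2) θ
  have e3 := norm_cf_le_one μ (psum T fbar n (s + 1)) θ
  simp only [chf] at h3
  rw [h3] at e
  have m0 := mainCf_nonneg (I := Finset.Ico (s + 1) K) (n - P) θ
  have m1 := mainCf_le_one (I := Finset.Ico (s + 1) K)
    (fun k hk => by have := Finset.mem_Ico.1 hk; omega) (n - P) θ
  set A := mainCf (Finset.Ico (s + 1) K) (n - P) θ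
  constructor
  · rw [e, norm_mul, Complex.norm_real, Real.norm_of_nonneg (mul_nonneg m0 h0)]
    calc _ ≤ 1 * (A * 1) := by gcongr
      _ = A := by ring
  · set z := cf μ (psum T fbar n (s + 1)) θ
    have e4 : cf μ (psum T fbar n M) θ - A =
        (z - 1) * ((A * r : ℝ) : ℂ) - ((A * (1 - r) : ℝ) : ℂ) := by
      rw [e]; push_cast; ring
    rw [e4]
    refine (norm_sub_le _ _).trans (add_le_add ?_ ?_)
    · rw [norm_mul, Complex.norm_real, Real.norm_of_nonneg (mul_nonneg m0 h0)]
      refine (mul_le_of_le_one_right (norm_nonneg _) (mul_le_one₀ m1 h0 h1)).trans e2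
    · rw [Complex.norm_real, Real.norm_of_nonneg (mul_nonneg m0 (by linarith))]
      exact (mul_le_of_le_one_left (by linarith) m1).trans h2

theorem IsCodingSequence.integral_psum_sq_mem (hc : IsCodingSequence T μ fbar)
    (hT : MeasurePreserving T μ μ) {n P s K M : ℕ} (hs : 2 ≤ s) (hn : n ≤ d (s + 1))
    (hK : s + 1 ≤ K) (hM : K ≤ M) (hP : ∀ k < K, p k ≤ P) (hPn : P ≤ n) :
    2 * (n - P : ℕ) * ∑ k ∈ Finset.Ico (s + 1) K, h k ≤ ∫ x, (psum T fbar n M x : ℝ) ^ 2 ∂μ ∧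
    ∫ x, (psum T fbar n M x : ℝ) ^ 2 ∂μ ≤ 2 * (n - P : ℕ) * ∑ k ∈ Finset.Ico (s + 1) K, h k +
      (∫ x, (psum T fbar n (s + 1) x : ℝ) ^ 2 ∂μ + restVar n P s K M) := by
  have e := hc.integral_psum_sq hT (by omega) hn M (by omega)
  have h1 := sum_levelVar_le hs hK hM hPn
  have h2 := le_sum_levelVar hs hn hK hM hP
  have h3 : 0 ≤ ∫ x, (psum T fbar n (s + 1) x : ℝ) ^ 2 ∂μ := integral_nonneg fun x => sq_nonneg _
  unfold levelVar at h1 h2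
  constructor <;> linarith

end Levels

end LatticeLCLT

/-! ### Convergence of the series and passage to the limit function. -/

namespace LatticeLCLT

section LTwo

variable {X : Type*} [MeasurableSpace X] {μ : Measure X}

theorem eLpNorm_two_eq {V : X → ℝ} (hV : MemLp V 2 μ) :
    eLpNorm V 2 μ = ENNReal.ofReal (√(∫ x, V x ^ 2 ∂μ)) := by
  rw [hV.eLpNorm_eq_integral_rpow_norm (by norm_num) (by norm_num), Real.sqrt_eq_rpow]
  norm_num

theorem tendsto_integral_sq {V : ℕ → X → ℝ} {W : X → ℝ} (hV : ∀ M, MemLp (V M) 2 μ)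
    (hW : MemLp W 2 μ) (h : Tendsto (fun M => eLpNorm (V M - W) 2 μ) atTop (𝓝 0)) :
    Tendsto (fun M => ∫ x, V M x ^ 2 ∂μ) atTop (𝓝 (∫ x, W x ^ 2 ∂μ)) := by
  have h1 := ((Lp.tendsto_Lp_iff_tendsto_eLpNorm'' V hV W hW).2 h).norm.pow 2
  have e : ∀ {U : X → ℝ} (hU : MemLp U 2 μ), ‖hU.toLp U‖ ^ 2 = ∫ x, U x ^ 2 ∂μ := fun hU => by
    rw [Lp.norm_toLp, eLpNorm_two_eq hU, ENNReal.toReal_ofReal (Real.sqrt_nonneg _),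
      Real.sq_sqrt (integral_nonneg fun x => sq_nonneg _)]
  simpa only [e] using h1

theorem tendsto_cf [IsProbabilityMeasure μ] {V : ℕ → X → ℤ} {W : X → ℤ}
    (hV : ∀ M, Measurable (V M)) (h : ∀ᵐ x ∂μ, ∀ᶠ M in atTop, V M x = W x) (θ : ℝ) :
    Tendsto (fun M => cf μ (V M) θ) atTop (𝓝 (cf μ W θ)) := by
  refine tendsto_integral_of_dominated_convergence (fun _ => 1) (fun M => ?_) (integrable_const _)
    (fun M => ae_of_all _ fun x => by rw [Complex.norm_exp_ofReal_mul_I]) ?_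
  · exact ((measurable_of_countable fun a : ℤ =>
      Complex.exp (((θ * a : ℝ) : ℂ) * Complex.I)).comp (hV M)).aestronglyMeasurable
  · filter_upwards [h] with x hx
    refine tendsto_const_nhds.congr' ?_
    filter_upwards [hx] with M hM
    rw [hM]

end LTwo

/-- A square of a geometric term, so that both the L² norms of f_k and the probabilities of f_k ≠ 0
are summable. -/
theorem levelVar_one_le {k : ℕ} (hk : 2 ≤ k) : levelVar 1 k ≤ 4 * ((3 / 4 : ℝ) ^ k) ^ 2 := by
  have h1 := levelVar_le_left 1 hk
  have h2 := h_le_half hk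
  have h3 : (2 : ℝ) ^ k ≤ 2 * p k := by exact_mod_cast two_pow_le_two_mul_p k
  have h4 : (0 : ℝ) < p k := by exact_mod_cast p_pos k
  have h5 : h k / p k ≤ (1 / 2) / (2 ^ k / 2) := by
    gcongr
    linarith
  have h6 : ((1 : ℝ) / 2) ^ k ≤ ((3 / 4 : ℝ) ^ k) ^ 2 := by
    rw [← pow_mul, mul_comm, pow_mul]
    gcongr
    norm_num
  have h7 : (1 / 2 : ℝ) / (2 ^ k / 2) = (1 / 2) ^ k := by rw [one_div_pow]; field_simp
  have h8 : 0 ≤ ((1 : ℝ) / 2) ^ k := by positivity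
  simp only [Nat.cast_one] at h1
  nlinarith

theorem psum_one {X : Type*} (T : X → X) (fbar : ℕ → X → ℤ) (M : ℕ) (x : X) :
    psum T fbar 1 M x = ∑ k ∈ Finset.Ico 2 M, block T fbar k x := by
  simp [psum]

theorem psum_eq_birkhoffSum {X : Type*} (T : X → X) (fbar : ℕ → X → ℤ) (n M : ℕ) :
    psum T fbar n M = birkhoffSum T (psum T fbar 1 M) n := by
  ext x
  simp only [psum, birkhoffSum, Finset.sum_range_one, Function.iterate_zero, id]
  exact Finset.sum_comm

section Levels

variable {X : Type*} [MeasurableSpace X] {μ : Measure X} [IsProbabilityMeasure μ] {T : X → X}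
  {fbar : ℕ → X → ℤ}

theorem IsCodingSequence.integral_block_sq (hc : IsCodingSequence T μ fbar)
    (hT : MeasurePreserving T μ μ) {k : ℕ} (hk : 2 ≤ k) :
    ∫ x, (block T fbar k x : ℝ) ^ 2 ∂μ = levelVar 1 k := by
  have : ∀ x, block T fbar k x = lin T fbar k (coef 1 k) x := fun x => by
    rw [← birkhoffSum_block_eq_lin T fbar (Nat.one_le_two_pow), birkhoffSum_one]
  simp only [this]
  exact hc.integral_lin_sq hT hk _

theorem IsCodingSequence.eLpNorm_block_le (hc : IsCodingSequence T μ fbar)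
    (hT : MeasurePreserving T μ μ) {k : ℕ} (hk : 2 ≤ k) :
    eLpNorm (fun x => (block T fbar k x : ℝ)) 2 μ ≤ ENNReal.ofReal (2 * (3 / 4) ^ k) := by
  rw [eLpNorm_two_eq (hc.memLp_block hT.measurable hk 2), hc.integral_block_sq hT hk]
  refine ENNReal.ofReal_le_ofReal (Real.sqrt_le_iff.2 ⟨by positivity, ?_⟩)
  have := levelVar_one_le hk
  linarith

/-- An integer different from 0 has square at least 1, so the second moment bounds the probability.
Borel–Cantelli then leaves finitely many nonzero terms. -/
theorem IsCodingSequence.measure_block_ne_zero_le (hc : IsCodingSequence T μ fbar)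
    (hT : MeasurePreserving T μ μ) {k : ℕ} (hk : 2 ≤ k) :
    μ {x | block T fbar k x ≠ 0} ≤ ENNReal.ofReal (4 * ((3 / 4 : ℝ) ^ k) ^ 2) := by
  have h1 := mul_meas_ge_le_integral_of_nonneg (μ := μ) (ae_of_all _ fun x => sq_nonneg _)
    (hc.memLp_block hT.measurable hk 2).integrable_sq 1
  rw [one_mul, hc.integral_block_sq hT hk] at h1
  have h2 : {x | block T fbar k x ≠ 0} = {x | 1 ≤ (block T fbar k x : ℝ) ^ 2} := by
    ext x
    simp only [Set.mem_ofPred_eq]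
    rw [← sq_abs, one_le_sq_iff₀ (abs_nonneg _)]
    constructor
    · intro h
      exact_mod_cast Int.one_le_abs h
    · intro h h0
      rw [h0] at h
      norm_num at h
  rw [h2, ← ofReal_measureReal]
  exact ENNReal.ofReal_le_ofReal (h1.trans (levelVar_one_le hk))

theorem IsCodingSequence.ae_eventually_block_eq_zero (hc : IsCodingSequence T μ fbar)
    (hT : MeasurePreserving T μ μ) : ∀ᵐ x ∂μ, ∀ᶠ k in atTop, block T fbar (k + 2) x = 0 := by
  have hs : Summable fun k : ℕ => 4 * ((3 / 4 : ℝ) ^ (k + 2)) ^ 2 := by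
    have : (fun k : ℕ => 4 * ((3 / 4 : ℝ) ^ (k + 2)) ^ 2) =
        fun k => (4 * (81 / 256)) * (9 / 16 : ℝ) ^ k := by
      ext k
      rw [← pow_mul, mul_comm (k + 2), pow_mul, pow_add]
      norm_num
      ring
    rw [this]
    exact (summable_geometric_of_lt_one (by norm_num) (by norm_num)).mul_left _
  have h1 : ∑' k : ℕ, μ {x | block T fbar (k + 2) x ≠ 0} ≠ ⊤ := by
    refine ne_top_of_le_ne_top hs.tsum_ofReal_ne_top
      (ENNReal.tsum_le_tsum fun k => hc.measure_block_ne_zero_le hT (by omega))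
  filter_upwards [ae_eventually_notMem h1] with x hx
  filter_upwards [hx] with k hk
  simpa using hk

/-- The series `∑ f_k` converges almost everywhere. -/
theorem IsCodingSequence.exists_ae_limit (hc : IsCodingSequence T μ fbar)
    (hT : MeasurePreserving T μ μ) :
    ∃ f : X → ℤ, Measurable f ∧ (∀ᵐ x ∂μ, HasSum (fun k : ℕ => block T fbar (k + 2) x) (f x)) ∧
      ∀ᵐ x ∂μ, ∀ᶠ M in atTop, psum T fbar 1 M x = f x := by
  have h0 := hc.ae_eventually_block_eq_zero hT
  have h1 : ∀ᵐ x ∂μ, ∃ N, HasSum (fun k : ℕ => block T fbar (k + 2) x) (psum T fbar 1 (N + 2) x) ∧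
      ∀ M, N + 2 ≤ M → psum T fbar 1 M x = psum T fbar 1 (N + 2) x := by
    filter_upwards [h0] with x hx
    obtain ⟨N, hN⟩ := eventually_atTop.1 hx
    refine ⟨N, ?_, fun M hM => ?_⟩
    · rw [psum_one, Finset.sum_Ico_eq_sum_range, Nat.add_sub_cancel]
      simp_rw [add_comm 2]
      exact hasSum_sum_of_ne_finset_zero fun k hk =>
        hN k (by rw [Finset.mem_range] at hk; omega)
    · rw [psum_one, psum_one, ← Finset.sum_Ico_consecutive _ (by omega) hM, add_eq_left]
      refine Finset.sum_eq_zero fun k hk => ?_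
      have hk := Finset.mem_Ico.1 hk
      obtain ⟨l, rfl⟩ := Nat.exists_eq_add_of_le (show 2 ≤ k by omega)
      rw [add_comm]
      exact hN l (by omega)
  obtain ⟨f, hf, hlim⟩ := measurable_limit_of_tendsto_metrizable_ae (L := atTop)
    (fun M => (hc.measurable_psum hT.measurable 1 M).aemeasurable (μ := μ)) (by
      filter_upwards [h1] with x ⟨N, _, hN⟩
      refine ⟨psum T fbar 1 (N + 2) x, tendsto_const_nhds.congr' ?_⟩
      filter_upwards [eventually_ge_atTop (N + 2)] with M hM using (hN M hM).symm)
  refine ⟨f, hf, ?_, ?_⟩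
  · filter_upwards [h1, hlim] with x ⟨N, hs, hN⟩ hx
    rwa [tendsto_nhds_unique hx (tendsto_const_nhds.congr' (by
      filter_upwards [eventually_ge_atTop (N + 2)] with M hM using (hN M hM).symm))]
  · filter_upwards [hlim] with x hx
    rw [nhds_discrete, tendsto_pure] at hx
    exact hx

variable {f : X → ℤ}

/-- Fatou's lemma reduces the tail of the series to finite sums, which a geometric tail bounds. -/
theorem IsCodingSequence.tendsto_eLpNorm_sub (hc : IsCodingSequence T μ fbar)
    (hT : MeasurePreserving T μ μ) (hf : ∀ᵐ x ∂μ, ∀ᶠ M in atTop, psum T fbar 1 M x = f x) :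
    Tendsto (fun M => eLpNorm (fun x => (f x : ℝ) - psum T fbar 1 M x) 2 μ) atTop (𝓝 0) := by
  have hs : Summable fun k : ℕ => 2 * (3 / 4 : ℝ) ^ k :=
    (summable_geometric_of_lt_one (by norm_num) (by norm_num)).mul_left _
  have hm : ∀ M, AEStronglyMeasurable (fun x => (psum T fbar 1 M x : ℝ)) μ := fun M =>
    (hc.memLp_psum hT 1 M 2).1
  refine tendsto_of_tendsto_of_tendsto_of_le_of_le' tendsto_const_nhds
    (ENNReal.tendsto_sum_nat_add _ hs.tsum_ofReal_ne_top) (Eventually.of_forall fun _ => zero_le)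
    ?_
  filter_upwards [eventually_ge_atTop 2] with M hM
  refine (Lp.eLpNorm_lim_le_liminf_eLpNorm
    (f := fun N x => (psum T fbar 1 N x : ℝ) - psum T fbar 1 M x) (fun N => (hm N).sub (hm M)) _ ?_
    ).trans (liminf_le_of_le (by isBoundedDefault) fun b hb => ?_)
  · filter_upwards [hf] with x hx
    refine tendsto_const_nhds.congr' ?_
    filter_upwards [hx] with N hN
    rw [hN]
  · obtain ⟨N, hN, hMN⟩ := (hb.and (eventually_ge_atTop M)).exists
    refine hN.trans ?_
    have e : (fun x => (psum T fbar 1 N x : ℝ) - psum T fbar 1 M x) =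
        ∑ k ∈ Finset.Ico M N, fun x => (block T fbar k x : ℝ) := by
      ext x
      rw [psum_one, psum_one, ← Finset.sum_Ico_consecutive _ hM hMN, Finset.sum_apply]
      push_cast
      ring
    rw [e]
    refine (eLpNorm_sum_le (fun k hk => (hc.memLp_block hT.measurable (k := k)
      (by have := Finset.mem_Ico.1 hk; omega) 2).1) (by norm_num)).trans ?_
    refine (Finset.sum_le_sum fun k hk => hc.eLpNorm_block_le hT (k := k)
      (by have := Finset.mem_Ico.1 hk; omega)).trans ?_
    rw [Finset.sum_Ico_eq_sum_range]
    simp_rw [add_comm M]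
    exact ENNReal.sum_le_tsum _

theorem IsCodingSequence.memLp_limit (hc : IsCodingSequence T μ fbar)
    (hT : MeasurePreserving T μ μ) (hfm : Measurable f)
    (hf : ∀ᵐ x ∂μ, ∀ᶠ M in atTop, psum T fbar 1 M x = f x) :
    MemLp (fun x => (f x : ℝ)) 2 μ := by
  obtain ⟨M, hM⟩ := ((hc.tendsto_eLpNorm_sub hT hf).eventually_lt_const
    (show (0 : ENNReal) < ⊤ by simp)).exists
  have h1 : MemLp (fun x => (f x : ℝ) - psum T fbar 1 M x) 2 μ :=
    ⟨((measurable_of_countable fun a : ℤ => (a : ℝ)).comp hfm).aestronglyMeasurable.sub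
      (hc.memLp_psum hT 1 M 2).1, hM⟩
  exact (h1.add (hc.memLp_psum hT 1 M 2)).congr_norm
    ((measurable_of_countable fun a : ℤ => (a : ℝ)).comp hfm).aestronglyMeasurable (ae_of_all _ fun x => by simp)

theorem IsCodingSequence.integral_psum (hc : IsCodingSequence T μ fbar)
    (hT : MeasurePreserving T μ μ) (M : ℕ) : ∫ x, (psum T fbar 1 M x : ℝ) ∂μ = 0 := by
  simp only [psum_one]
  push_cast
  rw [integral_finsetSum]
  · refine Finset.sum_eq_zero fun k hk => ?_
    have : ∀ x, block T fbar k x = lin T fbar k (coef 1 k) x := fun x => by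
      rw [← birkhoffSum_block_eq_lin T fbar (Nat.one_le_two_pow), birkhoffSum_one]
    simp only [this]
    exact hc.integral_lin hT (Finset.mem_Ico.1 hk).1 _
  · exact fun k hk =>
      (hc.memLp_block hT.measurable (Finset.mem_Ico.1 hk).1 2).integrable (by norm_num)

theorem IsCodingSequence.integral_limit (hc : IsCodingSequence T μ fbar)
    (hT : MeasurePreserving T μ μ) (hfm : Measurable f)
    (hf : ∀ᵐ x ∂μ, ∀ᶠ M in atTop, psum T fbar 1 M x = f x) : ∫ x, (f x : ℝ) ∂μ = 0 := by
  have hL := hc.memLp_limit hT hfm hf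
  have h1 := tendsto_integral_of_L1' (fun x => (f x : ℝ)) hL.1 (l := atTop)
    (F := fun M x => (psum T fbar 1 M x : ℝ))
    (Eventually.of_forall fun M => (hc.memLp_psum hT 1 M 2).integrable (by norm_num)) (by
      refine tendsto_of_tendsto_of_tendsto_of_le_of_le tendsto_const_nhds
        (hc.tendsto_eLpNorm_sub hT hf) (fun _ => zero_le) fun M => ?_
      rw [eLpNorm_sub_comm]
      exact eLpNorm_le_eLpNorm_of_exponent_le (by norm_num) (hL.1.sub (hc.memLp_psum hT 1 M 2).1))
  simp only [hc.integral_psum hT] at h1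
  exact (tendsto_nhds_unique h1 tendsto_const_nhds)

theorem IsCodingSequence.tendsto_cf_psum (hc : IsCodingSequence T μ fbar)
    (hT : MeasurePreserving T μ μ) (hf : ∀ᵐ x ∂μ, ∀ᶠ M in atTop, psum T fbar 1 M x = f x)
    (n : ℕ) (θ : ℝ) :
    Tendsto (fun M => cf μ (psum T fbar n M) θ) atTop (𝓝 (cf μ (birkhoffSum T f n) θ)) := by
  refine tendsto_cf (hc.measurable_psum hT.measurable n) ?_ θ
  have h1 : ∀ᵐ x ∂μ, ∀ i : ℕ, ∀ᶠ M in atTop, psum T fbar 1 M (T^[i] x) = f (T^[i] x) :=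
    ae_all_iff.2 fun i => (hT.iterate i).quasiMeasurePreserving.ae hf
  filter_upwards [h1] with x hx
  have h2 : ∀ᶠ M in atTop, ∀ i ∈ Finset.range n, psum T fbar 1 M (T^[i] x) = f (T^[i] x) :=
    (Finset.range n).eventually_all.2 fun i _ => hx i
  filter_upwards [h2] with M hM
  rw [psum_eq_birkhoffSum]
  exact Finset.sum_congr rfl hM

theorem IsCodingSequence.tendsto_integral_psum_sq (hc : IsCodingSequence T μ fbar)
    (hT : MeasurePreserving T μ μ) (hfm : Measurable f)
    (hf : ∀ᵐ x ∂μ, ∀ᶠ M in atTop, psum T fbar 1 M x = f x) (n : ℕ) :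
    Tendsto (fun M => ∫ x, (psum T fbar n M x : ℝ) ^ 2 ∂μ) atTop
      (𝓝 (∫ x, ((birkhoffSum T f n x : ℤ) : ℝ) ^ 2 ∂μ)) := by
  have hL := hc.memLp_limit hT hfm hf
  refine tendsto_integral_sq (fun M => hc.memLp_psum hT n M 2) (memLp_birkhoffSum hT hL n) ?_
  have h1 : Tendsto (fun M => n * eLpNorm (fun x => (f x : ℝ) - psum T fbar 1 M x) 2 μ) atTop
      (𝓝 0) := by
    simpa using ENNReal.Tendsto.const_mul (hc.tendsto_eLpNorm_sub hT hf) (a := n) (by simp)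
  refine tendsto_of_tendsto_of_tendsto_of_le_of_le tendsto_const_nhds h1 (fun _ => zero_le)
    fun M => ?_
  have hd := hL.1.sub (hc.memLp_psum hT 1 M 2).1
  rw [eLpNorm_sub_comm]
  have e : ((fun x => ((birkhoffSum T f n x : ℤ) : ℝ)) - fun x => (psum T fbar n M x : ℝ)) =
      ∑ i ∈ Finset.range n, (fun x => (f x : ℝ) - psum T fbar 1 M x) ∘ T^[i] := by
    ext x
    rw [psum_eq_birkhoffSum, Finset.sum_apply]
    simp [birkhoffSum, Finset.sum_sub_distrib]
  rw [e]
  refine (eLpNorm_sum_le (fun i _ => hd.comp_measurePreserving (hT.iterate i))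
    (by norm_num)).trans (le_of_eq ?_)
  rw [Finset.sum_congr rfl fun i _ => eLpNorm_comp_measurePreserving hd (hT.iterate i)]
  rw [Finset.sum_const, Finset.card_range, nsmul_eq_mul]
  rfl

/-- Here M → ∞ with n and K fixed; this is why the remainder has to be bounded uniformly in M. -/
theorem IsCodingSequence.estimates_limit (hc : IsCodingSequence T μ fbar)
    (hT : MeasurePreserving T μ μ) (hfm : Measurable f)
    (hf : ∀ᵐ x ∂μ, ∀ᶠ M in atTop, psum T fbar 1 M x = f x) {n P s K : ℕ} {A B : ℝ} (hs : 2 ≤ s)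
    (hn : n ≤ d (s + 1)) (hK : s + 1 ≤ K) (hP : ∀ k < K, p k ≤ P) (hPn : P ≤ n)
    (hA : ∫ x, (psum T fbar n (s + 1) x : ℝ) ^ 2 ∂μ ≤ A)
    (hB : ∀ M, K ≤ M → restVar n P s K M ≤ B) :
    (2 * (n - P : ℕ) * ∑ k ∈ Finset.Ico (s + 1) K, h k ≤
        ∫ x, ((birkhoffSum T f n x : ℤ) : ℝ) ^ 2 ∂μ ∧
      ∫ x, ((birkhoffSum T f n x : ℤ) : ℝ) ^ 2 ∂μ ≤
        2 * (n - P : ℕ) * ∑ k ∈ Finset.Ico (s + 1) K, h k + (A + B)) ∧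
    ∀ θ, ‖cf μ (birkhoffSum T f n) θ‖ ≤ mainCf (Finset.Ico (s + 1) K) (n - P) θ ∧
      ‖cf μ (birkhoffSum T f n) θ - mainCf (Finset.Ico (s + 1) K) (n - P) θ‖ ≤
        |θ| * √A + θ ^ 2 / 2 * B := by
  have hsq := hc.tendsto_integral_psum_sq hT hfm hf n
  refine ⟨⟨ge_of_tendsto hsq ?_, le_of_tendsto hsq ?_⟩, fun θ => ?_⟩
  · filter_upwards [eventually_ge_atTop K] with M hM
    exact (hc.integral_psum_sq_mem hT hs hn hK hM hP hPn).1
  · filter_upwards [eventually_ge_atTop K] with M hM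
    have := (hc.integral_psum_sq_mem hT hs hn hK hM hP hPn).2
    have := hB M hM
    linarith
  · have h1 := hc.tendsto_cf_psum hT hf n θ
    refine ⟨le_of_tendsto h1.norm ?_, le_of_tendsto (h1.sub_const _).norm ?_⟩
    · filter_upwards [eventually_ge_atTop K] with M hM
      exact (hc.cf_psum_estimates hT hs hn hK hM hP hPn θ).1
    · filter_upwards [eventually_ge_atTop K] with M hM
      refine (hc.cf_psum_estimates hT hs hn hK hM hP hPn θ).2.trans ?_
      gcongr
      exact hB M hM

end Levels

end LatticeLCLT

/-! ### Asymptotics of the sums of h, and the range of main levels. -/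

namespace LatticeLCLT

theorem h_eq {k : ℕ} (hk : 2 ≤ k) : h k = Real.log 2 * (1 / (k * Real.log k)) := by
  have h1 : 0 < Real.log 2 := Real.log_pos (by norm_num)
  have h2 : 0 < Real.log k := Real.log_pos (by exact_mod_cast hk)
  unfold h Real.logb
  field_simp

theorem h_anti {k l : ℕ} (hk : 2 ≤ k) (hkl : k ≤ l) : h l ≤ h k := by
  have h1 : (k : ℝ) ≤ l := by exact_mod_cast hkl
  have h2 := one_le_logb hk
  have h3 : (2 : ℝ) ≤ k := by exact_mod_cast hk
  have h4 : Real.logb 2 k ≤ Real.logb 2 l :=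
    Real.logb_le_logb_of_le (by norm_num) (by linarith) h1
  unfold h
  gcongr

/-- log x ≤ x - 1 used twice, for the quotient of the two logarithms and for (k + 1)/k. The reverse
comparison below uses 1 - 1/x ≤ log x in the same way. -/
theorem log_log_succ_sub_le {k : ℕ} (hk : 2 ≤ k) :
    Real.log (Real.log (k + 1 : ℕ)) - Real.log (Real.log k) ≤ 1 / (k * Real.log k) := by
  have h3 : (2 : ℝ) ≤ k := by exact_mod_cast hk
  have h1 : 0 < Real.log k := Real.log_pos (by linarith)
  have h2 : 0 < Real.log (k + 1 : ℕ) := Real.log_pos (by push_cast; linarith)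
  rw [← Real.log_div h2.ne' h1.ne']
  refine (Real.log_le_sub_one_of_pos (by positivity)).trans ?_
  have h4 : Real.log (k + 1 : ℕ) - Real.log k ≤ 1 / k := by
    rw [← Real.log_div (by positivity) (by positivity)]
    refine (Real.log_le_sub_one_of_pos (by positivity)).trans (le_of_eq ?_)
    push_cast
    field_simp
    ring
  rw [← one_div_mul_one_div, div_sub_one h1.ne', div_eq_mul_one_div _ (Real.log k)]
  gcongr

theorem le_log_log_succ_sub {k : ℕ} (hk : 2 ≤ k) :
    1 / ((k + 1 : ℕ) * Real.log (k + 1 : ℕ)) ≤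
      Real.log (Real.log (k + 1 : ℕ)) - Real.log (Real.log k) := by
  have h3 : (2 : ℝ) ≤ k := by exact_mod_cast hk
  have h1 : 0 < Real.log k := Real.log_pos (by linarith)
  have h2 : 0 < Real.log (k + 1 : ℕ) := Real.log_pos (by push_cast; linarith)
  rw [← Real.log_div h2.ne' h1.ne']
  refine le_trans ?_ (Real.one_sub_inv_le_log_of_pos (by positivity))
  have h4 : 1 / ((k + 1 : ℕ) : ℝ) ≤ Real.log (k + 1 : ℕ) - Real.log k := by
    rw [← Real.log_div (by positivity) (by positivity)]
    refine le_trans (le_of_eq ?_) (Real.one_sub_inv_le_log_of_pos (by positivity))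
    push_cast
    field_simp
    ring
  rw [← one_div_mul_one_div, inv_div, one_sub_div h2.ne',
    div_eq_mul_one_div (Real.log (k + 1 : ℕ) - Real.log k)]
  gcongr

theorem sum_h_le {a b : ℕ} (ha : 2 ≤ a) (hab : a + 1 ≤ b) :
    ∑ k ∈ Finset.Ico (a + 1) b, h k ≤
      Real.log 2 * (Real.log (Real.log b) - Real.log (Real.log a)) := by
  have hl : 0 < Real.log 2 := Real.log_pos (by norm_num)
  have : ∀ c, a + 1 ≤ c → ∑ k ∈ Finset.Ico (a + 1) c, h k ≤
      Real.log 2 * (Real.log (Real.log (c - 1 : ℕ)) - Real.log (Real.log a)) := by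
    intro c hc
    induction c, hc using Nat.le_induction with
    | base => simp
    | succ c hc ih =>
      rw [Finset.sum_Ico_succ_top hc, Nat.add_sub_cancel]
      obtain ⟨e, rfl⟩ := Nat.exists_eq_add_of_le' (show 1 ≤ c by omega)
      have h1 := le_log_log_succ_sub (k := e) (by omega)
      rw [Nat.add_sub_cancel] at ih
      rw [h_eq (k := e + 1) (by omega)]
      have := mul_le_mul_of_nonneg_left h1 hl.le
      linarith
  refine (this b hab).trans ?_
  have h2 : (2 : ℝ) ≤ (b - 1 : ℕ) := by exact_mod_cast (by omega : 2 ≤ b - 1)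
  have h3 : ((b - 1 : ℕ) : ℝ) ≤ b := by exact_mod_cast Nat.sub_le b 1
  have h4 : 0 < Real.log (b - 1 : ℕ) := Real.log_pos (by linarith)
  gcongr

theorem le_sum_h {a b : ℕ} (ha : 2 ≤ a) (hab : a ≤ b) :
    Real.log 2 * (Real.log (Real.log b) - Real.log (Real.log a)) ≤
      ∑ k ∈ Finset.Ico a b, h k := by
  have hl : 0 < Real.log 2 := Real.log_pos (by norm_num)
  induction b, hab using Nat.le_induction with
  | base => simp
  | succ c hc ih =>
    rw [Finset.sum_Ico_succ_top hc, h_eq (k := c) (by omega)]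
    have := mul_le_mul_of_nonneg_left (log_log_succ_sub_le (k := c) (by omega)) hl.le
    linarith

/-- The source of the value of σ²: one factor log 2 comes from the base-2 logarithm in h, the other
from log log (s/2)² - log log s, which tends to log 2. -/
theorem tendsto_sum_h :
    Tendsto (fun s : ℕ => ∑ k ∈ Finset.Ico (s + 1) ((s / 2) ^ 2), h k) atTop
      (𝓝 (Real.log 2 ^ 2)) := by
  have hl : 0 < Real.log 2 := Real.log_pos (by norm_num)
  have hlim : Tendsto (fun s : ℕ => Real.log 2 *
      Real.log (2 * (1 - Real.log 4 / Real.log (s + 1 : ℕ)))) atTop (𝓝 (Real.log 2 ^ 2)) := by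
    have h1 : Tendsto (fun s : ℕ => Real.log (s + 1 : ℕ)) atTop atTop :=
      Real.tendsto_log_atTop.comp (tendsto_natCast_atTop_atTop.comp (tendsto_add_atTop_nat 1))
    have h2 : Tendsto (fun s : ℕ => 2 * (1 - Real.log 4 / Real.log (s + 1 : ℕ))) atTop
        (𝓝 (2 * (1 - 0))) := (tendsto_const_nhds.sub (h1.const_div_atTop _)).const_mul 2
    rw [sub_zero, mul_one] at h2
    have h3 := (h2.log (by norm_num)).const_mul (Real.log 2)
    rwa [← sq] at h3
  refine tendsto_of_tendsto_of_tendsto_of_le_of_le' hlim tendsto_const_nhds ?_ ?_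
  · filter_upwards [eventually_ge_atTop 8] with s hs
    obtain ⟨r, hr⟩ : ∃ r, s / 2 = r := ⟨_, rfl⟩
    have hr4 : 4 ≤ r := by omega
    have hsr : s + 1 ≤ r ^ 2 := by nlinarith [Nat.div_add_mod s 2, Nat.mod_lt s two_pos]
    rw [hr]
    refine le_trans ?_ (le_sum_h (by omega) hsr)
    have hs1 : (9 : ℝ) ≤ (s + 1 : ℕ) := by exact_mod_cast (by omega : 9 ≤ s + 1)
    have h1 : 0 < Real.log (s + 1 : ℕ) := Real.log_pos (by linarith)
    have hr0 : (4 : ℝ) ≤ r := by exact_mod_cast hr4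
    have h2 : 0 < Real.log (r ^ 2 : ℕ) := Real.log_pos (by push_cast; nlinarith)
    have h4 : Real.log 4 < Real.log (s + 1 : ℕ) := Real.log_lt_log (by norm_num) (by linarith)
    have h5 : Real.log (s + 1 : ℕ) ≤ Real.log 4 + Real.log r := by
      rw [← Real.log_mul (by norm_num) (by positivity)]
      refine Real.log_le_log (by positivity) ?_
      exact_mod_cast (by omega : s + 1 ≤ 4 * r)
    rw [← Real.log_div h2.ne' h1.ne']
    have h6 : 0 < 1 - Real.log 4 / Real.log (s + 1 : ℕ) := by
      rw [sub_pos, div_lt_one h1]; exact h4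
    refine mul_le_mul_of_nonneg_left (Real.log_le_log (by linarith) ?_) hl.le
    rw [one_sub_div h1.ne', ← mul_div_assoc]
    gcongr
    rw [Nat.cast_pow, Real.log_pow, Nat.cast_ofNat]
    linarith
  · filter_upwards [eventually_ge_atTop 8] with s hs
    obtain ⟨r, hr⟩ : ∃ r, s / 2 = r := ⟨_, rfl⟩
    have hr4 : 4 ≤ r := by omega
    have hsr : s + 1 ≤ r ^ 2 := by nlinarith [Nat.div_add_mod s 2, Nat.mod_lt s two_pos]
    rw [hr]
    refine (sum_h_le (by omega) hsr).trans ?_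
    have hs1 : (8 : ℝ) ≤ s := by exact_mod_cast hs
    have h1 : 0 < Real.log s := Real.log_pos (by linarith)
    have hr0 : (4 : ℝ) ≤ r := by exact_mod_cast hr4
    have h2 : 0 < Real.log (r ^ 2 : ℕ) := Real.log_pos (by push_cast; nlinarith)
    rw [← Real.log_div h2.ne' h1.ne', sq (Real.log 2)]
    refine mul_le_mul_of_nonneg_left (Real.log_le_log (by positivity) ?_) hl.le
    rw [div_le_iff₀ h1]
    push_cast
    rw [Real.log_pow]
    have : (r : ℝ) ≤ s := by exact_mod_cast (by omega : r ≤ s)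
    push_cast
    gcongr

/-- The level index attached to `n`: the largest `s` with `d s ≤ n`. -/
def lev (n : ℕ) : ℕ := Nat.sqrt (Nat.log 2 n)

theorem d_lev_le {n : ℕ} (hn : 1 ≤ n) : d (lev n) ≤ n := by
  unfold d lev
  refine le_trans (Nat.pow_le_pow_right (by norm_num) ?_) (Nat.pow_log_le_self 2 (by omega))
  exact Nat.sqrt_le' _

theorem lt_d_succ_lev (n : ℕ) : n < d (lev n + 1) := by
  unfold d lev
  refine lt_of_lt_of_le (Nat.lt_pow_succ_log_self (by norm_num) n)
    (Nat.pow_le_pow_right (by norm_num) ?_)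
  exact Nat.lt_succ_sqrt' _

theorem log_le_lev (n : ℕ) : Nat.log 2 n + 1 ≤ (lev n + 1) ^ 2 := Nat.lt_succ_sqrt' _

theorem tendsto_lev : Tendsto lev atTop atTop := by
  refine tendsto_atTop.2 fun s => ?_
  filter_upwards [eventually_ge_atTop (d s)] with n hn
  refine Nat.le_sqrt'.2 ?_
  exact Nat.le_log_of_pow_le (by norm_num) hn

/-- The levels that matter for the `n`-th Birkhoff sum end before `top n`. -/
def top (n : ℕ) : ℕ := (lev n / 2) ^ 2

/-- The halving in `top` is made for this: 4 · top n ≤ (lev n)² ≤ log₂ n, so every p k in the main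
range is at most n^{1/4}. -/
theorem two_pow_top_pow_four_le {n : ℕ} (hn : 1 ≤ n) : (2 ^ top n) ^ 4 ≤ n := by
  refine le_trans ?_ (d_lev_le hn)
  unfold d top
  rw [← pow_mul]
  refine Nat.pow_le_pow_right (by norm_num) ?_
  have : 2 * (lev n / 2) ≤ lev n := Nat.mul_div_le _ _
  calc (lev n / 2) ^ 2 * 4 = (2 * (lev n / 2)) ^ 2 := by ring
    _ ≤ lev n ^ 2 := Nat.pow_le_pow_left this 2

theorem tendsto_top : Tendsto top atTop atTop := by
  have h1 : Tendsto (fun s : ℕ => (s / 2) ^ 2) atTop atTop := by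
    refine tendsto_atTop_mono (fun s => ?_) (Nat.tendsto_div_const_atTop (n := 2) (by norm_num))
    exact Nat.le_self_pow (by norm_num) _
  exact h1.comp tendsto_lev

end LatticeLCLT

/-! ### The neglected variance is of smaller order than n. -/

namespace LatticeLCLT

/-- The exponents of consecutive d's differ by s² - (s - 1)² = 2s - 1. -/
theorem d_mul_four_pow_le {k s : ℕ} (hks : k < s) : d k * 4 ^ s ≤ 2 * d s := by
  obtain ⟨m, rfl⟩ := Nat.exists_eq_add_of_le' (show 1 ≤ s by omega)
  calc d k * 4 ^ (m + 1) ≤ d m * 4 ^ (m + 1) := by gcongr; exact d_mono (by omega)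
    _ = 2 * d (m + 1) := by
      unfold d
      rw [show 4 = 2 ^ 2 by norm_num, ← pow_mul, ← pow_add, ← pow_succ']
      congr 1
      ring

theorem small_levels_le {s : ℕ} :
    8 * (d s * h s) + 8 * s * ∑ k ∈ Finset.Ico 2 s, d k * h k ≤
      d s * (8 * h s + 8 * ((s : ℝ) ^ 2 / 4 ^ s)) := by
  have h1 : ∑ k ∈ Finset.Ico 2 s, d k * h k ≤ s * (d s / 4 ^ s) := by
    refine (Finset.sum_le_card_nsmul _ _ ((d s : ℝ) / 4 ^ s) fun k hk => ?_).trans ?_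
    · have hk := Finset.mem_Ico.1 hk
      have i1 := h_le_half hk.1
      have i2 : (d k : ℝ) * 4 ^ s ≤ 2 * d s := by exact_mod_cast d_mul_four_pow_le hk.2
      rw [le_div_iff₀ (by positivity)]
      have i3 := (h_pos hk.1).le
      calc d k * h k * 4 ^ s = d k * 4 ^ s * h k := by ring
        _ ≤ 2 * d s * (1 / 2) := by gcongr
        _ = d s := by ring
    · rw [Nat.card_Ico, nsmul_eq_mul]
      gcongr
      exact_mod_cast Nat.sub_le s 2
  have h2 : 8 * (s : ℝ) * ∑ k ∈ Finset.Ico 2 s, d k * h k ≤ 8 * s * (s * (d s / 4 ^ s)) := by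
    gcongr
  calc _ ≤ 8 * (d s * h s) + 8 * s * (s * (d s / 4 ^ s)) := by linarith
    _ = _ := by ring

/-- Up to about log₂ n the bound 2n · h k ≤ 2n · h K is summed term by term. Beyond, where 2n ≤ 2^k,
the bound quadratic in n decays like 2^{-k}, and a geometric series remains. -/
theorem sum_levelVar_tail_le {n K : ℕ} (hK : 2 ≤ K) (M : ℕ) :
    ∑ k ∈ Finset.Ico K M, levelVar n k ≤ n * (2 * (Nat.log 2 n + 4) * h K) := by
  obtain ⟨L, hL⟩ : ∃ L, Nat.log 2 n = L := ⟨_, rfl⟩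
  have hn : 2 * n ≤ 2 ^ (L + 2) := by
    have := Nat.lt_pow_succ_log_self (b := 2) (by norm_num) n
    rw [hL] at this
    rw [pow_succ]
    omega
  have hn' : 2 * (n : ℝ) ≤ 2 ^ (L + 2) := by exact_mod_cast hn
  have hK0 := (h_pos hK).le
  set w : ℕ → ℝ := fun k => if k < L + 2 then 1 else 2 * n / 2 ^ k with hw
  have hw0 : ∀ k, 0 ≤ w k := fun k => by
    simp only [hw]
    split_ifs <;> positivity
  have h1 : ∀ k ∈ Finset.Ico K M, levelVar n k ≤ 2 * n * h K * w k := by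
    intro k hk
    have hk := Finset.mem_Ico.1 hk
    have i1 := h_anti hK hk.1
    simp only [hw]
    split_ifs with hlt
    · refine (levelVar_le_right n (by omega)).trans ?_
      rw [mul_one]
      gcongr
    · refine (levelVar_le_left n (by omega)).trans ?_
      have i2 : (2 : ℝ) ^ k ≤ 2 * p k := by exact_mod_cast two_pow_le_two_mul_p k
      have i3 : h k / p k ≤ h K / (2 ^ k / 2) := by
        gcongr
        linarith
      calc 2 * (n : ℝ) ^ 2 * (h k / p k) ≤ 2 * n ^ 2 * (h K / (2 ^ k / 2)) := by gcongr
        _ = _ := by field_simp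
  have h2 : ∑ k ∈ Finset.Ico K M, w k ≤ L + 4 := by
    calc ∑ k ∈ Finset.Ico K M, w k ≤ ∑ k ∈ Finset.range (L + 2 + M), w k :=
          Finset.sum_le_sum_of_subset_of_nonneg (fun k hk => by
            have hk := Finset.mem_Ico.1 hk
            rw [Finset.mem_range]
            omega) fun k _ _ => hw0 k
      _ = ∑ k ∈ Finset.range (L + 2), w k + ∑ i ∈ Finset.range M, w (L + 2 + i) :=
          Finset.sum_range_add _ _ _
      _ ≤ (L + 2) + 2 := by
          refine add_le_add (le_of_eq ?_) (le_trans ?_ (sum_geometric_two_le M))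
          · rw [Finset.sum_congr rfl (g := fun _ => (1 : ℝ)) fun k hk =>
              if_pos (Finset.mem_range.1 hk)]
            simp
          · refine Finset.sum_le_sum fun i _ => ?_
            simp only [hw]
            rw [if_neg (by omega), pow_add, one_div_pow, ← div_div]
            gcongr
            exact (div_le_one (by positivity)).2 hn'
      _ = _ := by ring
  calc ∑ k ∈ Finset.Ico K M, levelVar n k ≤ ∑ k ∈ Finset.Ico K M, 2 * n * h K * w k :=
        Finset.sum_le_sum h1
    _ = 2 * n * h K * ∑ k ∈ Finset.Ico K M, w k := by rw [Finset.mul_sum]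
    _ ≤ 2 * n * h K * (L + 4) := by gcongr
    _ = _ := by rw [hL]; ring

/-- The relative size of the part of the variance that is not accounted for by `mainCf`. -/
noncomputable def relErr (s : ℕ) : ℝ :=
  (8 * h s + 8 * ((s : ℝ) ^ 2 / 4 ^ s)) + 2 * (1 / 4 : ℝ) ^ ((s / 2) ^ 2) +
    2 * ((s + 1 : ℝ) ^ 2 + 3) * h ((s / 2) ^ 2)

theorem h_le_one_div {k : ℕ} (hk : 2 ≤ k) : h k ≤ 1 / k := by
  have h1 := one_le_logb hk
  have h3 : (2 : ℝ) ≤ k := by exact_mod_cast hk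
  unfold h
  gcongr
  nlinarith

/-- The delicate term is the last one: (s + 1)² is of the same order as (s/2)², so only the
logarithm in h makes the term tend to 0. -/
theorem tendsto_relErr : Tendsto relErr atTop (𝓝 0) := by
  have hr : Tendsto (fun s : ℕ => (s / 2) ^ 2) atTop atTop := by
    refine tendsto_atTop_mono (fun s => ?_) (Nat.tendsto_div_const_atTop (n := 2) (by norm_num))
    exact Nat.le_self_pow (by norm_num) _
  have h1 : Tendsto h atTop (𝓝 0) := by
    refine tendsto_of_tendsto_of_tendsto_of_le_of_le' tendsto_const_nhds
      tendsto_one_div_atTop_nhds_zero_nat ?_ ?_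
    · filter_upwards [eventually_ge_atTop 2] with k hk using (h_pos hk).le
    · filter_upwards [eventually_ge_atTop 2] with k hk using h_le_one_div hk
  have h2 : Tendsto (fun s : ℕ => (s : ℝ) ^ 2 / 4 ^ s) atTop (𝓝 0) :=
    tendsto_pow_const_div_const_pow_of_one_lt 2 (by norm_num)
  have h3 : Tendsto (fun s : ℕ => (1 / 4 : ℝ) ^ ((s / 2) ^ 2)) atTop (𝓝 0) :=
    (tendsto_pow_atTop_nhds_zero_of_lt_one (by norm_num) (by norm_num)).comp hr
  have h4 : Tendsto (fun s : ℕ => 2 * ((s + 1 : ℝ) ^ 2 + 3) * h ((s / 2) ^ 2)) atTop (𝓝 0) := by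
    have hl : Tendsto (fun s : ℕ => 40 / Real.logb 2 (((s / 2) ^ 2 : ℕ) : ℝ)) atTop (𝓝 0) :=
      Tendsto.const_div_atTop ((Real.tendsto_logb_atTop (by norm_num)).comp
        (tendsto_natCast_atTop_atTop.comp hr)) _
    refine tendsto_of_tendsto_of_tendsto_of_le_of_le' tendsto_const_nhds hl ?_ ?_
    · filter_upwards [hr.eventually_ge_atTop 2] with s hs
      have := h_pos hs
      positivity
    · filter_upwards [eventually_ge_atTop 4] with s hs
      obtain ⟨r, hrs⟩ : ∃ r, s / 2 = r := ⟨_, rfl⟩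
      have hr2 : 2 ≤ r := by omega
      rw [hrs]
      have i1 := one_le_logb (k := r ^ 2) (by nlinarith)
      have i2 : (s : ℝ) ≤ 2 * r + 1 := by exact_mod_cast (by omega : s ≤ 2 * r + 1)
      have i3 : (2 : ℝ) ≤ r := by exact_mod_cast hr2
      have i4 : ((s : ℝ) + 1) ^ 2 + 3 ≤ 20 * r ^ 2 := by
        have : (s : ℝ) + 1 ≤ 3 * r := by linarith
        have : ((s : ℝ) + 1) ^ 2 ≤ (3 * r) ^ 2 := by gcongr
        nlinarith
      have i5 : 0 ≤ h (r ^ 2) := (h_pos (by nlinarith)).le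
      calc 2 * (((s : ℝ) + 1) ^ 2 + 3) * h (r ^ 2) ≤ 2 * (20 * r ^ 2) * h (r ^ 2) := by gcongr
        _ = _ := by
          unfold h
          push_cast
          push_cast at i1
          field_simp
          norm_num
  have := (((h1.const_mul 8).add (h2.const_mul 8)).add (h3.const_mul 2)).add h4
  simp only [mul_zero, add_zero] at this
  exact this

theorem restVar_le {n M : ℕ} (hn : 1 ≤ n) (hs : 2 ≤ lev n) (hK : 2 ≤ top n) :
    restVar n (2 ^ top n) (lev n) (top n) M ≤ n * (2 * (1 / 4 : ℝ) ^ top n +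
      2 * ((lev n + 1 : ℝ) ^ 2 + 3) * h (top n)) := by
  have h1 := sum_levelVar_tail_le (n := n) hK M
  have h2 : (Nat.log 2 n : ℝ) + 1 ≤ ((lev n : ℝ) + 1) ^ 2 := by exact_mod_cast log_le_lev n
  have h3 := (h_pos hK).le
  have h4 : ∑ k ∈ Finset.Ico (lev n + 1) (top n), h k ≤ 2 ^ top n := by
    refine (Finset.sum_le_card_nsmul _ _ (1 : ℝ) fun k hk => ?_).trans ?_
    · exact (h_le_half (by have := Finset.mem_Ico.1 hk; omega)).trans (by norm_num)
    · rw [Nat.card_Ico, nsmul_eq_mul, mul_one]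
      exact_mod_cast (Nat.sub_le _ _).trans Nat.lt_two_pow_self.le
  have h5 : ((2 : ℝ) ^ top n) ^ 4 ≤ n := by exact_mod_cast two_pow_top_pow_four_le hn
  have h6 : ((2 : ℝ) ^ top n) ^ 2 * ((1 / 4 : ℝ) ^ top n) = 1 := by
    rw [← pow_mul, mul_comm (top n), pow_mul, ← mul_pow]
    norm_num
  unfold restVar
  rw [mul_add]
  refine add_le_add ?_ (h1.trans ?_)
  · push_cast
    -- With P = 2^top, the number of levels is crudely bounded by P, and P² = P⁴ · 4^{-top} is at
    -- most n · 4^{-top}.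
    calc 2 * (2 : ℝ) ^ top n * ∑ k ∈ Finset.Ico (lev n + 1) (top n), h k
        ≤ 2 * 2 ^ top n * 2 ^ top n := by gcongr
      _ = 2 * (2 ^ top n) ^ 2 * ((2 ^ top n) ^ 2 * (1 / 4 : ℝ) ^ top n) := by rw [h6]; ring
      _ = (2 ^ top n) ^ 4 * (2 * (1 / 4 : ℝ) ^ top n) := by ring
      _ ≤ _ := by gcongr
  · gcongr n * (2 * ?_ * _)
    linarith

/-- The levels that matter for the `n`-th Birkhoff sum. -/
def mainSet (n : ℕ) : Finset ℕ := Finset.Ico (lev n + 1) (top n)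

/-- The effective length of the levels in `mainSet n`. -/
def mainLen (n : ℕ) : ℕ := n - 2 ^ top n

section Levels

variable {X : Type*} [MeasurableSpace X] {μ : Measure X} [IsProbabilityMeasure μ] {T : X → X}
  {fbar : ℕ → X → ℤ} {f : X → ℤ}

/-- The preceding bounds with s = lev n, K = top n and P = 2^top n, where all error terms together
are at most n · relErr (lev n). -/
theorem IsCodingSequence.eventually_estimates (hc : IsCodingSequence T μ fbar)
    (hT : MeasurePreserving T μ μ) (hfm : Measurable f)
    (hf : ∀ᵐ x ∂μ, ∀ᶠ M in atTop, psum T fbar 1 M x = f x) :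
    ∃ ε : ℕ → ℝ, Tendsto ε atTop (𝓝 0) ∧ ∀ᶠ n in atTop, 
      |∫ x, ((birkhoffSum T f n x : ℤ) : ℝ) ^ 2 ∂μ - 2 * mainLen n * ∑ k ∈ mainSet n, h k| ≤
        n * ε n ∧
      ∀ θ, ‖cf μ (birkhoffSum T f n) θ‖ ≤ mainCf (mainSet n) (mainLen n) θ ∧
        ‖cf μ (birkhoffSum T f n) θ - mainCf (mainSet n) (mainLen n) θ‖ ≤
          |θ| * √(n * ε n) + θ ^ 2 / 2 * (n * ε n) := by
  refine ⟨fun n => relErr (lev n), tendsto_relErr.comp tendsto_lev, ?_⟩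
  filter_upwards [eventually_ge_atTop 1, tendsto_lev.eventually_ge_atTop 8] with n hn hs
  have hst : lev n + 1 ≤ top n := by
    unfold top
    nlinarith [Nat.div_add_mod (lev n) 2, Nat.mod_lt (lev n) two_pos]
  have hP : ∀ k < top n, p k ≤ 2 ^ top n := fun k hk => by
    rcases Nat.eq_zero_or_pos k with rfl | h0
    · simpa [p] using Nat.one_le_two_pow
    · exact (p_le_two_pow h0).trans (Nat.pow_le_pow_right (by norm_num) hk.le)
  have hPn : 2 ^ top n ≤ n :=
    (Nat.le_self_pow (by norm_num) _).trans (two_pow_top_pow_four_le hn)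
  have hds : (d (lev n) : ℝ) ≤ n := by exact_mod_cast d_lev_le hn
  have hh := (h_pos (k := lev n) (by omega)).le
  have hh' := (h_pos (k := top n) (by omega)).le
  set A := (n : ℝ) * (8 * h (lev n) + 8 * ((lev n : ℝ) ^ 2 / 4 ^ lev n)) with hA
  set B := (n : ℝ) * (2 * (1 / 4 : ℝ) ^ top n + 2 * ((lev n + 1 : ℝ) ^ 2 + 3) * h (top n)) with hB
  have hA0 : 0 ≤ A := by positivity
  have hB0 : 0 ≤ B := by positivity
  have hAB : n * relErr (lev n) = A + B := by
    rw [hA, hB, ← mul_add, relErr, top]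
    ring
  have H := hc.estimates_limit hT hfm hf (n := n) (P := 2 ^ top n) (s := lev n) (K := top n)
    (A := A) (B := B) (by omega) (lt_d_succ_lev n).le hst hP hPn
    ((hc.integral_psum_sq_le hT n (by omega)).trans (small_levels_le.trans (by
      rw [hA]
      gcongr)))
    fun M _ => restVar_le hn (by omega) (by omega)
  rw [hAB]
  refine ⟨?_, fun θ => ⟨(H.2 θ).1, (H.2 θ).2.trans ?_⟩⟩
  · rw [abs_le]
    have := H.1
    unfold mainLen mainSet
    constructor <;> linarith
  · gcongr <;> linarith

end Levels

theorem tendsto_mainLen_div : Tendsto (fun n : ℕ => (mainLen n : ℝ) / n) atTop (𝓝 1) := by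
  have h1 : Tendsto (fun n : ℕ => 1 - (1 / 2 : ℝ) ^ top n) atTop (𝓝 (1 - 0)) :=
    ((tendsto_pow_atTop_nhds_zero_of_lt_one (by norm_num) (by norm_num)).comp
      tendsto_top).const_sub 1
  rw [sub_zero] at h1
  refine tendsto_of_tendsto_of_tendsto_of_le_of_le' h1 tendsto_const_nhds ?_ ?_
  · filter_upwards [eventually_ge_atTop 1] with n hn
    have hn0 : (0 : ℝ) < n := by exact_mod_cast hn
    have h2 : ((2 : ℝ) ^ top n) ^ 4 ≤ n := by exact_mod_cast two_pow_top_pow_four_le hn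
    have hPn : 2 ^ top n ≤ n :=
      (Nat.le_self_pow (by norm_num) _).trans (two_pow_top_pow_four_le hn)
    have h3 : (1 : ℝ) ≤ 2 ^ top n := one_le_pow₀ (by norm_num)
    rw [le_div_iff₀ hn0, mainLen, Nat.cast_sub hPn, sub_mul, one_mul]
    push_cast
    refine sub_le_sub_left ?_ _
    rw [one_div_pow, one_div, inv_mul_eq_div, le_div_iff₀ (by positivity), ← sq]
    exact (pow_le_pow_right₀ h3 (by norm_num)).trans h2
  · refine Eventually.of_forall fun n => div_le_one_of_le₀ ?_ (Nat.cast_nonneg n)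
    exact_mod_cast Nat.sub_le _ _

theorem tendsto_sum_mainSet :
    Tendsto (fun n => ∑ k ∈ mainSet n, h k) atTop (𝓝 (Real.log 2 ^ 2)) :=
  tendsto_sum_h.comp tendsto_lev

end LatticeLCLT

/-! ### The main factor: pointwise limit and domination. -/

namespace LatticeLCLT

theorem mainCf_le_exp {I : Finset ℕ} (hI : ∀ k ∈ I, 2 ≤ k) (m : ℕ) (θ : ℝ) :
    mainCf I m θ ≤ Real.exp (-(2 * m * ∑ k ∈ I, α k ^ 2 * (1 - Real.cos (p k * θ)))) := by
  rw [Finset.mul_sum, ← Finset.sum_neg_distrib, Real.exp_sum]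
  refine Finset.prod_le_prod (fun k _ => by rw [pow_mul]; positivity) fun k hk => ?_
  have h1 : chf k (p k * θ) ≤ Real.exp (-(α k ^ 2 * (1 - Real.cos (p k * θ)))) := by
    have := Real.add_one_le_exp (-(α k ^ 2 * (1 - Real.cos (p k * θ))))
    unfold chf
    linarith
  refine (pow_le_pow_left₀ (chf_nonneg (hI k hk) _) h1 _).trans (le_of_eq ?_)
  rw [← Real.exp_nat_mul]
  push_cast
  ring_nf

theorem exp_neg_le_one_sub {y : ℝ} (h1 : y ≤ 1 / 2) :
    Real.exp (-(y + 2 * y ^ 2)) ≤ 1 - y := by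
  have h2 : 0 < 1 - y := by linarith
  rw [← Real.le_log_iff_exp_le h2]
  refine le_trans ?_ (Real.one_sub_inv_le_log_of_pos h2)
  have h3 : (1 - y)⁻¹ ≤ 1 + y + 2 * y ^ 2 := by
    rw [inv_le_iff_one_le_mul₀ h2]
    nlinarith [mul_nonneg (sq_nonneg y) (show 0 ≤ 1 - 2 * y by linarith)]
  linarith

theorem exp_le_mainCf {I : Finset ℕ} {δ : ℝ} (hδ : δ ≤ 1 / 2) (m : ℕ) (θ : ℝ)
    (hI : ∀ k ∈ I, α k ^ 2 * (1 - Real.cos (p k * θ)) ≤ δ) :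
    Real.exp (-(2 * m * ((1 + 2 * δ) * ∑ k ∈ I, α k ^ 2 * (1 - Real.cos (p k * θ))))) ≤
      mainCf I m θ := by
  rw [Finset.mul_sum, Finset.mul_sum, ← Finset.sum_neg_distrib, Real.exp_sum]
  refine Finset.prod_le_prod (fun k _ => (Real.exp_pos _).le) fun k hk => ?_
  have hy0 : 0 ≤ α k ^ 2 * (1 - Real.cos (p k * θ)) :=
    mul_nonneg (sq_nonneg _) (by linarith [Real.cos_le_one (p k * θ)])
  have hy1 := hI k hk
  unfold chf
  set y := α k ^ 2 * (1 - Real.cos (p k * θ))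
  have h1 : Real.exp (-((1 + 2 * δ) * y)) ≤ 1 - y := by
    refine le_trans (Real.exp_le_exp.2 ?_) (exp_neg_le_one_sub (hy1.trans hδ))
    nlinarith
  refine le_trans (le_of_eq ?_) (pow_le_pow_left₀ (Real.exp_pos _).le h1 _)
  rw [← Real.exp_nat_mul]
  push_cast
  ring_nf

theorem α_sq_mul_one_sub_cos_le {k : ℕ} (hk : 2 ≤ k) (θ : ℝ) :
    α k ^ 2 * (1 - Real.cos (p k * θ)) ≤ h k * (θ ^ 2 / 2) := by
  have h1 := one_sub_chf_le k (p k * θ)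
  unfold chf at h1
  rw [← p_sq_mul_α_sq hk]
  nlinarith

theorem le_α_sq_mul_one_sub_cos {k : ℕ} (hk : 2 ≤ k) {θ : ℝ} (hθ : |p k * θ| ≤ 1) :
    h k * (θ ^ 2 / 2) * (1 - (p k * θ) ^ 2) ≤ α k ^ 2 * (1 - Real.cos (p k * θ)) := by
  have h1 := (abs_le.1 (Real.cos_bound hθ)).2
  rw [pow_abs, abs_of_nonneg (by positivity)] at h1
  rw [← p_sq_mul_α_sq hk]
  set u := p k * θ with hu
  have h2 : u ^ 2 / 2 * (1 - u ^ 2) ≤ 1 - Real.cos u := by nlinarith [sq_nonneg (u ^ 2)]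
  calc _ = α k ^ 2 * (u ^ 2 / 2 * (1 - u ^ 2)) := by rw [hu]; ring
    _ ≤ _ := mul_le_mul_of_nonneg_left h2 (sq_nonneg _)

theorem le_α_sq_mul_one_sub_cos' {k : ℕ} (hk : 2 ≤ k) {θ : ℝ} (hθ : |p k * θ| ≤ Real.pi) :
    h k * (2 / Real.pi ^ 2 * θ ^ 2) ≤ α k ^ 2 * (1 - Real.cos (p k * θ)) := by
  have h1 := Real.cos_le_one_sub_mul_cos_sq hθ
  rw [← p_sq_mul_α_sq hk]
  calc _ = α k ^ 2 * (2 / Real.pi ^ 2 * (p k * θ) ^ 2) := by ring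
    _ ≤ _ := mul_le_mul_of_nonneg_left (by linarith) (sq_nonneg _)

theorem two_le_of_mem_mainSet {n k : ℕ} (hs : 1 ≤ lev n) (hk : k ∈ mainSet n) : 2 ≤ k := by
  have := Finset.mem_Ico.1 hk
  omega

theorem p_le_of_mem_mainSet {n k : ℕ} (hk : k ∈ mainSet n) : p k ≤ 2 ^ top n := by
  have := Finset.mem_Ico.1 hk
  exact (p_le_two_pow (by omega)).trans (Nat.pow_le_pow_right (by norm_num) this.2.le)

theorem p_pow_four_le {n k : ℕ} (hn : 1 ≤ n) (hk : k ∈ mainSet n) : (p k : ℝ) ^ 4 ≤ n := by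
  exact_mod_cast (Nat.pow_le_pow_left (p_le_of_mem_mainSet hk) 4).trans
    (two_pow_top_pow_four_le hn)

theorem p_mul_sq_le {n k : ℕ} (hn : 1 ≤ n) (hk : k ∈ mainSet n) (t : ℝ) :
    (p k * (t / √n)) ^ 2 ≤ t ^ 2 / √n := by
  have hn0 : (0 : ℝ) < √n := Real.sqrt_pos.2 (by exact_mod_cast hn)
  have h1 : (p k : ℝ) ^ 2 ≤ √n := Real.le_sqrt_of_sq_le (by
    rw [← pow_mul]
    exact p_pow_four_le hn hk)
  calc (p k * (t / √n)) ^ 2 = (p k) ^ 2 * t ^ 2 / √n ^ 2 := by ring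
    _ ≤ √n * t ^ 2 / √n ^ 2 := by gcongr
    _ = _ := by field_simp

/-- On the main levels (p k · t/√n)² ≤ t²/√n, so the second-order expansion of cos is uniform in k.
The exponent is then (mainLen n / n) · ∑ h k · t² up to a factor tending to 1, and the first two
factors tend to 1 and (ln 2)². -/
theorem tendsto_mainCf (t : ℝ) :
    Tendsto (fun n => mainCf (mainSet n) (mainLen n) (t / √n)) atTop
      (𝓝 (Real.exp (-(Real.log 2 ^ 2 * t ^ 2)))) := by
  have hsqrt : Tendsto (fun n : ℕ => √(n : ℝ)) atTop atTop :=
    Real.tendsto_sqrt_atTop.comp tendsto_natCast_atTop_atTop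
  have hδ : Tendsto (fun n : ℕ => t ^ 2 / √(n : ℝ)) atTop (𝓝 0) := hsqrt.const_div_atTop _
  have hδ' : Tendsto (fun n : ℕ => t ^ 2 / (n : ℝ)) atTop (𝓝 0) :=
    tendsto_natCast_atTop_atTop.const_div_atTop _
  have hmain := tendsto_mainLen_div.mul (tendsto_sum_mainSet.mul_const (t ^ 2))
  rw [one_mul] at hmain
  have hup : Tendsto (fun n : ℕ => Real.exp (-((mainLen n : ℝ) / n *
      ((∑ k ∈ mainSet n, h k) * t ^ 2) * (1 - t ^ 2 / √(n : ℝ))))) atTop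
      (𝓝 (Real.exp (-(Real.log 2 ^ 2 * t ^ 2)))) := by
    refine (Real.continuous_exp.tendsto _).comp ?_
    simpa using (hmain.mul (hδ.const_sub 1)).neg
  have hlo : Tendsto (fun n : ℕ => Real.exp (-((mainLen n : ℝ) / n *
      ((∑ k ∈ mainSet n, h k) * t ^ 2) * (1 + 2 * (t ^ 2 / n))))) atTop
      (𝓝 (Real.exp (-(Real.log 2 ^ 2 * t ^ 2)))) := by
    refine (Real.continuous_exp.tendsto _).comp ?_
    simpa using (hmain.mul ((hδ'.const_mul 2).const_add 1)).neg
  refine tendsto_of_tendsto_of_tendsto_of_le_of_le' hlo hup ?_ ?_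
  · filter_upwards [eventually_ge_atTop 1, tendsto_lev.eventually_ge_atTop 1,
      hδ'.eventually_le_const (show (0 : ℝ) < 1 / 2 by norm_num)] with n hn hs hsmall
    have hn0 : (0 : ℝ) < n := by exact_mod_cast hn
    have hsq : √(n : ℝ) ^ 2 = n := Real.sq_sqrt hn0.le
    refine le_trans (Real.exp_le_exp.2 (neg_le_neg ?_)) (exp_le_mainCf hsmall _ _ fun k hk => ?_)
    · have h1 : ∑ k ∈ mainSet n, α k ^ 2 * (1 - Real.cos (p k * (t / √n))) ≤
          (∑ k ∈ mainSet n, h k) * ((t / √n) ^ 2 / 2) := by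
        rw [Finset.sum_mul]
        exact Finset.sum_le_sum fun k hk =>
          α_sq_mul_one_sub_cos_le (two_le_of_mem_mainSet hs hk) _
      calc _ ≤ 2 * (mainLen n : ℝ) * ((1 + 2 * (t ^ 2 / n)) *
            ((∑ k ∈ mainSet n, h k) * ((t / √n) ^ 2 / 2))) := by gcongr
        _ = _ := by rw [div_pow, hsq]; field_simp
    · have h2 := h_le_half (two_le_of_mem_mainSet hs hk)
      refine (α_sq_mul_one_sub_cos_le (two_le_of_mem_mainSet hs hk) _).trans ?_
      rw [div_pow, hsq]
      have : 0 ≤ t ^ 2 / (n : ℝ) := by positivity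
      nlinarith
  · filter_upwards [eventually_ge_atTop 1, tendsto_lev.eventually_ge_atTop 1,
      hδ.eventually_le_const (show (0 : ℝ) < 1 by norm_num)] with n hn hs hsmall
    have hn0 : (0 : ℝ) < n := by exact_mod_cast hn
    have hsq : √(n : ℝ) ^ 2 = n := Real.sq_sqrt hn0.le
    refine (mainCf_le_exp (fun k hk => two_le_of_mem_mainSet hs hk) _ _).trans
      (Real.exp_le_exp.2 (neg_le_neg ?_))
    have h1 : (∑ k ∈ mainSet n, h k) * ((t / √n) ^ 2 / 2 * (1 - t ^ 2 / √n)) ≤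
        ∑ k ∈ mainSet n, α k ^ 2 * (1 - Real.cos (p k * (t / √n))) := by
      rw [Finset.sum_mul]
      refine Finset.sum_le_sum fun k hk => ?_
      have hk2 := two_le_of_mem_mainSet hs hk
      have hu := p_mul_sq_le hn hk t
      refine le_trans ?_ (le_α_sq_mul_one_sub_cos hk2
        (abs_le_one_iff_mul_self_le_one.2 (by nlinarith)))
      have := (h_pos hk2).le
      rw [mul_assoc]
      gcongr
    calc _ = 2 * (mainLen n : ℝ) *
          ((∑ k ∈ mainSet n, h k) * ((t / √n) ^ 2 / 2 * (1 - t ^ 2 / √n))) := by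
            rw [div_pow, hsq]; field_simp
      _ ≤ _ := by gcongr

theorem eventually_mainSet_large :
    ∀ᶠ n in atTop, (1 / 2 : ℝ) ≤ mainLen n / n ∧ Real.log 2 ^ 2 / 2 ≤ ∑ k ∈ mainSet n, h k := by
  have hl : 0 < Real.log 2 ^ 2 := pow_pos (Real.log_pos (by norm_num)) 2
  filter_upwards [tendsto_mainLen_div.eventually_const_le (show (1 / 2 : ℝ) < 1 by norm_num),
    tendsto_sum_mainSet.eventually_const_le (show Real.log 2 ^ 2 / 2 < Real.log 2 ^ 2 by linarith)]
    with n h1 h2 using ⟨h1, h2⟩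

/-- Domination of `mainCf` by a Gaussian near the origin. -/
theorem eventually_mainCf_le_gaussian :
    ∀ᶠ n : ℕ in atTop, ∀ t : ℝ, t ^ 4 ≤ n →
      mainCf (mainSet n) (mainLen n) (t / √n) ≤ Real.exp (-((Real.log 2 / Real.pi) ^ 2 * t ^ 2)) := by
  filter_upwards [eventually_ge_atTop 1, tendsto_lev.eventually_ge_atTop 1,
    eventually_mainSet_large] with n hn hs ⟨hm, hσ⟩ t ht
  have hn0 : (0 : ℝ) < n := by exact_mod_cast hn
  have hsq : √(n : ℝ) ^ 2 = n := Real.sq_sqrt hn0.le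
  refine (mainCf_le_exp (fun k hk => two_le_of_mem_mainSet hs hk) _ _).trans
    (Real.exp_le_exp.2 (neg_le_neg ?_))
  have h1 : (∑ k ∈ mainSet n, h k) * (2 / Real.pi ^ 2 * (t / √n) ^ 2) ≤
      ∑ k ∈ mainSet n, α k ^ 2 * (1 - Real.cos (p k * (t / √n))) := by
    rw [Finset.sum_mul]
    refine Finset.sum_le_sum fun k hk => ?_
    refine le_α_sq_mul_one_sub_cos' (two_le_of_mem_mainSet hs hk) ?_
    have hu := p_mul_sq_le hn hk t
    -- The restriction t⁴ ≤ n keeps |p k · t/√n| at most 1, well inside [-π, π], where 1 - cos has a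
    -- quadratic lower bound.
    have : t ^ 2 / √n ≤ 1 := by
      rw [div_le_one (Real.sqrt_pos.2 hn0)]
      exact Real.le_sqrt_of_sq_le (by rw [← pow_mul]; exact ht)
    exact (abs_le_one_iff_mul_self_le_one.2 (by nlinarith)).trans (by linarith [Real.pi_gt_three])
  calc (Real.log 2 / Real.pi) ^ 2 * t ^ 2
      = 2 * ((1 / 2) * (Real.log 2 ^ 2 / 2 * (2 / Real.pi ^ 2 * t ^ 2))) := by ring
    _ ≤ 2 * (mainLen n / n * ((∑ k ∈ mainSet n, h k) * (2 / Real.pi ^ 2 * t ^ 2))) := by gcongr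
    _ = 2 * mainLen n * ((∑ k ∈ mainSet n, h k) * (2 / Real.pi ^ 2 * (t / √n) ^ 2)) := by
      rw [div_pow, hsq]; field_simp
    _ ≤ _ := by gcongr

/-- This is |e^{ib} - e^{ia}|² ≤ 2|e^{ia} - 1|² + 2|e^{ib} - 1|², since |e^{iu} - 1|² = 2(1 - cos
u). -/
theorem one_sub_cos_sub_le (a b : ℝ) :
    1 - Real.cos (b - a) ≤ 2 * ((1 - Real.cos a) + (1 - Real.cos b)) := by
  have ha := Real.cos_sq_add_sin_sq a
  have hb := Real.cos_sq_add_sin_sq b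
  rw [Real.cos_sub]
  nlinarith [sq_nonneg (Real.cos a + Real.cos b - 2), sq_nonneg (Real.sin a + Real.sin b),
    sq_nonneg (Real.cos a - Real.cos b)]

/-- The reason for the odd-index rule in p: with powers of two alone, every factor of `mainCf` would
equal 1 at θ = π and the local theorem on ℤ would fail. A difference of 1 transfers the size of θ
itself to one of two adjacent levels. -/
theorem p_succ_of_even {k : ℕ} (hk : Even k) : p (k + 1) = p k + 1 := by
  unfold p
  rw [if_pos hk, if_neg (by rw [Nat.not_even_iff_odd]; exact hk.add_one), Nat.add_sub_cancel]

/-- A factor 4^k is lost for h and another for p². This suffices, because the levels used have index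
at most lev n + 3, while n ≥ 2^{(lev n)²}. -/
theorem le_α_sq {k : ℕ} (hk : 2 ≤ k) : (1 / 16 : ℝ) ^ k ≤ α k ^ 2 := by
  have h1 : (p k : ℝ) ≤ 2 ^ k := by exact_mod_cast p_le_two_pow (k := k) (by omega)
  have h2 : (0 : ℝ) < p k := by exact_mod_cast p_pos k
  have h3 : Real.logb 2 k ≤ 2 ^ k := by
    rw [Real.logb_le_iff_le_rpow (by norm_num) (by positivity)]
    have h4 : k ≤ 2 ^ 2 ^ k := Nat.lt_two_pow_self.le.trans
      (Nat.pow_le_pow_right (by norm_num) Nat.lt_two_pow_self.le)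
    have h5 : (2 : ℝ) ^ ((2 : ℝ) ^ k) = 2 ^ 2 ^ k := by
      rw [← Real.rpow_natCast 2 (2 ^ k)]
      push_cast
      rfl
    rw [h5]
    exact_mod_cast h4
  have h4 := one_le_logb hk
  have h5 : (k : ℝ) ≤ 2 ^ k := by exact_mod_cast Nat.lt_two_pow_self.le
  have h6 : (1 / 4 : ℝ) ^ k ≤ h k := by
    unfold h
    rw [one_div_pow]
    have h0 : (0 : ℝ) < k := by positivity
    gcongr
    calc (k : ℝ) * Real.logb 2 k ≤ 2 ^ k * 2 ^ k := by gcongr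
      _ = 4 ^ k := by rw [← mul_pow]; norm_num
  have h8 := (h_pos hk).le
  have h7 : α k ^ 2 = h k / p k ^ 2 := by rw [← p_sq_mul_α_sq hk]; field_simp
  rw [h7]
  calc (1 / 16 : ℝ) ^ k = (1 / 4 : ℝ) ^ k / ((2 : ℝ) ^ k) ^ 2 := by
        rw [← pow_mul, mul_comm, pow_mul, ← div_pow]; norm_num
    _ ≤ _ := by gcongr

/-- Domination of `mainCf` away from the origin, from two levels whose `p`'s differ by one. -/
theorem eventually_mainCf_le_of_abs_le :
    ∀ᶠ n : ℕ in atTop, ∀ t : ℝ, |t| ≤ Real.pi * √n → mainCf (mainSet n) (mainLen n) (t / √n) ≤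
      Real.exp (-((1 / 16 : ℝ) ^ (lev n + 3) * (t ^ 2 / Real.pi ^ 2))) := by
  filter_upwards [eventually_ge_atTop 1, tendsto_lev.eventually_ge_atTop 8,
    eventually_mainSet_large] with n hn hs ⟨hm, _⟩ t ht
  have hn0 : (0 : ℝ) < n := by exact_mod_cast hn
  have hsq0 : 0 < √(n : ℝ) := Real.sqrt_pos.2 hn0
  have hsq : √(n : ℝ) ^ 2 = n := Real.sq_sqrt hn0.le
  have hst : lev n + 3 < top n := by
    unfold top
    nlinarith [Nat.div_add_mod (lev n) 2, Nat.mod_lt (lev n) two_pos]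
  -- One of the first two main levels has even index; its successor has index at most lev n + 3,
  -- whence the exponent in the bound.
  obtain ⟨κ, hκe, hκ1, hκ2⟩ : ∃ κ, Even κ ∧ lev n + 1 ≤ κ ∧ κ ≤ lev n + 2 := by
    rcases Nat.even_or_odd (lev n) with he | ho
    · exact ⟨lev n + 2, he.add even_two, by omega, le_rfl⟩
    · exact ⟨lev n + 1, ho.add_one, le_rfl, by omega⟩
  refine (mainCf_le_exp (fun k hk => two_le_of_mem_mainSet (by omega) hk) _ _).trans
    (Real.exp_le_exp.2 (neg_le_neg ?_))
  set θ := t / √(n : ℝ) with hθ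
  set β := (1 / 16 : ℝ) ^ (lev n + 3) with hβ
  have hβα : ∀ k, 2 ≤ k → k ≤ lev n + 3 → β ≤ α k ^ 2 := fun k hk hk' =>
    (pow_le_pow_of_le_one (by norm_num) (by norm_num) hk').trans (le_α_sq hk)
  have hc : ∀ u : ℝ, 0 ≤ 1 - Real.cos u := fun u => by linarith [Real.cos_le_one u]
  have h1 : β * ((1 - Real.cos (p κ * θ)) + (1 - Real.cos (p (κ + 1) * θ))) ≤
      ∑ k ∈ mainSet n, α k ^ 2 * (1 - Real.cos (p k * θ)) := by
    have hsub : ({κ, κ + 1} : Finset ℕ) ⊆ mainSet n := by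
      intro k hk
      simp only [Finset.mem_insert, Finset.mem_singleton] at hk
      rw [mainSet, Finset.mem_Ico]
      omega
    refine le_trans ?_ (Finset.sum_le_sum_of_subset_of_nonneg hsub fun k _ _ =>
      mul_nonneg (sq_nonneg _) (hc _))
    rw [Finset.sum_pair (by omega), mul_add]
    exact add_le_add (mul_le_mul_of_nonneg_right (hβα _ (by omega) (by omega)) (hc _))
      (mul_le_mul_of_nonneg_right (hβα _ (by omega) (by omega)) (hc _))
  have h2 := one_sub_cos_sub_le (p κ * θ) (p (κ + 1) * θ)
  rw [p_succ_of_even hκe, show ((p κ + 1 : ℕ) : ℝ) * θ - p κ * θ = θ by push_cast; ring,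
    ← p_succ_of_even hκe] at h2
  have h3 : |θ| ≤ Real.pi := by
    rw [hθ, abs_div, abs_of_pos hsq0, div_le_iff₀ hsq0]
    exact ht
  have h4 := Real.cos_le_one_sub_mul_cos_sq h3
  have hβ0 : 0 ≤ β := by positivity
  calc β * (t ^ 2 / Real.pi ^ 2) = 2 * ((1 / 2) * (β * (1 / 2 * (2 / Real.pi ^ 2 * t ^ 2)))) := by ring
    _ ≤ 2 * (mainLen n / n * (β * (1 / 2 * (2 / Real.pi ^ 2 * t ^ 2)))) := by gcongr
    _ = 2 * mainLen n * (β * (1 / 2 * (2 / Real.pi ^ 2 * θ ^ 2))) := by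
      rw [hθ, div_pow, hsq]; field_simp
    _ ≤ 2 * mainLen n * (β * ((1 - Real.cos (p κ * θ)) + (1 - Real.cos (p (κ + 1) * θ)))) := by
      gcongr
      linarith
    _ ≤ _ := by gcongr

theorem eventually_mainCf_le :
    ∀ᶠ n : ℕ in atTop, ∀ t : ℝ, |t| ≤ Real.pi * √n → mainCf (mainSet n) (mainLen n) (t / √n) ≤
      Real.exp (-((Real.log 2 / Real.pi) ^ 2 * t ^ 2)) + 4 * (1 + t ^ 2)⁻¹ := by
  filter_upwards [eventually_ge_atTop 1, tendsto_lev.eventually_ge_atTop 20,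
    eventually_mainCf_le_gaussian, eventually_mainCf_le_of_abs_le] with n hn hs H1 H2 t ht
  have hpos : 0 ≤ 4 * (1 + t ^ 2)⁻¹ := by positivity
  rcases le_total (t ^ 4) n with h | hlarge
  · exact (H1 t h).trans (le_add_of_nonneg_right hpos)
  · refine (H2 t ht).trans (le_trans ?_ (le_add_of_nonneg_left (Real.exp_pos _).le))
    set β := (1 / 16 : ℝ) ^ (lev n + 3) with hβ
    have hβ0 : 0 < β := by positivity
    have h1 : (1 : ℝ) ≤ n := by exact_mod_cast hn
    have ht1 : 1 ≤ t ^ 2 := by nlinarith [sq_nonneg t]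
    have hpi : Real.pi ^ 4 ≤ 4 ^ 4 := by
      gcongr
      exact Real.pi_le_four
    -- From t⁴ ≥ n ≥ 2^{(lev n)²}: squared, the left side is at most 2^{16 + 16(lev n + 3)}, and
    -- this exponent is below (lev n)² once lev n ≥ 20. It gives x² ≥ t² for x = βt²/π², so e^{-x} ≤
    -- 2/x² ≤ 2/t².
    have h2 : Real.pi ^ 4 / β ^ 2 ≤ t ^ 2 := by
      refine le_of_sq_le_sq ?_ (sq_nonneg t)
      refine le_trans ?_ (hlarge.trans (le_of_eq (show t ^ 4 = (t ^ 2) ^ 2 by ring)))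
      have h3 : (2 : ℝ) ^ (lev n ^ 2) ≤ n := by exact_mod_cast d_lev_le hn
      refine le_trans ?_ h3
      calc (Real.pi ^ 4 / β ^ 2) ^ 2 ≤ (4 ^ 4 / β ^ 2) ^ 2 := by gcongr
        _ = 2 ^ (16 + 16 * (lev n + 3)) := by
          rw [hβ, one_div_pow, show (16 : ℝ) = 2 ^ 4 by norm_num, ← pow_mul, pow_add]
          rw [show (2 : ℝ) ^ (16 * (lev n + 3)) = (2 ^ (4 * (lev n + 3))) ^ 4 by
            rw [← pow_mul]; congr 1; ring]
          field_simp
          norm_num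
        _ ≤ 2 ^ (lev n ^ 2) := pow_le_pow_right₀ (by norm_num) (by nlinarith)
    set x := β * (t ^ 2 / Real.pi ^ 2) with hx
    have hx0 : 0 < x := by positivity
    have h4 : Real.exp (-x) ≤ 2 / x ^ 2 := by
      rw [Real.exp_neg, inv_eq_one_div, div_le_div_iff₀ (Real.exp_pos _) (by positivity)]
      have := Real.quadratic_le_exp_of_nonneg hx0.le
      linarith
    have h5 : 2 / x ^ 2 ≤ 2 / t ^ 2 := by
      refine div_le_div_of_nonneg_left (by norm_num) (by positivity) ?_
      rw [div_le_iff₀ (by positivity)] at h2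
      rw [hx, mul_pow, div_pow, ← mul_div_assoc, le_div_iff₀ (by positivity)]
      nlinarith
    refine h4.trans (h5.trans ?_)
    rw [← div_eq_mul_inv, div_le_div_iff₀ (by positivity) (by positivity)]
    linarith

end LatticeLCLT

/-! ### Fourier inversion and the local limit theorem. -/

namespace LatticeLCLT

theorem integral_exp_int_mul (a : ℤ) :
    ∫ θ in -Real.pi..Real.pi, Complex.exp (((θ * a : ℝ) : ℂ) * Complex.I) =
      if a = 0 then 2 * (Real.pi : ℂ) else 0 := by
  split_ifs with ha
  · subst ha
    simp only [Int.cast_zero, mul_zero, Complex.ofReal_zero, zero_mul, Complex.exp_zero,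
      intervalIntegral.integral_const, Complex.real_smul, mul_one]
    push_cast
    ring
  · have hc : (a : ℂ) * Complex.I ≠ 0 := mul_ne_zero (by exact_mod_cast ha) Complex.I_ne_zero
    have e : ∀ θ : ℝ, Complex.exp (((θ * a : ℝ) : ℂ) * Complex.I) =
        Complex.exp (a * Complex.I * θ) := fun θ => by
      push_cast
      ring_nf
    simp only [e]
    rw [integral_exp_mul_complex hc, div_eq_zero_iff]
    left
    rw [sub_eq_zero, Complex.exp_eq_exp_iff_exists_int]
    exact ⟨a, by push_cast; ring⟩

section Fourier

variable {X : Type*} [MeasurableSpace X] {μ : Measure X} [IsProbabilityMeasure μ]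

theorem continuous_cf {V : X → ℤ} (hV : Measurable V) : Continuous (cf μ V) := by
  refine continuous_of_dominated (bound := fun _ => 1) (fun θ => ?_)
    (fun θ => ae_of_all _ fun x => by rw [Complex.norm_exp_ofReal_mul_I]) (integrable_const _)
    (ae_of_all _ fun x => by fun_prop)
  exact ((measurable_of_countable fun a : ℤ =>
    Complex.exp (((θ * a : ℝ) : ℂ) * Complex.I)).comp hV).aestronglyMeasurable

/-- Fourier inversion on `ℤ`. -/
theorem integral_cf_mul_exp {V : X → ℤ} (hV : Measurable V) (x : ℤ) :
    ∫ θ in -Real.pi..Real.pi, cf μ V θ * Complex.exp (((-(θ * x) : ℝ) : ℂ) * Complex.I) =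
      2 * Real.pi * μ.real {ω | V ω = x} := by
  have e : ∀ θ : ℝ, cf μ V θ * Complex.exp (((-(θ * x) : ℝ) : ℂ) * Complex.I) =
      ∫ ω, Complex.exp (((θ * (V ω - x : ℤ) : ℝ) : ℂ) * Complex.I) ∂μ := by
    intro θ
    unfold cf
    rw [← integral_mul_const]
    congr 1
    ext ω
    rw [← Complex.exp_add]
    push_cast
    ring_nf
  simp only [e]
  rw [intervalIntegral_integral_swap]
  · simp only [integral_exp_int_mul, sub_eq_zero]
    have : (fun ω => if V ω = x then 2 * (Real.pi : ℂ) else 0) =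
        {ω | V ω = x}.indicator fun _ => 2 * (Real.pi : ℂ) := by
      ext ω
      simp [Set.indicator_apply]
    have hx : MeasurableSet {ω | V ω = x} := hV (measurableSet_singleton x)
    rw [this, integral_indicator hx, setIntegral_const,
      Complex.real_smul, mul_comm]
  · have : IsFiniteMeasure (volume.restrict (Set.uIoc (-Real.pi) Real.pi)) := by
      rw [Set.uIoc]; infer_instance
    refine Integrable.of_bound ?_ 1 (ae_of_all _ fun q => by
      simp only [Function.uncurry]
      rw [Complex.norm_exp_ofReal_mul_I])
    have hm : Measurable fun q : ℝ × X => ((V q.2 - x : ℤ) : ℝ) :=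
      (measurable_of_countable fun a : ℤ => ((a - x : ℤ) : ℝ)).comp (hV.comp measurable_snd)
    have : Measurable fun q : ℝ × X =>
        Complex.exp (((q.1 * (V q.2 - x : ℤ) : ℝ) : ℂ) * Complex.I) :=
      (Complex.measurable_ofReal.comp (measurable_fst.mul hm)).mul_const _ |>.cexp
    exact this.aestronglyMeasurable

/-- Inversion after the substitution θ = t/√n. The indicator makes all integrals run over the same
line, as dominated convergence requires. -/
theorem sqrt_mul_measureReal_eq {V : X → ℤ} (hV : Measurable V) (x : ℤ) {n : ℕ} (hn : 1 ≤ n) :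
    ((√(n : ℝ) * μ.real {ω | V ω = x} : ℝ) : ℂ) = (2 * Real.pi : ℂ)⁻¹ *
      ∫ t, (Set.Ioc (-(Real.pi * √n)) (Real.pi * √n)).indicator (fun t => cf μ V (t / √n)) t *
        Complex.exp (((-(t / √n * x) : ℝ) : ℂ) * Complex.I) := by
  have hn0 : (0 : ℝ) < √n := Real.sqrt_pos.2 (by exact_mod_cast hn)
  have hpi : (2 * Real.pi : ℂ) ≠ 0 := by
    exact_mod_cast (by positivity : (2 * Real.pi : ℝ) ≠ 0)
  have h1 := intervalIntegral.integral_comp_div (a := -(Real.pi * √n)) (b := Real.pi * √n)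
    (fun θ : ℝ => cf μ V θ * Complex.exp (((-(θ * x) : ℝ) : ℂ) * Complex.I)) hn0.ne'
  rw [neg_div, mul_div_assoc, div_self hn0.ne', mul_one, integral_cf_mul_exp hV,
    intervalIntegral.integral_of_le (by linarith [mul_pos Real.pi_pos hn0]),
    ← integral_indicator measurableSet_Ioc] at h1
  have e : ∀ t, (Set.Ioc (-(Real.pi * √n)) (Real.pi * √n)).indicator (fun t => cf μ V (t / √n)) t *
      Complex.exp (((-(t / √n * x) : ℝ) : ℂ) * Complex.I) =
      (Set.Ioc (-(Real.pi * √n)) (Real.pi * √n)).indicator (fun t => cf μ V (t / √n) *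
        Complex.exp (((-(t / √n * x) : ℝ) : ℂ) * Complex.I)) t := fun t => by
    rw [Set.indicator_mul_left]
  simp only [e]
  rw [h1, Complex.real_smul]
  push_cast
  field_simp

-- exp(-τt²) is the characteristic function of the centred normal law of variance 2τ, which is why
-- 2τ takes the place of σ².
omit [IsProbabilityMeasure μ] in
theorem gaussian_eq {τ : ℝ} (hτ : 0 < τ) (x : ℤ) {n : ℕ} (hn : 1 ≤ n) :
    ((Real.exp (-(x : ℝ) ^ 2 / (2 * (n : ℝ) * (2 * τ))) / √(2 * Real.pi * (2 * τ)) : ℝ) : ℂ) =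
      (2 * Real.pi : ℂ)⁻¹ * ∫ t : ℝ, ((Real.exp (-(τ * t ^ 2)) : ℝ) : ℂ) *
        Complex.exp (((-(t / √n * x) : ℝ) : ℂ) * Complex.I) := by
  have hn1 : (0 : ℝ) < n := by exact_mod_cast hn
  have hn0 : (0 : ℝ) < √n := Real.sqrt_pos.2 hn1
  have hsq : √(n : ℝ) ^ 2 = n := Real.sq_sqrt hn1.le
  have h1 := fourierIntegral_gaussian (b := (τ : ℂ)) (by simpa using hτ) ((-(x / √n) : ℝ) : ℂ)
  have e : ∀ t : ℝ, ((Real.exp (-(τ * t ^ 2)) : ℝ) : ℂ) *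
      Complex.exp (((-(t / √n * x) : ℝ) : ℂ) * Complex.I) =
      Complex.exp (Complex.I * ((-(x / √n) : ℝ) : ℂ) * t) * Complex.exp (-(τ : ℂ) * t ^ 2) := by
    intro t
    rw [Complex.ofReal_exp, ← Complex.exp_add, ← Complex.exp_add]
    push_cast
    ring_nf
  simp only [e]
  rw [h1]
  have h2 : ((Real.pi : ℂ) / τ) ^ (1 / 2 : ℂ) = ((√(Real.pi / τ) : ℝ) : ℂ) := by
    rw [Real.sqrt_eq_rpow, Complex.ofReal_cpow (by positivity)]
    push_cast
    rfl
  have h3 : Complex.exp (-((-(x / √n) : ℝ) : ℂ) ^ 2 / (4 * τ)) =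
      ((Real.exp (-(x : ℝ) ^ 2 / (2 * (n : ℝ) * (2 * τ))) : ℝ) : ℂ) := by
    rw [Complex.ofReal_exp]
    congr 1
    rw [← Complex.ofReal_pow, neg_sq, div_pow, hsq]
    push_cast
    field_simp
    norm_num
  rw [h2, h3]
  have h4 : 1 / √(2 * Real.pi * (2 * τ)) = (2 * Real.pi)⁻¹ * √(Real.pi / τ) := by
    rw [show 2 * Real.pi * (2 * τ) = (2 * Real.pi) ^ 2 / (Real.pi / τ) by
      field_simp, Real.sqrt_div (by positivity), Real.sqrt_sq (by positivity), one_div_div]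
    field_simp
  rw [div_eq_mul_one_div, h4]
  push_cast
  ring

/-- A criterion for the lattice local central limit theorem in terms of characteristic functions. -/
theorem tendsto_iSup_of_cf {V : ℕ → X → ℤ} (hV : ∀ n, Measurable (V n)) {τ : ℝ} (hτ : 0 < τ)
    {g : ℝ → ℝ} (hg : Integrable g)
    (hdom : ∀ᶠ n : ℕ in atTop, ∀ t : ℝ, |t| ≤ Real.pi * √n → ‖cf μ (V n) (t / √n)‖ ≤ g t)
    (hg0 : ∀ t, 0 ≤ g t)
    (hlim : ∀ t : ℝ, Tendsto (fun n : ℕ => cf μ (V n) (t / √n)) atTop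
      (𝓝 ((Real.exp (-(τ * t ^ 2)) : ℝ) : ℂ))) :
    Tendsto (fun n : ℕ => ⨆ x : ℤ, |√(n : ℝ) * μ.real {ω | V n ω = x} -
      Real.exp (-(x : ℝ) ^ 2 / (2 * (n : ℝ) * (2 * τ))) / √(2 * Real.pi * (2 * τ))|) atTop
      (𝓝 0) := by
  set F : ℕ → ℝ → ℂ := fun n =>
    (Set.Ioc (-(Real.pi * √(n : ℝ))) (Real.pi * √n)).indicator fun t => cf μ (V n) (t / √n) with hF
  set γ : ℝ → ℂ := fun t => ((Real.exp (-(τ * t ^ 2)) : ℝ) : ℂ) with hγ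
  have hFm : ∀ n, AEStronglyMeasurable (F n) volume := fun n =>
    (((continuous_cf (hV n)).comp (continuous_id.div_const _)).aestronglyMeasurable).indicator
      measurableSet_Ioc
  have hγi : Integrable γ := by
    have := (integrable_exp_neg_mul_sq hτ).ofReal (𝕜 := ℂ)
    simp only [neg_mul] at this
    exact this
  have hFdom : ∀ᶠ n in atTop, ∀ t, ‖F n t‖ ≤ g t := by
    filter_upwards [hdom] with n hn t
    rw [hF]
    simp only [Set.indicator_apply]
    split_ifs with ht
    · exact hn t (abs_le.2 ⟨ht.1.le, ht.2⟩)
    · rw [norm_zero]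
      exact hg0 t
  have hFlim : ∀ t, Tendsto (fun n => F n t) atTop (𝓝 (γ t)) := by
    intro t
    refine (hlim t).congr' ?_
    have : Tendsto (fun n : ℕ => Real.pi * √(n : ℝ)) atTop atTop :=
      (Real.tendsto_sqrt_atTop.comp tendsto_natCast_atTop_atTop).const_mul_atTop Real.pi_pos
    filter_upwards [this.eventually_gt_atTop |t|] with n hn
    rw [hF]
    simp only
    rw [Set.indicator_of_mem]
    exact ⟨(abs_lt.1 hn).1, (abs_lt.1 hn).2.le⟩
  -- The integer x enters only through an exponential of modulus 1, so this L¹ distance bounds the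
  -- error for all x at once.
  have hJ : Tendsto (fun n => ∫ t, ‖F n t - γ t‖) atTop (𝓝 0) := by
    have h0 := tendsto_integral_filter_of_dominated_convergence (μ := volume) (l := atTop)
      (F := fun n t => ‖F n t - γ t‖) (f := fun _ => (0 : ℝ)) (fun t => g t + ‖γ t‖)
      (Eventually.of_forall fun n => ((hFm n).sub hγi.1).norm) (by
        filter_upwards [hFdom] with n hn
        refine ae_of_all _ fun t => ?_
        rw [norm_norm]
        exact (norm_sub_le _ _).trans (add_le_add_left (hn t) _)) (hg.add hγi.norm)
      (ae_of_all _ fun t => by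
        have := ((hFlim t).sub_const (γ t)).norm
        rwa [sub_self, norm_zero] at this)
    simpa using h0
  have hpi : 0 ≤ (2 * Real.pi)⁻¹ := by positivity
  refine tendsto_of_tendsto_of_tendsto_of_le_of_le' tendsto_const_nhds
    (by simpa only [mul_zero] using hJ.const_mul (2 * Real.pi)⁻¹)
    (Eventually.of_forall fun n => Real.iSup_nonneg fun x => abs_nonneg _) ?_
  filter_upwards [hFdom, eventually_ge_atTop 1] with n hn hn1
  refine Real.iSup_le (fun x => ?_) (mul_nonneg hpi (integral_nonneg fun t => norm_nonneg _))
  have hFi : Integrable (F n) := hg.mono' (hFm n) (ae_of_all _ hn)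
  have he : ∀ {G : ℝ → ℂ}, Integrable G →
      Integrable fun t : ℝ => G t * Complex.exp (((-(t / √n * x) : ℝ) : ℂ) * Complex.I) :=
    fun hG => hG.mul_bdd (c := 1) (Continuous.aestronglyMeasurable (by fun_prop))
      (ae_of_all _ fun t => by rw [Complex.norm_exp_ofReal_mul_I])
  rw [← Real.norm_eq_abs, ← Complex.norm_real, Complex.ofReal_sub,
    sqrt_mul_measureReal_eq (hV n) x hn1, gaussian_eq hτ x hn1, ← mul_sub,
    ← integral_sub (he hFi) (he hγi), norm_mul]
  gcongr
  · refine le_of_eq ?_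
    rw [norm_inv, norm_mul, Complex.norm_real, Real.norm_of_nonneg Real.pi_pos.le]
    norm_num
  · refine (norm_integral_le_integral_norm _).trans (le_of_eq ?_)
    congr 1
    ext t
    rw [← sub_mul, norm_mul, Complex.norm_exp_ofReal_mul_I, mul_one]

variable {T : X → X} {fbar : ℕ → X → ℤ} {f : X → ℤ}

theorem IsCodingSequence.satisfiesLatticeLCLT (hc : IsCodingSequence T μ fbar)
    (hT : MeasurePreserving T μ μ) (hfm : Measurable f)
    (hf : ∀ᵐ x ∂μ, ∀ᶠ M in atTop, psum T fbar 1 M x = f x) :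
    SatisfiesLatticeLCLT T μ f (2 * Real.log 2 ^ 2) := by
  have hl : 0 < Real.log 2 := Real.log_pos (by norm_num)
  obtain ⟨ε, hε, hest⟩ := hc.eventually_estimates hT hfm hf
  refine ⟨hfm, hc.memLp_limit hT hfm hf, hc.integral_limit hT hfm hf, by positivity, ?_, ?_⟩
  · have h1 : Tendsto (fun n => 2 * ((mainLen n : ℝ) / n * ∑ k ∈ mainSet n, h k)) atTop
        (𝓝 (2 * Real.log 2 ^ 2)) := by
      simpa using (tendsto_mainLen_div.mul tendsto_sum_mainSet).const_mul 2
    refine (tendsto_iff_of_dist ?_).2 h1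
    refine squeeze_zero' (Eventually.of_forall fun _ => dist_nonneg) ?_ hε
    filter_upwards [hest, eventually_ge_atTop 1] with n hn hn1
    have hn0 : (0 : ℝ) < n := by exact_mod_cast hn1
    rw [Real.dist_eq, show ∀ I Z : ℝ, I / n - 2 * ((mainLen n : ℝ) / n * Z) =
      (I - 2 * mainLen n * Z) / n by intro I Z; field_simp, abs_div, abs_of_pos hn0,
      div_le_iff₀ hn0, mul_comm (ε n)]
    exact hn.1
  · have hg : Integrable fun t : ℝ =>
        Real.exp (-((Real.log 2 / Real.pi) ^ 2 * t ^ 2)) + 4 * (1 + t ^ 2)⁻¹ := by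
      refine Integrable.add ?_ (integrable_inv_one_add_sq.const_mul 4)
      simpa only [neg_mul] using integrable_exp_neg_mul_sq
        (show 0 < (Real.log 2 / Real.pi) ^ 2 by positivity)
    refine tendsto_iSup_of_cf (fun n => measurable_birkhoffSum hT.measurable hfm n) (pow_pos hl 2) hg
      ?_ (fun t => by positivity) fun t => ?_
    · filter_upwards [hest, eventually_mainCf_le] with n hn hn' t ht
      exact (hn.2 _).1.trans (hn' t ht)
    · have h1 : Tendsto (fun n => ((mainCf (mainSet n) (mainLen n) (t / √n) : ℝ) : ℂ)) atTop
          (𝓝 ((Real.exp (-(Real.log 2 ^ 2 * t ^ 2)) : ℝ) : ℂ)) :=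
        (Complex.continuous_ofReal.tendsto _).comp (tendsto_mainCf t)
      refine (tendsto_iff_of_dist ?_).2 h1
      -- At θ = t/√n the error |θ|√(nε) + θ²nε/2 no longer contains n except through ε.
      have h2 : Tendsto (fun n => |t| * √(ε n) + t ^ 2 / 2 * ε n) atTop (𝓝 0) := by
        have := (hε.sqrt.const_mul |t|).add (hε.const_mul (t ^ 2 / 2))
        simpa using this
      refine squeeze_zero' (Eventually.of_forall fun _ => dist_nonneg) ?_ h2
      filter_upwards [hest, eventually_ge_atTop 1] with n hn hn1
      have hn0 : (0 : ℝ) < n := by exact_mod_cast hn1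
      have hs0 : 0 < √(n : ℝ) := Real.sqrt_pos.2 hn0
      have hsq : √(n : ℝ) ^ 2 = n := Real.sq_sqrt hn0.le
      rw [dist_eq_norm]
      refine (hn.2 _).2.trans (le_of_eq ?_)
      rw [abs_div, abs_of_pos hs0, Real.sqrt_mul hn0.le, div_pow, hsq]
      field_simp

end Fourier

end LatticeLCLT

theorem mainTheorem1 {X : Type*} [MeasurableSpace X] (μ : Measure X) [IsProbabilityMeasure μ]
    (T : X ≃ᵐ X) (hT : Ergodic T μ) (haper : LatticeLCLT.IsAperiodic T μ) :
    (∃ fbar : ℕ → X → ℤ, LatticeLCLT.IsCodingSequence T μ fbar) ∧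
    ∀ fbar : ℕ → X → ℤ, LatticeLCLT.IsCodingSequence T μ fbar →
      (∀ k, 2 ≤ k → ∀ x, LatticeLCLT.block T fbar k x =
        LatticeLCLT.transfer T fbar k x - LatticeLCLT.transfer T fbar k (T x)) ∧
      ∃ f : X → ℤ,
        (∀ᵐ x ∂μ, HasSum (fun k : ℕ => LatticeLCLT.block T fbar (k + 2) x) (f x)) ∧
        Tendsto (fun N : ℕ => eLpNorm (fun x => (f x : ℝ) -
          ∑ k ∈ Finset.Icc 2 N, (LatticeLCLT.block T fbar k x : ℝ)) 2 μ) atTop (𝓝 0) ∧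
        LatticeLCLT.SatisfiesLatticeLCLT T μ f (2 * Real.log 2 ^ 2) := by
  have hTp := hT.toMeasurePreserving
  refine ⟨LatticeLCLT.exists_isCodingSequence hT (haper.isAtomless hTp), fun fbar hc =>
    ⟨fun k _ x => LatticeLCLT.block_eq_transfer_sub T fbar k x, ?_⟩⟩
  obtain ⟨f, hfm, hsum, hf⟩ := hc.exists_ae_limit hTp
  refine ⟨f, hsum, ?_, hc.satisfiesLatticeLCLT hTp hfm hf⟩
  -- The shift by one turns the half-open range `Ico 2 (N + 1)` of `psum` into `Icc 2 N`.
  have h := (hc.tendsto_eLpNorm_sub hTp hf).comp (tendsto_add_atTop_nat 1)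
  refine h.congr fun N => ?_
  simp only [Function.comp, LatticeLCLT.psum_one]
  push_cast
  rfl
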